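/- Let $M$ be a connected smooth $n$-manifold ($n\ge 1$) with a Finsler structure $F:TM\to[0,\infty)$ (smooth off the zero section, positively homogeneous of degree one, with metric tensor $g_y(v,w)=\tfrac12\,\partial_s\partial_r|_{0}F^2(x,y+sv+rw)$ positive definite for $y\neq0$), and suppose that $(M,F)$ is complete (forward and backward). Let $\rho:M\to\mathbb R$ be smooth with $\rho(M)=[a,b]$, $a<b$. Let $\mathrm{grad}\,\rho$ be its Finsler gradient: it vanishes where $d\rho=0$, and elsewhere it is the nonzero vector $y$ with $g_y(y,\cdot)=d\rho$. Suppose that $\rho$ is transnormal, i.e. there is a continuous $\mathfrak b:[a,b]\to\mathbb R$ with $$g_{\mathrm{grad}\rho}(\mathrm{grad}\,\rho,\mathrm{grad}\,\rho)=\mathfrak b\circ\rho ,$$ and that $\rho$ has no critical values in $(a,b)$. For $l>0$, a horizontal geodesic on $[0,l]$ is a continuous curve $\gamma:[0,l]\to M$ with $\rho(\gamma(0))=a$ which on $(0,l)$ lies in $\rho^{-1}((a,b))$ and is an integral curve of $\mathrm{grad}\,\rho/F(\mathrm{grad}\,\rho)$. Adapted coordinates are smooth local coordinates $(u^1=t,u^2,\dots,u^n)$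 on an open subset of $\rho^{-1}((a,b))$ such that $\partial/\partial t=\mathrm{grad}\,\rho/F(\mathrm{grad}\,\rho)$ and such that each point $p$ of this subset has $t(p)>0$ and is the endpoint $\gamma(t(p))$ of a horizontal geodesic $\gamma$ on $[0,t(p)]$. Then $T:=\int_a^b ds/\sqrt{\mathfrak b(s)}$ is finite; adapted coordinates exist around every point of $\rho^{-1}((a,b))$; the coordinate $t$ is the same in all of them and extends to a continuous function $t:M\to\mathbb R$; every point of $\rho^{-1}((a,b))$ lies on a horizontal geodesic $\gamma$ on $[0,T]$ with $t(\gamma(\tau))=\tau$ for all $\tau\in[0,T]$; and: (a) $t(M)=[0,T]$, and for every $c\in[a,b]$, $\rho^{-1}(c)=\{t=\int_a^c ds/\sqrt{\mathfrak b(s)}\}$. (b) $\rho$ is a function of $t$ alone, and for $0<t<T$, that is on $\rho^{-1}((a,b))$, this function is twice differentiable, $\mathfrak b$ is differentiable at $\rho$, and $\dfrac{d^2\rho}{dt^2}=\tfrac12\,\mathfrak b'(\rho)$. (c) On $\rho^{-1}((a,b))$ the metric tensor $g=g_{\mathrm{grad}\rho}$ has in every adapted coordinate system the form $$ds^2=dt^2+\rho'^2\sum_{i,j=2}^n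 f_{ij}\,du^i\,du^j,\qquad \rho'=\frac{d\rho}{dt},$$ where $f$ is a smooth symmetric positive definite tensor on the tangent spaces $\ker d\rho$ of the regular level sets (so a metric tensor on each regular level set, which may depend on the level set), $f_{ij}=f(\partial/\partial u^i,\partial/\partial u^j)$, and $\rho'^2f$ is the metric tensor induced by $g$ on each regular level set. -/

import Mathlib

open Set Filter Topology MeasureTheory Manifold
open scoped ENNReal ContDiff

noncomputable section

namespace FinslerTransnormal

/-- The model space of an `n`-dimensional manifold. -/
abbrev Model (n : ℕ) : Type := EuclideanSpace ℝ (Fin n)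

section Finsler

variable {n : ℕ} {M : Type*} [TopologicalSpace M] [ChartedSpace (Model n) M]

/-- The metric tensor `g_y(v, w) = (1/2) ∂²/∂s∂r F²(x, y + s v + r w)` at `(x, y)`. The tangent
space at `x` is the vector space `Model n`. -/
def metricTensor (F : TangentBundle (𝓡 n) M → ℝ) (x : M) (y : TangentSpace (𝓡 n) x) :
    TangentSpace (𝓡 n) x →L[ℝ] TangentSpace (𝓡 n) x →L[ℝ] ℝ :=
  show Model n →L[ℝ] Model n →L[ℝ] ℝ from
    (1 / 2 : ℝ) • fderiv ℝ (fderiv ℝ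
      (fun z : Model n => F (⟨x, z⟩ : TangentBundle (𝓡 n) M) ^ 2)) y

/-- Finsler structures `F : TM → [0, ∞)`. -/
structure IsFinslerStructure [IsManifold (𝓡 n) ∞ M]
    (F : TangentBundle (𝓡 n) M → ℝ) : Prop where
  nonneg : ∀ v, 0 ≤ F v
  smooth : ContMDiffOn (𝓡 n).tangent 𝓘(ℝ, ℝ) ∞ F {v | v.2 ≠ 0}
  homogeneous : ∀ (x : M) (y : TangentSpace (𝓡 n) x) (c : ℝ), 0 < c →
    F ⟨x, c • y⟩ = c * F ⟨x, y⟩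
  posDef : ∀ (x : M) (y v : TangentSpace (𝓡 n) x), y ≠ 0 → v ≠ 0 → 0 < metricTensor F x y v v

/-- `γ` restricted to `[α, β]` is a piecewise smooth curve. -/
def IsPiecewiseSmooth (γ : ℝ → M) (α β : ℝ) : Prop :=
  ∃ (k : ℕ) (τ : ℕ → ℝ), Monotone τ ∧ τ 0 = α ∧ τ k = β ∧
    ∀ i < k, ContMDiffOn 𝓘(ℝ, ℝ) (𝓡 n) ∞ γ (Icc (τ i) (τ (i + 1)))

/-- The length of `γ` on `[α, β]`. -/
def finslerLength (F : TangentBundle (𝓡 n) M → ℝ) (γ : ℝ → M) (α β : ℝ) : ℝ≥0∞ :=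
  ∫⁻ s in Icc α β, ENNReal.ofReal
    (F ⟨γ s, mfderiv 𝓘(ℝ, ℝ) (𝓡 n) γ s (1 : ℝ)⟩)

/-- The (in general non-symmetric) Finsler distance from `p` to `q`. -/
def finslerDist (F : TangentBundle (𝓡 n) M → ℝ) (p q : M) : ℝ≥0∞ :=
  ⨅ (γ : ℝ → M) (α : ℝ) (β : ℝ)
    (_ : α ≤ β ∧ IsPiecewiseSmooth (n := n) γ α β ∧ γ α = p ∧ γ β = q), finslerLength F γ α β

/-- Forward and backward completeness: every forward Cauchy sequence and every backward Cauchy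
sequence of the Finsler distance converges. -/
structure IsComplete (F : TangentBundle (𝓡 n) M → ℝ) : Prop where
  forward : ∀ u : ℕ → M,
    (∀ ε : ℝ≥0∞, 0 < ε → ∃ N, ∀ i j, N ≤ i → i ≤ j → finslerDist F (u i) (u j) < ε) →
    ∃ p, Tendsto u atTop (𝓝 p)
  backward : ∀ u : ℕ → M,
    (∀ ε : ℝ≥0∞, 0 < ε → ∃ N, ∀ i j, N ≤ i → i ≤ j → finslerDist F (u j) (u i) < ε) →
    ∃ p, Tendsto u atTop (𝓝 p)

/-- The differential of `ρ` at `x`. -/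
def differential (ρ : M → ℝ) (x : M) : TangentSpace (𝓡 n) x →L[ℝ] ℝ :=
  mfderiv (𝓡 n) 𝓘(ℝ, ℝ) ρ x

def IsCriticalPoint (n : ℕ) {M : Type*} [TopologicalSpace M] [ChartedSpace (Model n) M]
    (ρ : M → ℝ) (x : M) : Prop :=
  differential (n := n) ρ x = 0

open Classical in
/-- The Finsler gradient: zero at critical points; elsewhere the (unique) nonzero vector
`y = grad ρ` with `g_y(y, v) = dρ(v)` for all `v`. -/
def grad (F : TangentBundle (𝓡 n) M → ℝ) (ρ : M → ℝ) (x : M) : TangentSpace (𝓡 n) x :=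
  if IsCriticalPoint n ρ x then 0
  else Classical.epsilon fun y : TangentSpace (𝓡 n) x =>
    y ≠ 0 ∧ ∀ v, metricTensor F x y y v = differential ρ x v

/-- The metric tensor `g_{grad ρ}` at the gradient direction. -/
def gradMetric (F : TangentBundle (𝓡 n) M → ℝ) (ρ : M → ℝ) (x : M) :
    TangentSpace (𝓡 n) x →L[ℝ] TangentSpace (𝓡 n) x →L[ℝ] ℝ :=
  metricTensor F x (grad F ρ x)

/-- `ρ` is a Finsler transnormal function with `g(grad ρ, grad ρ) = 𝔟 ∘ ρ`. -/
structure IsTransnormal (F : TangentBundle (𝓡 n) M → ℝ) (ρ : M → ℝ) (𝔟 : ℝ → ℝ) : Prop where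
  smooth : ContMDiff (𝓡 n) 𝓘(ℝ, ℝ) ∞ ρ
  continuousOn : ContinuousOn 𝔟 (range ρ)
  norm_grad : ∀ x, gradMetric F ρ x (grad F ρ x) (grad F ρ x) = 𝔟 (ρ x)

/-- The unit vector field in the direction of `grad ρ` (zero at critical points). -/
def unitGrad (F : TangentBundle (𝓡 n) M → ℝ) (ρ : M → ℝ) (x : M) : TangentSpace (𝓡 n) x :=
  (F ⟨x, grad F ρ x⟩)⁻¹ • grad F ρ x

/-- A horizontal geodesic `γ : [0, l] → M`: it starts on `ρ⁻¹(a)`, and on `(0, l)` it is an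
integral curve of `grad ρ` reparametrized by arc length, inside `ρ⁻¹(a, b)`. -/
structure IsHorizontalGeodesic (F : TangentBundle (𝓡 n) M → ℝ) (ρ : M → ℝ) (a b : ℝ)
    (γ : ℝ → M) (l : ℝ) : Prop where
  continuousOn : ContinuousOn γ (Icc 0 l)
  start : ρ (γ 0) = a
  mem : ∀ s ∈ Ioo 0 l, ρ (γ s) ∈ Ioo a b
  integralCurve : IsMIntegralCurveOn (I := 𝓡 n) γ (unitGrad F ρ) (Ioo 0 l)

end Finsler

section Adapted

variable {m : ℕ} {M : Type*} [TopologicalSpace M] [ChartedSpace (Model (m + 1)) M]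

/-- The coordinate vector field `∂/∂uⁱ` of the chart `e` at `x`. -/
def coordVec (e : OpenPartialHomeomorph M (Model (m + 1))) (i : Fin (m + 1)) (x : M) :
    TangentSpace (𝓡 (m + 1)) x :=
  show Model (m + 1) from
    mfderiv 𝓘(ℝ, Model (m + 1)) (𝓡 (m + 1)) e.symm (e x) (EuclideanSpace.single i (1 : ℝ))

/-- The value `duⁱ(v)` of the coordinate differential of the chart `e`. -/
def coordDiff (e : OpenPartialHomeomorph M (Model (m + 1))) (i : Fin (m + 1)) (x : M)
    (v : TangentSpace (𝓡 (m + 1)) x) : ℝ :=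
  (show Model (m + 1) from mfderiv (𝓡 (m + 1)) 𝓘(ℝ, Model (m + 1)) e x v) i

/-- Adapted coordinates `(t, u², …, uⁿ)` on an open subset of `ρ⁻¹(a, b)`; `t` is the coordinate
of index `0`. The coordinate lines of `t` are integral curves of `grad ρ` reparametrized by arc
length, and `t` is the parameter of the horizontal geodesic through the point, counted from
`ρ⁻¹(a)`. -/
structure IsAdaptedChart [IsManifold (𝓡 (m + 1)) ∞ M] (F : TangentBundle (𝓡 (m + 1)) M → ℝ)
    (ρ : M → ℝ) (a b : ℝ) (e : OpenPartialHomeomorph M (Model (m + 1))) : Prop where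
  mem_atlas : e ∈ IsManifold.maximalAtlas (𝓡 (m + 1)) ∞ M
  regular : ∀ x ∈ e.source, ρ x ∈ Ioo a b
  coordVec_zero : ∀ x ∈ e.source, coordVec e 0 x = unitGrad F ρ x
  parameter : ∀ x ∈ e.source, 0 < e x 0 ∧
    ∃ γ : ℝ → M, IsHorizontalGeodesic F ρ a b γ (e x 0) ∧ γ (e x 0) = x

end Adapted

end FinslerTransnormal

end

set_option linter.unusedSectionVars false

noncomputable section

/-! The whole theorem follows from one function, `t = ∫_a^ρ ds/√𝔟`. At a regular point, Euler's
relation identifies `g_y(y, ·)` with half the differential of `F²` along the fibre, so `grad ρ` is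
the inverse Legendre transform of `dρ`. Strict convexity makes this transform injective
(`legendre_injective`), and the implicit function theorem makes `grad ρ` smooth
(`contDiffAt_localGrad`). Transnormality then gives `F(grad ρ) = √(𝔟 ∘ ρ)`, so that `dρ` has the
value `√(𝔟 ∘ ρ)` on the unit gradient and `t` has derivative 1 along it. Although `𝔟` is only
assumed continuous, `t` is smooth on the regular set, since `dt = dρ / F(grad ρ)`.

Finiteness of the total time comes from the inequality `dρ(v) ≤ √𝔟(ρ) F(v)`: any continuous `g ≥ 0`
with `g √𝔟 ≤ 1` has an integral between two levels that is controlled along chains of chart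
segments, uniformly in `g`. Connectedness joins the levels `a` and `b` (`exists_integral_le`), and
exhausting `(a, b)` from inside gives integrability of `1/√𝔟`.

The unit gradient is straightened with `t` itself as first coordinate (`exists_straightening`, which
rests on a flow that is jointly smooth in time and initial point). In such a flow box, integral
curves are parallel lines. They have unit speed, so completeness gives them limits at the ends of
their intervals; as long as the limit is regular, a flow box continues the curve. Hence every
regular point lies on a curve over all of `(0, T)`, which closes up to a horizontal geodesic. Since
the parameter of any horizontal geodesic equals `t`, adapted charts and flow boxes are the same
thing, which gives the existence and the chart independence of `t`.

Part (a) is strict monotonicity of the integral. For (b), the inverse function `r` of the integral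
satisfies `r' = √𝔟(r)`, and `𝔟 ∘ ρ = F(grad ρ)²` is smooth on the regular set, so `𝔟` can be
differentiated. For (c), `g(∂/∂t, ·) = dt`, so the mixed terms vanish and `f = g/𝔟(ρ)` works. -/

namespace FinslerTransnormal

/-! ### Smooth inverse and implicit function theorems. -/

section InverseFunction

variable {E F : Type*} [NormedAddCommGroup E] [NormedSpace ℝ E] [CompleteSpace E]
  [NormedAddCommGroup F] [NormedSpace ℝ F]

/-- The inverse function theorem for functions that are smooth near a point: the local inverse is
smooth on its whole domain. -/
theorem exists_openPartialHomeomorph_contDiffAt {f : E → F} {a : E} (A : E ≃L[ℝ] F)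
    (hf : ∀ᶠ x in 𝓝 a, ContDiffAt ℝ ∞ f x) (hA : HasFDerivAt f (A : E →L[ℝ] F) a) :
    ∃ T : OpenPartialHomeomorph E F, a ∈ T.source ∧ ⇑T = f ∧
      (∀ x ∈ T.source, ContDiffAt ℝ ∞ f x) ∧ ∀ y ∈ T.target, ContDiffAt ℝ ∞ T.symm y := by
  have ha := hf.self_of_nhds
  have hcont : ContinuousAt (fderiv ℝ f) a :=
    (ha.fderiv_right (m := 0) (by simp)).continuousAt
  have hinv : ∀ᶠ x in 𝓝 a, fderiv ℝ f x ∈ range ((↑) : (E ≃L[ℝ] F) → E →L[ℝ] F) := by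
    apply hcont.eventually_mem
    rw [hA.fderiv]
    exact ContinuousLinearEquiv.nhds A
  -- Isomorphisms form an open set, so the derivative stays invertible near `a`; restricting to `W`
  -- makes the inverse smooth at every point of its domain and not only at `f a`.
  obtain ⟨W, hW, hWo, haW⟩ := eventually_nhds_iff.1 (hf.and hinv)
  let T₀ := ha.toOpenPartialHomeomorph f hA (by simp)
  have hT₀ : a ∈ T₀.source := ha.mem_toOpenPartialHomeomorph_source hA (by simp)
  refine ⟨T₀.restrOpen W hWo, ⟨hT₀, haW⟩, rfl, fun x hx => (hW x hx.2).1, fun y hy => ?_⟩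
  have hy' := (T₀.restrOpen W hWo).map_target hy
  obtain ⟨A', hA'⟩ := (hW _ hy'.2).2
  refine (T₀.restrOpen W hWo).contDiffAt_symm (f₀' := A') hy ?_ (hW _ hy'.2).1
  rw [hA']
  exact ((hW _ hy'.2).1.differentiableAt (by simp)).hasFDerivAt

/-- The implicit function theorem for functions that are smooth near a point. -/
theorem exists_implicit_contDiffAt {G : Type*} [NormedAddCommGroup G] [NormedSpace ℝ G]
    [CompleteSpace F] {f : E × F → G} {a : E} {b : F} (A : F ≃L[ℝ] G)
    (hf : ∀ᶠ p in 𝓝 (a, b), ContDiffAt ℝ ∞ f p)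
    (hA : HasFDerivAt (fun y => f (a, y)) (A : F →L[ℝ] G) b) :
    ∃ ψ : E → F, (∀ᶠ x in 𝓝 a, ContDiffAt ℝ ∞ ψ x ∧ f (x, ψ x) = f (a, b)) ∧ ψ a = b ∧
      ∀ᶠ p in 𝓝 (a, b), f p = f (a, b) → p.2 = ψ p.1 := by
  have hd := (hf.self_of_nhds.differentiableAt (by simp)).hasFDerivAt
  set L := fderiv ℝ f (a, b) with hL
  have hLA : ∀ w, L (0, w) = A w := by
    have h1 : HasFDerivAt (fun y => f (a, y)) (L.comp (ContinuousLinearMap.inr ℝ E F)) b :=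
      hd.comp b (hasFDerivAt_prodMk_right a b)
    intro w
    have := DFunLike.congr_fun (h1.unique hA) w
    simpa using this
  have hLs : ∀ v w, L (v, w) = L (v, 0) + A w := fun v w => by
    rw [← hLA, ← map_add]; simp
  let L1 : E →L[ℝ] G := L.comp (ContinuousLinearMap.inl ℝ E F)
  -- The derivative of `(x, y) ↦ (x, f (x, y))` is block triangular with the isomorphism `A` in the
  -- corner, so its inverse is `(v, z) ↦ (v, A⁻¹ (z - L (v, 0)))`.
  let B : (E × F) ≃L[ℝ] (E × G) := ContinuousLinearEquiv.equivOfInverse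
    ((ContinuousLinearMap.fst ℝ E F).prod L)
    ((ContinuousLinearMap.fst ℝ E G).prod ((A.symm : G →L[ℝ] F).comp
      (ContinuousLinearMap.snd ℝ E G - L1.comp (ContinuousLinearMap.fst ℝ E G))))
    (by
      rintro ⟨v, w⟩
      have h : L (v, w) - L (v, 0) = A w := by rw [hLs v w, add_sub_cancel_left]
      simp only [ContinuousLinearMap.prod_apply, ContinuousLinearMap.coe_fst',
        ContinuousLinearMap.comp_apply, _root_.sub_apply,
        ContinuousLinearMap.coe_snd', ContinuousLinearMap.inl_apply, L1,
        ContinuousLinearEquiv.coe_coe, h, A.symm_apply_apply]) (by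
      rintro ⟨v, w⟩
      ext
      · rfl
      · exact (hLs _ _).trans (by simp [L1]))
  have hB : HasFDerivAt (fun p : E × F => (p.1, f p)) (B : E × F →L[ℝ] E × G) (a, b) :=
    hasFDerivAt_fst.prodMk hd
  obtain ⟨T, haT, hTf, -, hTs⟩ := exists_openPartialHomeomorph_contDiffAt B
    (hf.mono fun p hp => contDiffAt_fst.prodMk hp) hB
  have hT : ∀ p, T p = (p.1, f p) := fun p => by rw [hTf]
  have hmap : Tendsto (fun x : E => (x, f (a, b))) (𝓝 a) (𝓝 (a, f (a, b))) :=
    (Continuous.prodMk_left _).tendsto' _ _ rfl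
  have htgt : ∀ᶠ x in 𝓝 a, (x, f (a, b)) ∈ T.target :=
    hmap.eventually_mem (T.open_target.mem_nhds (by
      have := T.map_source haT; rwa [hT] at this))
  refine ⟨fun x => (T.symm (x, f (a, b))).2, htgt.mono fun x hx => ⟨?_, ?_⟩, ?_, ?_⟩
  · exact ((hTs _ hx).comp x (contDiffAt_id.prodMk contDiffAt_const)).snd
  · have := T.right_inv hx
    rw [hT] at this
    have h1 : (T.symm (x, f (a, b))).1 = x := congrArg Prod.fst this
    have h2 := congrArg Prod.snd this
    dsimp at h2
    nth_rw 1 [← h1]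
    exact h2
  · have := T.left_inv haT
    rw [hT] at this
    simp [this]
  · filter_upwards [T.open_source.mem_nhds haT] with p hp hfp
    have := T.left_inv hp
    rw [hT, hfp] at this
    simp [this]

end InverseFunction

/-! ### Composition operators on spaces of continuous functions. -/

section Nemytskii

universe u
variable {K : Type*} [TopologicalSpace K] [CompactSpace K]

/-- The pointwise application of a bilinear map to continuous functions. -/
def pointwiseBilin (K : Type*) [TopologicalSpace K] [CompactSpace K] {E F G : Type*}
    [NormedAddCommGroup E] [NormedSpace ℝ E] [NormedAddCommGroup F] [NormedSpace ℝ F]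
    [NormedAddCommGroup G] [NormedSpace ℝ G] (β : G →L[ℝ] E →L[ℝ] F) :
    C(K, G) →L[ℝ] C(K, E) →L[ℝ] C(K, F) :=
  LinearMap.mkContinuous₂
    (LinearMap.mk₂ ℝ (fun (A : C(K, G)) (h : C(K, E)) =>
        (⟨fun s => β (A s) (h s),
          (β.continuous.comp A.continuous).clm_apply h.continuous⟩ : C(K, F)))
      (fun _ _ _ => by ext; simp) (fun _ _ _ => by ext; simp)
      (fun _ _ _ => by ext; simp) (fun _ _ _ => by ext; simp)) ‖β‖ (fun A h => by
    rw [ContinuousMap.norm_le _ (by positivity)]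
    intro s
    simp only [LinearMap.mk₂_apply, ContinuousMap.coe_mk]
    exact (β (A s)).le_of_opNorm_le_of_le
      (β.le_of_opNorm_le_of_le le_rfl (A.norm_coe_le_norm s)) (h.norm_coe_le_norm s))

variable {E F : Type u} [NormedAddCommGroup E] [NormedSpace ℝ E]
  [NormedAddCommGroup F] [NormedSpace ℝ F]

theorem contDiff_pointwiseBilin {G H : Type*} [NormedAddCommGroup G] [NormedSpace ℝ G]
    [NormedAddCommGroup H] [NormedSpace ℝ H] (β : G →L[ℝ] E →L[ℝ] F) {n : WithTop ℕ∞}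
    {N : H → C(K, G)} (hN : ContDiff ℝ n N) : ContDiff ℝ n (fun u => pointwiseBilin K β (N u)) :=
  (pointwiseBilin K β).contDiff.comp hN

-- Postcomposition with `g` is continuous for the uniform distance because `K` is compact. This
-- takes the place of uniform continuity of `g` near the image of `u`.
omit [NormedSpace ℝ E] in
theorem exists_forall_norm_comp_sub_comp_le {G : Type*} [NormedAddCommGroup G] (g : C(E, G))
    (u : C(K, E)) {ε : ℝ} (hε : 0 < ε) :
    ∃ δ > 0, ∀ v : C(K, E), dist v u < δ → ∀ s, ‖g (v s) - g (u s)‖ ≤ ε := by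
  have hc : ContinuousAt (fun v : C(K, E) => g.comp v) u :=
    (ContinuousMap.continuous_postcomp g).continuousAt
  obtain ⟨δ, hδ, H⟩ := Metric.continuousAt_iff.1 hc ε hε
  refine ⟨δ, hδ, fun v hv s => ?_⟩
  have h2 := H hv
  rw [dist_eq_norm] at h2
  exact (ContinuousMap.norm_coe_le_norm (g.comp v - g.comp u) s).trans h2.le

/-- The mean value inequality on the segment from `u s` to `v s` bounds the remainder by the
oscillation of `f'` there. The oscillation is at most `ε` for all `s` at once, since every `u + θ •
(v - u)` is uniformly close to `u`. -/
theorem hasFDerivAt_postcomp {f : C(E, F)} {f' : C(E, E →L[ℝ] F)}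
    (hf : ∀ x, HasFDerivAt f (f' x) x) (u : C(K, E)) :
    HasFDerivAt (fun v : C(K, E) => f.comp v)
      (pointwiseBilin K (ContinuousLinearMap.id ℝ (E →L[ℝ] F)) (f'.comp u)) u := by
  rw [hasFDerivAt_iff_isLittleO, Asymptotics.isLittleO_iff]
  intro ε hε
  obtain ⟨δ, hδ, H⟩ := exists_forall_norm_comp_sub_comp_le f' u hε
  filter_upwards [Metric.ball_mem_nhds u hδ] with v hv
  rw [ContinuousMap.norm_le _ (by positivity)]
  intro s
  have key : ‖f (v s) - f (u s) - f' (u s) (v s - u s)‖ ≤ ε * ‖v s - u s‖ := by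
    refine (convex_segment (u s) (v s)).norm_image_sub_le_of_norm_hasFDerivWithin_le'
      (f' := fun x => f' x) (fun x _ => (hf x).hasFDerivWithinAt) ?_
      (left_mem_segment ℝ _ _) (right_mem_segment ℝ _ _)
    intro x hx
    rw [segment_eq_image'] at hx
    obtain ⟨θ, hθ, rfl⟩ := hx
    refine H (u + θ • (v - u)) ?_ s
    rw [dist_eq_norm, add_sub_cancel_left, norm_smul]
    rw [Metric.mem_ball, dist_eq_norm] at hv
    refine lt_of_le_of_lt ?_ hv
    rw [Real.norm_of_nonneg hθ.1]
    exact mul_le_of_le_one_left (norm_nonneg _) hθ.2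
  exact key.trans (by gcongr; exact (v - u).norm_coe_le_norm s)

/-- Composition with a smooth map is a smooth map between spaces of continuous functions. -/
theorem contDiff_postcomp_nat (n : ℕ) : ∀ {F : Type u} [NormedAddCommGroup F] [NormedSpace ℝ F]
    {f : C(E, F)}, ContDiff ℝ n f → ContDiff ℝ n (fun v : C(K, E) => f.comp v) := by
  -- The derivative is pointwise application of the postcomposition with `f'`, whose target is `E
  -- →L[ℝ] F`. The induction therefore varies the target space, and `E` and `F` share a universe.
  induction n with
  | zero =>
    intro F _ _ f _
    simpa using ContinuousMap.continuous_postcomp f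
  | succ n ih =>
    intro F _ _ f hf
    rw [Nat.cast_add, Nat.cast_one, contDiff_succ_iff_hasFDerivAt] at hf ⊢
    obtain ⟨f', hf', hd⟩ := hf
    exact ⟨fun u => pointwiseBilin K (ContinuousLinearMap.id ℝ (E →L[ℝ] F))
        ((⟨f', hf'.continuous⟩ : C(E, E →L[ℝ] F)).comp u),
      contDiff_pointwiseBilin (ContinuousLinearMap.id ℝ (E →L[ℝ] F))
        (ih (f := ⟨f', hf'.continuous⟩) hf'),
      fun u => hasFDerivAt_postcomp (f' := ⟨f', hf'.continuous⟩) hd u⟩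

theorem contDiff_postcomp {f : C(E, F)} (hf : ContDiff ℝ ∞ f) :
    ContDiff ℝ ∞ (fun v : C(K, E) => f.comp v) := by
  rw [contDiff_infty] at hf ⊢
  exact fun n => contDiff_postcomp_nat n (hf n)

end Nemytskii

/-! ### Flows that are jointly smooth in time and initial point. -/

section Flow

variable {E : Type*} [NormedAddCommGroup E] [NormedSpace ℝ E] [CompleteSpace E]

/-- The integral `s ↦ ∫₀ˢ v` as a continuous linear map on `C([0, 1], E)`. -/
def integralCLM (E : Type*) [NormedAddCommGroup E] [NormedSpace ℝ E] [CompleteSpace E] :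
    C(unitInterval, E) →L[ℝ] C(unitInterval, E) :=
  have hint (v : C(unitInterval, E)) (x y : ℝ) :
      IntervalIntegrable (fun τ => v (projIcc 0 1 zero_le_one τ)) volume x y :=
    (v.continuous.comp continuous_projIcc).intervalIntegrable x y
  LinearMap.mkContinuous
    { toFun := fun v => ⟨fun s => ∫ τ in (0 : ℝ)..s, v (projIcc 0 1 zero_le_one τ),
        (intervalIntegral.continuous_primitive (hint v) 0).comp continuous_subtype_val⟩
      map_add' := fun v w => by
        ext s
        exact intervalIntegral.integral_add (hint v _ _) (hint w _ _)
      map_smul' := fun c v => by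
        ext s
        exact intervalIntegral.integral_smul c _ } 1 (fun v => by
    rw [ContinuousMap.norm_le _ (by positivity)]
    intro s
    have := intervalIntegral.norm_integral_le_of_norm_le_const (a := 0) (b := (s : ℝ))
      (C := ‖v‖) (f := fun τ => v (projIcc 0 1 zero_le_one τ))
      (fun τ _ => v.norm_coe_le_norm _)
    refine this.trans ?_
    rw [sub_zero, abs_of_nonneg s.2.1, one_mul]
    exact mul_le_of_le_one_right (norm_nonneg _) s.2.2)

theorem integralCLM_apply (v : C(unitInterval, E)) (s : unitInterval) :
    integralCLM E v s = ∫ τ in (0 : ℝ)..s, v (projIcc 0 1 zero_le_one τ) := rfl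

/-- A smooth vector field has a local flow that is jointly smooth in time and initial point. -/
theorem exists_contDiffAt_flow_of_contDiff {X : E → E} (hX : ContDiff ℝ ∞ X) (x₀ : E) :
    ∃ α : E × ℝ → E, ∀ᶠ p in 𝓝 (x₀, (0 : ℝ)), ContDiffAt ℝ ∞ α p ∧ α (p.1, 0) = p.1 ∧
      HasDerivAt (fun s => α (p.1, s)) (X (α p)) p.2 := by
  obtain ⟨ε, hε, a, r, L, K, hr, hpl⟩ :=
    IsPicardLindelof.of_contDiffAt_one (hX.contDiffAt (x := x₀) |>.of_le (by simp))
  obtain ⟨α, hα, hαc⟩ := (hpl 0).exists_forall_mem_closedBall_eq_hasDerivWithinAt_continuousOn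
  simp only [zero_sub, zero_add] at hα hαc
  have hder : ∀ x ∈ Metric.ball x₀ r, ∀ s ∈ Ioo (-ε) ε,
      HasDerivAt (fun s => α (x, s)) (X (α (x, s))) s := fun x hx s hs =>
    ((hα x (Metric.ball_subset_closedBall hx)).2 s (Ioo_subset_Icc_self hs)).hasDerivAt
      (Icc_mem_nhds hs.1 hs.2)
  have hα0 : ∀ x ∈ Metric.ball x₀ r, α (x, 0) = x := fun x hx =>
    (hα x (Metric.ball_subset_closedBall hx)).1
  have hscale : ∀ {l : ℝ}, l ∈ Ioo (-ε) ε → ∀ s ∈ Icc (0 : ℝ) 1, l * s ∈ Ioo (-ε) ε := by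
    intro l hl s hs
    rw [mem_Ioo, ← abs_lt] at hl ⊢
    rw [abs_mul, abs_of_nonneg hs.1]
    exact lt_of_le_of_lt (mul_le_of_le_one_right (abs_nonneg _) hs.2) hl
  -- the rescaled solutions as elements of `C([0, 1], E)`
  have hcont : ∀ p ∈ Metric.ball x₀ r ×ˢ Ioo (-ε) ε,
      Continuous (fun s : unitInterval => α (p.1, p.2 * s)) := by
    rintro ⟨x, l⟩ ⟨hx, hl⟩
    rw [continuous_iff_continuousAt]
    intro s
    exact ContinuousAt.comp (g := fun s => α (x, s)) (f := fun s : unitInterval => l * s)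
      (hder x hx _ (hscale hl s s.2)).continuousAt (by fun_prop)
  classical
  let u : E × ℝ → C(unitInterval, E) := fun p =>
    if hp : p ∈ Metric.ball x₀ r ×ˢ Ioo (-ε) ε then ⟨_, hcont p hp⟩ else 0
  have hball : Metric.ball x₀ r ×ˢ Ioo (-ε) ε ∈ 𝓝 (x₀, (0 : ℝ)) :=
    prod_mem_nhds (Metric.ball_mem_nhds _ hr) (Ioo_mem_nhds (by linarith) hε)
  -- The rescaled solutions tend uniformly to the constant `x₀`; this brings them into the
  -- neighbourhood in which the implicit function theorem gives uniqueness.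
  have hu : Tendsto u (𝓝 (x₀, (0 : ℝ))) (𝓝 (ContinuousMap.const _ x₀)) := by
    rw [Metric.tendsto_nhds]
    intro η hη
    have h0 : ContinuousAt α (x₀, 0) := hαc.continuousAt
      (prod_mem_nhds (Metric.closedBall_mem_nhds _ hr) (Icc_mem_nhds (by linarith) hε))
    have h1 : ∀ᶠ p in 𝓝 (x₀, (0 : ℝ)), dist (α p) x₀ < η := by
      have := Metric.tendsto_nhds.1 h0 η hη
      rwa [hα0 x₀ (Metric.mem_ball_self hr)] at this
    rw [nhds_prod_eq, Filter.eventually_prod_iff] at h1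
    obtain ⟨pa, hpa, pb, hpb, h1⟩ := h1
    obtain ⟨δ, hδ, hpb⟩ := Metric.eventually_nhds_iff.1 hpb
    filter_upwards [hball, prod_mem_nhds hpa (Metric.ball_mem_nhds (0 : ℝ) hδ)] with p hp hp'
    rw [ContinuousMap.dist_lt_iff hη]
    intro s
    simp only [u, dif_pos hp, ContinuousMap.coe_mk, ContinuousMap.const_apply]
    refine h1 hp'.1 (hpb ?_)
    have h2 := hp'.2
    simp only [Metric.mem_ball, dist_zero_right, norm_mul, Real.norm_eq_abs] at h2 ⊢
    rw [abs_of_nonneg s.2.1]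
    exact lt_of_le_of_lt (mul_le_of_le_one_right (abs_nonneg _) s.2.2) h2
  let NX : C(unitInterval, E) → C(unitInterval, E) := fun v =>
    (⟨X, hX.continuous⟩ : C(E, E)).comp v
  have hNX : ContDiff ℝ ∞ NX := contDiff_postcomp hX
  -- The zeros of `Ψ ((x, l), ·)` are the solutions of `v s = x + l ∫₀ˢ X(v)`, that is, of the
  -- integral equation for `s ↦ α (x, l s)`. Rescaling to `[0, 1]` turns time into a parameter, and
  -- at `l = 0` the derivative in `v` is the identity.
  let Ψ : (E × ℝ) × C(unitInterval, E) → C(unitInterval, E) := fun q =>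
    q.2 - ContinuousLinearMap.const ℝ unitInterval q.1.1 - q.1.2 • integralCLM E (NX q.2)
  have hΨ : ContDiff ℝ ∞ Ψ := by
    have h1 : ContDiff ℝ ∞ (fun q : (E × ℝ) × C(unitInterval, E) => integralCLM E (NX q.2)) :=
      (integralCLM E).contDiff.comp (hNX.comp contDiff_snd)
    have h2 : ContDiff ℝ ∞ (fun q : (E × ℝ) × C(unitInterval, E) =>
        (ContinuousLinearMap.const ℝ unitInterval q.1.1 : C(unitInterval, E))) :=
      (ContinuousLinearMap.contDiff _).comp (contDiff_fst.comp contDiff_fst)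
    exact (contDiff_snd.sub h2).sub ((contDiff_snd.comp contDiff_fst).smul h1)
  have hΨ0 : Ψ ((x₀, 0), ContinuousMap.const _ x₀) = 0 := by
    ext s; simp [Ψ]
  obtain ⟨ψ, hψ, -, hψu⟩ := exists_implicit_contDiffAt (f := Ψ) (a := (x₀, (0 : ℝ)))
    (b := ContinuousMap.const unitInterval x₀) (ContinuousLinearEquiv.refl ℝ _)
    (Eventually.of_forall fun p => hΨ.contDiffAt) (by
      have : (fun y => Ψ ((x₀, (0 : ℝ)), y)) =
          fun y => y - ContinuousLinearMap.const ℝ unitInterval x₀ := by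
        funext y; simp [Ψ]
      rw [this]
      exact (hasFDerivAt_id _).sub_const _)
  have huΨ : ∀ p ∈ Metric.ball x₀ r ×ˢ Ioo (-ε) ε, Ψ (p, u p) = 0 := by
    rintro ⟨x, l⟩ hp
    obtain ⟨hx, hl⟩ := hp
    have hul : ∀ s : unitInterval, u (x, l) s = α (x, l * s) := fun s => by
      simp only [u]; rw [dif_pos ⟨hx, hl⟩]; rfl
    ext s
    have h1 : ∫ τ in (0 : ℝ)..s, l • X (α (x, l * τ)) = α (x, l * s) - α (x, l * 0) := by
      apply intervalIntegral.integral_eq_sub_of_hasDerivAt (f := fun τ => α (x, l * τ))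
      · intro τ hτ
        rw [uIcc_of_le s.2.1] at hτ
        have := (hder x hx _ (hscale hl τ ⟨hτ.1, hτ.2.trans s.2.2⟩)).scomp τ
          ((hasDerivAt_id τ).const_mul l)
        simpa [Function.comp_def] using this
      · apply ContinuousOn.intervalIntegrable
        intro τ hτ
        rw [uIcc_of_le s.2.1] at hτ
        have h2 := (hder x hx _ (hscale hl τ ⟨hτ.1, hτ.2.trans s.2.2⟩)).continuousAt
        have h3 : ContinuousAt (fun τ => α (x, l * τ)) τ :=
          ContinuousAt.comp (g := fun s => α (x, s)) (f := fun τ => l * τ) h2 (by fun_prop)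
        exact ((hX.continuous.continuousAt.comp h3).const_smul l).continuousWithinAt
    have h2 : ∫ τ in (0 : ℝ)..s, NX (u (x, l)) (projIcc 0 1 zero_le_one τ) =
        ∫ τ in (0 : ℝ)..s, X (α (x, l * τ)) := by
      apply intervalIntegral.integral_congr
      intro τ hτ
      rw [uIcc_of_le s.2.1] at hτ
      simp only [NX, ContinuousMap.comp_apply, ContinuousMap.coe_mk, hul]
      rw [projIcc_of_mem zero_le_one ⟨hτ.1, hτ.2.trans s.2.2⟩]
    simp only [Ψ, ContinuousMap.sub_apply, ContinuousMap.smul_apply, integralCLM_apply, h2, hul,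
      ContinuousMap.zero_apply]
    rw [← intervalIntegral.integral_smul, h1, mul_zero, hα0 x hx]
    simp
  -- The flow at time `l` is the rescaled solution evaluated at 1, and evaluation is a continuous
  -- linear map.
  have heq : ∀ᶠ p in 𝓝 (x₀, (0 : ℝ)), α p = ψ p ⟨1, by simp⟩ := by
    have h1 : Tendsto (fun p => (p, u p)) (𝓝 (x₀, (0 : ℝ)))
        (𝓝 ((x₀, (0 : ℝ)), ContinuousMap.const _ x₀)) := tendsto_id.prodMk_nhds hu
    filter_upwards [h1.eventually hψu, hball] with p hp hpb
    rw [← hp (by rw [huΨ p hpb, hΨ0])]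
    simp only [u]
    rw [dif_pos hpb]
    simp
  refine ⟨α, ?_⟩
  filter_upwards [heq.eventually_nhds, hψ, hball] with p hp1 hp2 hp3
  refine ⟨?_, hα0 _ hp3.1, hder _ hp3.1 _ hp3.2⟩
  refine ContDiffAt.congr_of_eventuallyEq ?_ hp1
  exact (ContinuousMap.evalCLM ℝ (⟨1, by simp⟩ : unitInterval)).contDiff.contDiffAt.comp p hp2.1

/-- A bump function around `x₀` makes the vector field globally smooth. For initial points near `x₀`
and small times, the flow stays where the bump function equals 1. -/
theorem exists_contDiffAt_flow [FiniteDimensional ℝ E] {X : E → E} {x₀ : E}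
    (hX : ∀ᶠ x in 𝓝 x₀, ContDiffAt ℝ ∞ X x) :
    ∃ α : E × ℝ → E, ∀ᶠ p in 𝓝 (x₀, (0 : ℝ)), ContDiffAt ℝ ∞ α p ∧ α (p.1, 0) = p.1 ∧
      HasDerivAt (fun s => α (p.1, s)) (X (α p)) p.2 := by
  obtain ⟨δ, hδ, hXδ⟩ := Metric.eventually_nhds_iff_ball.1 hX
  let χ : ContDiffBump x₀ := ⟨δ / 4, δ / 2, by positivity, by linarith⟩
  have hsm : ContDiff ℝ ∞ (fun x => χ x • X x) := by
    rw [contDiff_iff_contDiffAt]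
    intro x
    by_cases hx : x ∈ Metric.ball x₀ δ
    · exact χ.contDiff.contDiffAt.smul (hXδ x hx)
    · have h1 : x ∉ tsupport χ := by
        rw [χ.tsupport_eq]
        intro h
        apply hx
        exact Metric.closedBall_subset_ball (by simp [χ]; linarith) h
      refine contDiffAt_const (c := (0 : E)) |>.congr_of_eventuallyEq ?_
      filter_upwards [(isClosed_tsupport χ).isOpen_compl.mem_nhds h1] with y hy
      rw [image_eq_zero_of_notMem_tsupport hy, zero_smul]
  obtain ⟨α, hα⟩ := exists_contDiffAt_flow_of_contDiff hsm x₀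
  refine ⟨α, ?_⟩
  have hx := hα.self_of_nhds
  have hc : Tendsto α (𝓝 (x₀, 0)) (𝓝 x₀) := by
    have := hx.1.continuousAt.tendsto
    rwa [hx.2.1] at this
  filter_upwards [hα, hc.eventually χ.eventuallyEq_one] with p hp hp1
  refine ⟨hp.1, hp.2.1, ?_⟩
  have := hp.2.2
  rw [hp1] at this
  simpa using this

end Flow

/-! ### Minkowski norms and Legendre duality. -/

section Minkowski

variable {E : Type*} [NormedAddCommGroup E] [NormedSpace ℝ E]

/-- Half the second derivative of `Φ²`. -/
def fundamentalTensor (Φ : E → ℝ) (y : E) : E →L[ℝ] E →L[ℝ] ℝ :=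
  (1 / 2 : ℝ) • fderiv ℝ (fderiv ℝ (fun z => Φ z ^ 2)) y

/-- The Legendre transform, half the first derivative of `Φ²`. -/
def legendre (Φ : E → ℝ) (y : E) : E →L[ℝ] ℝ := (1 / 2 : ℝ) • fderiv ℝ (fun z => Φ z ^ 2) y

/-- A (not necessarily symmetric) Minkowski norm. -/
structure IsMinkowskiNorm (Φ : E → ℝ) : Prop where
  nonneg : ∀ v, 0 ≤ Φ v
  smooth : ∀ y, y ≠ 0 → ContDiffAt ℝ ∞ Φ y
  homogeneous : ∀ (y : E) (c : ℝ), 0 < c → Φ (c • y) = c * Φ y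
  posDef : ∀ y v, y ≠ 0 → v ≠ 0 → 0 < fundamentalTensor Φ y v v

namespace IsMinkowskiNorm

variable {Φ : E → ℝ} (h : IsMinkowskiNorm Φ)
include h

theorem contDiffAt_sq {y : E} (hy : y ≠ 0) : ContDiffAt ℝ ∞ (fun z => Φ z ^ 2) y :=
  (h.smooth y hy).pow 2

theorem hasFDerivAt_sq {y : E} (hy : y ≠ 0) :
    HasFDerivAt (fun z => Φ z ^ 2) ((2 : ℝ) • legendre Φ y) y := by
  simpa [legendre, smul_smul] using ((h.contDiffAt_sq hy).differentiableAt (by simp)).hasFDerivAt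

theorem hasFDerivAt_legendre {y : E} (hy : y ≠ 0) :
    HasFDerivAt (legendre Φ) (fundamentalTensor Φ y) y :=
  ((((h.contDiffAt_sq hy).fderiv_right (m := ∞) (by simp)).differentiableAt
    (by simp)).hasFDerivAt).const_smul (1 / 2 : ℝ)

theorem map_zero : Φ 0 = 0 := by
  have := h.homogeneous 0 2 two_pos
  rw [smul_zero] at this
  linarith

theorem symm {y : E} (hy : y ≠ 0) (v w : E) :
    fundamentalTensor Φ y v w = fundamentalTensor Φ y w v := by
  have := ((h.contDiffAt_sq hy).isSymmSndFDerivAt (by simp; exact WithTop.coe_le_coe.2 le_top)).eq v w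
  simp only [fundamentalTensor, smul_apply, this]

theorem legendre_smul {y : E} (hy : y ≠ 0) {c : ℝ} (hc : 0 < c) :
    legendre Φ (c • y) = c • legendre Φ y := by
  have h1 : HasFDerivAt (fun z => Φ (c • z) ^ 2)
      (((2 : ℝ) • legendre Φ (c • y)).comp (c • ContinuousLinearMap.id ℝ E)) y :=
    (h.hasFDerivAt_sq (smul_ne_zero hc.ne' hy)).comp y ((hasFDerivAt_id y).const_smul c)
  have h2 : (fun z => Φ (c • z) ^ 2) = fun z => c ^ 2 * Φ z ^ 2 := by
    funext z; rw [h.homogeneous z c hc]; ring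
  rw [h2] at h1
  have h3 := h1.unique ((h.hasFDerivAt_sq hy).const_mul (c ^ 2))
  ext v
  have h4 := DFunLike.congr_fun h3 v
  simp at h4
  simp only [smul_apply, smul_eq_mul]
  have : 2 * c * legendre Φ (c • y) v = 2 * c * (c * legendre Φ y v) := by linarith
  exact mul_left_cancel₀ (by positivity) this

/-- Euler's relation for the Legendre transform. -/
theorem fundamentalTensor_self {y : E} (hy : y ≠ 0) : fundamentalTensor Φ y y = legendre Φ y := by
  have h1 : HasDerivAt (fun c : ℝ => legendre Φ (c • y)) (fundamentalTensor Φ y y) 1 := by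
    have h0 : HasFDerivAt (legendre Φ) (fundamentalTensor Φ y) ((1 : ℝ) • y) := by
      rw [one_smul]; exact h.hasFDerivAt_legendre hy
    have := h0.comp_hasDerivAt (1 : ℝ) ((hasDerivAt_id (1 : ℝ)).smul_const y)
    simpa [Function.comp_def] using this
  have h2 : HasDerivAt (fun c : ℝ => c • legendre Φ y) (legendre Φ y) 1 := by
    simpa using (hasDerivAt_id (1 : ℝ)).smul_const (legendre Φ y)
  refine h1.unique (h2.congr_of_eventuallyEq ?_)
  filter_upwards [lt_mem_nhds zero_lt_one] with c hc
  exact h.legendre_smul hy hc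

theorem legendre_self {y : E} (hy : y ≠ 0) : legendre Φ y y = Φ y ^ 2 := by
  have h1 : HasDerivAt (fun c : ℝ => Φ (c • y) ^ 2) (2 * legendre Φ y y) 1 := by
    have h0 : HasFDerivAt (fun z => Φ z ^ 2) ((2 : ℝ) • legendre Φ y) ((1 : ℝ) • y) := by
      rw [one_smul]; exact h.hasFDerivAt_sq hy
    have := h0.comp_hasDerivAt (1 : ℝ) ((hasDerivAt_id (1 : ℝ)).smul_const y)
    simpa [Function.comp_def] using this
  have h2 : HasDerivAt (fun c : ℝ => c ^ 2 * Φ y ^ 2) (2 * Φ y ^ 2) 1 := by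
    simpa using (hasDerivAt_pow 2 (1 : ℝ)).mul_const (Φ y ^ 2)
  have := h1.unique (h2.congr_of_eventuallyEq (by
    filter_upwards [lt_mem_nhds zero_lt_one] with c hc
    rw [h.homogeneous y c hc]; ring))
  linarith

/-- By Euler's relations, `Φ y ^ 2` is the value of the fundamental tensor at `y` on the pair `(y,
y)`. -/
theorem pos {y : E} (hy : y ≠ 0) : 0 < Φ y := by
  have h1 := h.posDef y y hy hy
  rw [h.fundamentalTensor_self hy, h.legendre_self hy] at h1
  exact lt_of_le_of_ne (h.nonneg y) (fun h0 => by rw [← h0] at h1; simp at h1)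

/-- Along the segment from `y` to `z`, the Legendre transform paired with `z - y` has derivative
`g(z - y, z - y) > 0`, so its end values differ. If the segment meets the origin, where nothing is
differentiable, pairing the common covector with `(1 - s) y + s z = 0` gives `(1 - s) Φ(y)² + s
Φ(z)² = 0`, which is impossible. -/
theorem legendre_injective {y z : E} (hy : y ≠ 0) (hz : z ≠ 0)
    (hyz : legendre Φ y = legendre Φ z) : y = z := by
  by_contra hne
  have hw : z - y ≠ 0 := sub_ne_zero.2 (Ne.symm hne)
  by_cases h0 : ∃ s ∈ Icc (0 : ℝ) 1, y + s • (z - y) = 0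
  · obtain ⟨s, hs, h0⟩ := h0
    have h1 : (1 - s) • y + s • z = 0 := by
      rw [← h0]; module
    have h2 := congrArg (legendre Φ y) h1
    simp only [map_add, map_smul, _root_.map_zero, smul_eq_mul] at h2
    rw [h.legendre_self hy, hyz, h.legendre_self hz] at h2
    have p1 : 0 < Φ y ^ 2 := pow_pos (h.pos hy) 2
    have p2 : 0 < Φ z ^ 2 := pow_pos (h.pos hz) 2
    rcases eq_or_lt_of_le hs.1 with h3 | h3
    · rw [← h3] at h2; simp at h2; exact p1.ne' (by simp [h2])
    · have := mul_pos h3 p2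
      have := mul_nonneg (sub_nonneg.2 hs.2) p1.le
      linarith
  · push Not at h0
    have hd : ∀ s ∈ Icc (0 : ℝ) 1, HasDerivAt (fun s : ℝ => legendre Φ (y + s • (z - y)) (z - y))
        (fundamentalTensor Φ (y + s • (z - y)) (z - y) (z - y)) s := by
      intro s hs
      have h1 : HasDerivAt (fun s : ℝ => y + s • (z - y)) (z - y) s := by
        simpa using ((hasDerivAt_id s).smul_const (z - y)).const_add y
      have h2 := (h.hasFDerivAt_legendre (h0 s hs)).comp_hasDerivAt s h1
      simpa using h2.clm_apply (hasDerivAt_const s (z - y))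
    obtain ⟨s, hs, hs'⟩ := exists_hasDerivAt_eq_slope
      (fun s : ℝ => legendre Φ (y + s • (z - y)) (z - y)) _ zero_lt_one
      (fun s hs => (hd s hs).continuousAt.continuousWithinAt)
      (fun s hs => hd s (Ioo_subset_Icc_self hs))
    have := h.posDef _ _ (h0 s (Ioo_subset_Icc_self hs)) hw
    rw [hs'] at this
    simp [hyz] at this

/-- Every nonzero covector is the Legendre transform of a vector, which maximises it. -/
theorem exists_legendre_eq [FiniteDimensional ℝ E] {ξ : E →L[ℝ] ℝ} (hξ : ξ ≠ 0) :
    ∃ y, y ≠ 0 ∧ legendre Φ y = ξ ∧ ∀ v, ξ v ≤ Φ y * Φ v := by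
  obtain ⟨v₀, hv₀⟩ : ∃ v, 0 < ξ v := by
    obtain ⟨v, hv⟩ := ContinuousLinearMap.exists_ne_zero hξ
    rcases lt_or_gt_of_ne hv with h1 | h1
    · exact ⟨-v, by simpa using h1⟩
    · exact ⟨v, h1⟩
  have hv₀0 : v₀ ≠ 0 := by rintro rfl; simp at hv₀
  have hne0 : ∀ v ∈ Metric.sphere (0 : E) 1, v ≠ 0 := by
    rintro v hv rfl; simp at hv
  have hnorm : ∀ v : E, v ≠ 0 → ‖v‖⁻¹ • v ∈ Metric.sphere (0 : E) 1 := fun v hv => by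
    simp [norm_smul, hv]
  -- Maximise `ξ / Φ` on the unit sphere. By homogeneity the maximum `k` gives `ξ ≤ k Φ` everywhere,
  -- so `y₀` is a minimum of `k Φ - ξ`, and hence `ξ = k dΦ(y₀)`.
  obtain ⟨y₀, hy₀, hmax⟩ := (isCompact_sphere (0 : E) 1).exists_isMaxOn ⟨_, hnorm v₀ hv₀0⟩
    (f := fun v => ξ v / Φ v) (fun v hv => (ξ.continuous.continuousAt.div
      (h.smooth v (hne0 v hv)).continuousAt (h.pos (hne0 v hv)).ne').continuousWithinAt)
  have hy0 := hne0 y₀ hy₀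
  set k := ξ y₀ / Φ y₀ with hk
  have hle : ∀ v, v ≠ 0 → ξ v ≤ k * Φ v := by
    intro v hv
    have h1 : ξ (‖v‖⁻¹ • v) / Φ (‖v‖⁻¹ • v) ≤ k := hmax (hnorm v hv)
    have hn : 0 < ‖v‖⁻¹ := inv_pos.2 (norm_pos_iff.2 hv)
    rw [h.homogeneous v _ hn, map_smul, smul_eq_mul, mul_div_mul_left _ _ hn.ne',
      div_le_iff₀ (h.pos hv)] at h1
    exact h1
  have hkpos : 0 < k := by
    have := hv₀.trans_le (hle v₀ hv₀0)
    exact pos_of_mul_pos_left this (h.nonneg _)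
  have hΦd := ((h.smooth y₀ hy0).differentiableAt (by simp)).hasFDerivAt
  have hcrit : k • fderiv ℝ Φ y₀ - ξ = 0 := by
    refine IsLocalMin.hasFDerivAt_eq_zero (f := fun v => k * Φ v - ξ v) (a := y₀) ?_
      ((hΦd.const_mul k).sub ξ.hasFDerivAt)
    filter_upwards [isOpen_compl_singleton.mem_nhds hy0] with v hv
    have h1 := hle v hv
    have h2 : k * Φ y₀ = ξ y₀ := div_mul_cancel₀ _ (h.pos hy0).ne'
    linarith
  have hc : 0 < k / Φ y₀ := div_pos hkpos (h.pos hy0)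
  have hleg : legendre Φ y₀ = Φ y₀ • fderiv ℝ Φ y₀ := by
    have h1 := (h.hasFDerivAt_sq hy0).unique (hΦd.pow 2)
    have h2 : legendre Φ y₀ = (1 / 2 : ℝ) • ((2 : ℝ) • legendre Φ y₀) := by
      rw [smul_smul]; norm_num
    rw [h2, h1, smul_smul]
    congr 1
    simp
  -- The Legendre transform of `y₀` is `Φ(y₀) dΦ(y₀)`; the factor `k / Φ y₀` corrects it to `k
  -- dΦ(y₀) = ξ`. The rescaled vector has norm `k`, so `ξ ≤ k Φ` is the required bound.
  refine ⟨(k / Φ y₀) • y₀, smul_ne_zero hc.ne' hy0, ?_, fun v => ?_⟩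
  · rw [h.legendre_smul hy0 hc, hleg, smul_smul, div_mul_cancel₀ _ (h.pos hy0).ne']
    exact sub_eq_zero.1 hcrit
  · rw [h.homogeneous _ _ hc, div_mul_cancel₀ _ (h.pos hy0).ne']
    rcases eq_or_ne v 0 with rfl | hv
    · simp [h.map_zero]
    · exact hle v hv

/-- Existence supplies some vector with this covector for which the inequality holds, and
injectivity says that this vector is `y`. -/
theorem legendre_le [FiniteDimensional ℝ E] {y : E} (hy : y ≠ 0) (v : E) :
    legendre Φ y v ≤ Φ y * Φ v := by
  have hξ : legendre Φ y ≠ 0 := by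
    intro h0
    have := h.legendre_self hy
    rw [h0] at this
    exact (pow_pos (h.pos hy) 2).ne (by simpa using this)
  obtain ⟨z, hz, hzy, hle⟩ := h.exists_legendre_eq hξ
  obtain rfl := h.legendre_injective hz hy hzy
  exact hle v

/-- The fundamental tensor as a linear isomorphism onto the dual space. -/
theorem exists_fundamentalTensor_equiv [FiniteDimensional ℝ E] {y : E} (hy : y ≠ 0) :
    ∃ A : E ≃L[ℝ] (E →L[ℝ] ℝ), (A : E →L[ℝ] E →L[ℝ] ℝ) = fundamentalTensor Φ y := by
  have hinj : Function.Injective (fundamentalTensor Φ y) := by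
    rw [injective_iff_map_eq_zero]
    intro v hv
    by_contra hv0
    have := h.posDef y v hy hv0
    simp [hv] at this
  have hfin : Module.finrank ℝ E = Module.finrank ℝ (E →L[ℝ] ℝ) := by
    rw [← LinearMap.toContinuousLinearMap.finrank_eq (R := ℝ) (M := E →ₗ[ℝ] ℝ),
      Subspace.dual_finrank_eq]
  exact ⟨(LinearEquiv.ofInjectiveOfFinrankEq (fundamentalTensor Φ y).toLinearMap hinj
    hfin).toContinuousLinearEquiv, by ext; rfl⟩

end IsMinkowskiNorm

end Minkowski

/-! ### Minkowski norms under linear isomorphisms. -/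

section MinkowskiComp

variable {E E' : Type*} [NormedAddCommGroup E] [NormedSpace ℝ E]
  [NormedAddCommGroup E'] [NormedSpace ℝ E']

theorem IsMinkowskiNorm.legendre_comp {Φ : E → ℝ} (h : IsMinkowskiNorm Φ) (A : E' ≃L[ℝ] E)
    {w : E'} (hw : w ≠ 0) (v : E') :
    legendre (fun w => Φ (A w)) w v = legendre Φ (A w) (A v) := by
  have hA : A w ≠ 0 := by simpa using hw
  have h1 := (h.hasFDerivAt_sq hA).comp w A.hasFDerivAt
  have h2 : fderiv ℝ (fun w => Φ (A w) ^ 2) w = _ := h1.fderiv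
  simp only [legendre] at h2 ⊢
  rw [h2]
  simp

theorem IsMinkowskiNorm.fundamentalTensor_comp {Φ : E → ℝ} (h : IsMinkowskiNorm Φ)
    (A : E' ≃L[ℝ] E) {w : E'} (hw : w ≠ 0) (v₁ v₂ : E') :
    fundamentalTensor (fun w => Φ (A w)) w v₁ v₂ =
      fundamentalTensor Φ (A w) (A v₁) (A v₂) := by
  have hA : A w ≠ 0 := by simpa using hw
  have h1 : HasFDerivAt (fun w => (legendre Φ (A w)).comp (A : E' →L[ℝ] E))
      (((ContinuousLinearMap.compL ℝ E' E ℝ).flip (A : E' →L[ℝ] E)).comp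
        ((fundamentalTensor Φ (A w)).comp (A : E' →L[ℝ] E))) w :=
    ((ContinuousLinearMap.compL ℝ E' E ℝ).flip (A : E' →L[ℝ] E)).hasFDerivAt.comp w
      ((h.hasFDerivAt_legendre hA).comp w A.hasFDerivAt)
  have h2 : (legendre fun w => Φ (A w)) =ᶠ[𝓝 w]
      fun w => (legendre Φ (A w)).comp (A : E' →L[ℝ] E) := by
    filter_upwards [isOpen_compl_singleton.mem_nhds hw] with z hz
    ext v
    exact h.legendre_comp A hz v
  have h3 := h1.congr_of_eventuallyEq h2
  have h4 : fundamentalTensor (fun w => Φ (A w)) w = fderiv ℝ (legendre fun w => Φ (A w)) w := by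
    have hd : DifferentiableAt ℝ (fderiv ℝ (fun w => Φ (A w) ^ 2)) w :=
      (((h.contDiffAt_sq hA).comp w A.contDiff.contDiffAt).fderiv_right (m := ∞)
        (by simp)).differentiableAt (by simp)
    exact (hd.hasFDerivAt.const_smul (1 / 2 : ℝ)).fderiv.symm
  rw [h4, h3.fderiv]
  rfl

theorem IsMinkowskiNorm.comp {Φ : E → ℝ} (h : IsMinkowskiNorm Φ) (A : E' ≃L[ℝ] E) :
    IsMinkowskiNorm (fun w => Φ (A w)) where
  nonneg v := h.nonneg _
  smooth y hy := (h.smooth _ (by simpa using hy)).comp y A.contDiff.contDiffAt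
  homogeneous y c hc := by rw [map_smul, h.homogeneous _ _ hc]
  posDef y v hy hv := by
    rw [h.fundamentalTensor_comp A hy]
    exact h.posDef _ _ (by simpa using hy) (by simpa using hv)

end MinkowskiComp

/-! ### The Finsler structure in a chart. -/

section Coordinates

variable {n : ℕ} {M : Type*} [TopologicalSpace M] [ChartedSpace (Model n) M]
  [IsManifold (𝓡 n) ∞ M]

/-- The derivative of the inverse of a chart, in terms of the model space. -/
def frame (e : OpenPartialHomeomorph M (Model n)) (u : Model n) : Model n →L[ℝ] Model n :=
  show Model n →L[ℝ] Model n from mfderiv 𝓘(ℝ, Model n) (𝓡 n) e.symm u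

/-- The derivative of a chart, in terms of the model space. -/
def coframe (e : OpenPartialHomeomorph M (Model n)) (x : M) : Model n →L[ℝ] Model n :=
  show Model n →L[ℝ] Model n from mfderiv (𝓡 n) 𝓘(ℝ, Model n) e x

variable {e : OpenPartialHomeomorph M (Model n)}

omit [IsManifold (𝓡 n) ∞ M] in
theorem mdifferentiable_of_mem_maximalAtlas (he : e ∈ IsManifold.maximalAtlas (𝓡 n) ∞ M) :
    e.MDifferentiable (𝓡 n) (𝓡 n) :=
  ⟨(contMDiffOn_of_mem_maximalAtlas he).mdifferentiableOn (by simp),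
    (contMDiffOn_symm_of_mem_maximalAtlas he).mdifferentiableOn (by simp)⟩

omit [IsManifold (𝓡 n) ∞ M] in
theorem frame_coframe (he : e ∈ IsManifold.maximalAtlas (𝓡 n) ∞ M) {x : M} (hx : x ∈ e.source)
    (v : Model n) : frame e (e x) (coframe e x v) = v :=
  DFunLike.congr_fun ((mdifferentiable_of_mem_maximalAtlas he).symm_comp_deriv hx) v

omit [IsManifold (𝓡 n) ∞ M] in
theorem coframe_frame (he : e ∈ IsManifold.maximalAtlas (𝓡 n) ∞ M) {u : Model n}
    (hu : u ∈ e.target) (v : Model n) : coframe e (e.symm u) (frame e u v) = v :=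
  DFunLike.congr_fun ((mdifferentiable_of_mem_maximalAtlas he).comp_symm_deriv hu) v

/-- `frame e u` as an isomorphism. -/
def frameEquiv (he : e ∈ IsManifold.maximalAtlas (𝓡 n) ∞ M) {u : Model n} (hu : u ∈ e.target) :
    Model n ≃L[ℝ] Model n :=
  ContinuousLinearEquiv.equivOfInverse (frame e u) (coframe e (e.symm u))
    (coframe_frame he hu) (fun v => by
      have := frame_coframe he (e.map_target hu) v
      rwa [e.right_inv hu] at this)

omit [IsManifold (𝓡 n) ∞ M] in
theorem frameEquiv_apply (he : e ∈ IsManifold.maximalAtlas (𝓡 n) ∞ M) {u : Model n}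
    (hu : u ∈ e.target) (v : Model n) : frameEquiv he hu v = frame e u v := rfl

/-- This is the tangent map of `e.symm`, with the tangent bundle of the model space written as a
product. It transfers smoothness of `F` on the tangent bundle to `localF`. -/
theorem contMDiffOn_frame (he : e ∈ IsManifold.maximalAtlas (𝓡 n) ∞ M) :
    ContMDiffOn 𝓘(ℝ, Model n × Model n) (𝓡 n).tangent ∞
      (fun p : Model n × Model n => (⟨e.symm p.1, frame e p.1 p.2⟩ : TangentBundle (𝓡 n) M))
      (e.target ×ˢ univ) := by
  have h1 := (contMDiffOn_symm_of_mem_maximalAtlas he).contMDiffOn_tangentMapWithin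
    (m := ∞) (by simp) e.open_target.uniqueMDiffOn
  have h2 : ContMDiff 𝓘(ℝ, Model n × Model n) (𝓡 n).tangent ∞
      (fun p : Model n × Model n => (⟨p.1, p.2⟩ : TangentBundle (𝓡 n) (Model n))) := by
    have := contMDiff_tangentBundleModelSpaceHomeomorph_symm (I := 𝓡 n) (n := ∞)
    have h0 : ContMDiff 𝓘(ℝ, Model n × Model n) ((𝓡 n).prod 𝓘(ℝ, Model n)) ∞
        (fun p : Model n × Model n => (p.1, p.2)) :=
      contDiff_fst.contMDiff.prodMk contDiff_snd.contMDiff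
    rw [chartedSpaceSelf_prod] at h0
    exact this.comp h0
  refine (h1.comp (s := e.target ×ˢ univ) h2.contMDiffOn (fun p hp => hp.1)).congr ?_
  intro p hp
  simp only [Function.comp_apply, tangentMapWithin, frame]
  congr 1
  rw [mfderivWithin_of_isOpen e.open_target hp.1]
  rfl

/-- The Finsler structure in the coordinates `e`. -/
def localF (F : TangentBundle (𝓡 n) M → ℝ) (e : OpenPartialHomeomorph M (Model n))
    (p : Model n × Model n) : ℝ :=
  F ⟨e.symm p.1, frame e p.1 p.2⟩

variable {F : TangentBundle (𝓡 n) M → ℝ}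

omit [IsManifold (𝓡 n) ∞ M] in
theorem frame_ne_zero (he : e ∈ IsManifold.maximalAtlas (𝓡 n) ∞ M) {u : Model n}
    (hu : u ∈ e.target) {w : Model n} (hw : w ≠ 0) : frame e u w ≠ 0 := by
  rw [← frameEquiv_apply he hu]
  simpa using hw

theorem contDiffAt_localF (hF : IsFinslerStructure F)
    (he : e ∈ IsManifold.maximalAtlas (𝓡 n) ∞ M) {p : Model n × Model n}
    (hp : p.1 ∈ e.target) (hp' : p.2 ≠ 0) : ContDiffAt ℝ ∞ (localF F e) p := by
  have hopen : IsOpen (e.target ×ˢ ({0}ᶜ : Set (Model n))) :=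
    e.open_target.prod isOpen_compl_singleton
  have h1 := hF.smooth.comp (s := e.target ×ˢ ({0}ᶜ : Set (Model n)))
    ((contMDiffOn_frame he).mono (prod_mono_right (subset_univ _)))
    (fun p hp => frame_ne_zero he hp.1 hp.2)
  exact (contMDiffOn_iff_contDiffOn.1 h1).contDiffAt (hopen.mem_nhds ⟨hp, hp'⟩)

/-- The Finsler structure on a tangent space. -/
def fiberF (F : TangentBundle (𝓡 n) M → ℝ) (x : M) (z : Model n) : ℝ :=
  F (⟨x, z⟩ : TangentBundle (𝓡 n) M)

/-- Only smoothness needs an argument: on one fibre, `F` is its expression in a chart with the base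
point fixed, composed with the inverse of the frame. -/
theorem isMinkowskiNorm_fiberF (hF : IsFinslerStructure F) (x : M) :
    IsMinkowskiNorm (fiberF F x) where
  nonneg v := hF.nonneg _
  smooth y hy := by
    have he : chartAt (Model n) x ∈ IsManifold.maximalAtlas (𝓡 n) ∞ M :=
      IsManifold.chart_mem_maximalAtlas x
    have hu := mem_chart_target (Model n) x
    have h1 : ContDiffAt ℝ ∞ (localF F (chartAt (Model n) x))
        (chartAt (Model n) x x, (frameEquiv he hu).symm y) :=
      contDiffAt_localF hF he hu (by simpa using hy)
    have h2 := ContDiffAt.comp y (f := fun z => (chartAt (Model n) x x, (frameEquiv he hu).symm z))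
      h1 (contDiffAt_const.prodMk (frameEquiv he hu).symm.contDiff.contDiffAt)
    refine h2.congr_of_eventuallyEq (Eventually.of_forall fun z => ?_)
    simp only [Function.comp_apply, localF, fiberF]
    rw [← frameEquiv_apply he hu, ContinuousLinearEquiv.apply_symm_apply,
      OpenPartialHomeomorph.left_inv _ (mem_chart_source (Model n) x)]
  homogeneous y c hc := hF.homogeneous x y c hc
  posDef y v hy hv := hF.posDef x y v hy hv

omit [IsManifold (𝓡 n) ∞ M] in
theorem localF_eq (u w : Model n) : localF F e (u, w) = fiberF F (e.symm u) (frame e u w) := rfl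

theorem isMinkowskiNorm_localF (hF : IsFinslerStructure F)
    (he : e ∈ IsManifold.maximalAtlas (𝓡 n) ∞ M) {u : Model n} (hu : u ∈ e.target) :
    IsMinkowskiNorm (fun w => localF F e (u, w)) :=
  (isMinkowskiNorm_fiberF hF (e.symm u)).comp (frameEquiv he hu)

theorem legendre_localF (hF : IsFinslerStructure F)
    (he : e ∈ IsManifold.maximalAtlas (𝓡 n) ∞ M) {u : Model n} (hu : u ∈ e.target)
    {w : Model n} (hw : w ≠ 0) (v : Model n) :
    legendre (fun w => localF F e (u, w)) w v =
      legendre (fiberF F (e.symm u)) (frame e u w) (frame e u v) :=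
  (isMinkowskiNorm_fiberF hF (e.symm u)).legendre_comp (frameEquiv he hu) hw v

theorem fundamentalTensor_localF (hF : IsFinslerStructure F)
    (he : e ∈ IsManifold.maximalAtlas (𝓡 n) ∞ M) {u : Model n} (hu : u ∈ e.target)
    {w : Model n} (hw : w ≠ 0) (v₁ v₂ : Model n) :
    fundamentalTensor (fun w => localF F e (u, w)) w v₁ v₂ =
      metricTensor F (e.symm u) (frame e u w) (frame e u v₁) (frame e u v₂) :=
  (isMinkowskiNorm_fiberF hF (e.symm u)).fundamentalTensor_comp (frameEquiv he hu) hw v₁ v₂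

/-- Smoothness holds jointly in base point and vector, as is needed to solve the Legendre equation
for the gradient by the implicit function theorem. -/
theorem contDiffAt_legendre_localF (hF : IsFinslerStructure F)
    (he : e ∈ IsManifold.maximalAtlas (𝓡 n) ∞ M) {p : Model n × Model n}
    (hp : p.1 ∈ e.target) (hp' : p.2 ≠ 0) :
    ContDiffAt ℝ ∞ (fun p : Model n × Model n => legendre (fun w => localF F e (p.1, w)) p.2) p := by
  refine ContDiffAt.const_smul (1 / 2 : ℝ) ?_
  refine ContDiffAt.fderiv (m := ∞) (n := ∞)
    (f := fun (q : Model n × Model n) (w : Model n) => localF F e (q.1, w) ^ 2) ?_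
    contDiffAt_snd (by simp)
  refine ContDiffAt.pow ?_ 2
  exact ContDiffAt.comp (p, p.2) (g := localF F e)
    (f := fun q : (Model n × Model n) × Model n => (q.1.1, q.2)) (contDiffAt_localF hF he hp hp')
    (by fun_prop)

theorem contDiffAt_fundamentalTensor_localF (hF : IsFinslerStructure F)
    (he : e ∈ IsManifold.maximalAtlas (𝓡 n) ∞ M) {p : Model n × Model n}
    (hp : p.1 ∈ e.target) (hp' : p.2 ≠ 0) :
    ContDiffAt ℝ ∞
      (fun p : Model n × Model n => fundamentalTensor (fun w => localF F e (p.1, w)) p.2) p := by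
  have h0 : ∀ q : Model n × Model n, q.1 ∈ e.target → q.2 ≠ 0 →
      fundamentalTensor (fun w => localF F e (q.1, w)) q.2 =
        fderiv ℝ (fun w => legendre (fun w => localF F e (q.1, w)) w) q.2 := fun q hq hq' =>
    ((isMinkowskiNorm_localF hF he hq).hasFDerivAt_legendre hq').fderiv.symm
  have hopen : e.target ×ˢ ({0}ᶜ : Set (Model n)) ∈ 𝓝 p :=
    (e.open_target.prod isOpen_compl_singleton).mem_nhds ⟨hp, hp'⟩
  refine ContDiffAt.congr_of_eventuallyEq ?_ (by
    filter_upwards [hopen] with q hq using h0 q hq.1 hq.2)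
  refine ContDiffAt.fderiv (m := ∞) (n := ∞)
    (f := fun (q : Model n × Model n) w => legendre (fun w => localF F e (q.1, w)) w)
    ?_ contDiffAt_snd (by simp)
  exact ContDiffAt.comp (p, p.2)
    (g := fun p : Model n × Model n => legendre (fun w => localF F e (p.1, w)) p.2)
    (f := fun q : (Model n × Model n) × Model n => (q.1.1, q.2))
    (contDiffAt_legendre_localF hF he hp hp') (by fun_prop)

/-! ### Existence and smoothness of the Finsler gradient. -/

section Gradient

variable {ρ : M → ℝ}

/-- The defining property of the Finsler gradient. -/
theorem grad_spec (hF : IsFinslerStructure F) {x : M} (hx : ¬ IsCriticalPoint n ρ x) :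
    (grad F ρ x : Model n) ≠ 0 ∧ legendre (fiberF F x) (grad F ρ x) = differential ρ x := by
  have h := isMinkowskiNorm_fiberF hF x
  -- Euler's relation turns the quadratic-looking condition `g_y(y, ·) = dρ` into the Legendre
  -- equation, which has a solution because `dρ ≠ 0`.
  have hiff : ∀ y : Model n, y ≠ 0 →
      ((∀ v : Model n, metricTensor F x y y v = differential ρ x v) ↔
        legendre (fiberF F x) y = differential ρ x) := by
    intro y hy
    rw [← h.fundamentalTensor_self hy]
    exact ⟨fun h => ContinuousLinearMap.ext h, fun h v => DFunLike.congr_fun h v⟩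
  have hex : ∃ y : TangentSpace (𝓡 n) x,
      y ≠ 0 ∧ ∀ v, metricTensor F x y y v = differential ρ x v := by
    obtain ⟨y, hy, hyl, -⟩ := h.exists_legendre_eq (ξ := differential ρ x) hx
    exact ⟨y, hy, (hiff y hy).2 hyl⟩
  have := Classical.epsilon_spec hex
  rw [grad, if_neg hx]
  exact ⟨this.1, (hiff _ this.1).1 this.2⟩

/-- The Finsler gradient in the coordinates `e`. -/
def localGrad (F : TangentBundle (𝓡 n) M → ℝ) (ρ : M → ℝ) (e : OpenPartialHomeomorph M (Model n))
    (u : Model n) : Model n :=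
  coframe e (e.symm u) (grad F ρ (e.symm u))

omit [IsManifold (𝓡 n) ∞ M] in
theorem frame_localGrad (he : e ∈ IsManifold.maximalAtlas (𝓡 n) ∞ M) {u : Model n}
    (hu : u ∈ e.target) : frame e u (localGrad F ρ e u) = grad F ρ (e.symm u) :=
  (frameEquiv he hu).apply_symm_apply _

omit [IsManifold (𝓡 n) ∞ M] in
theorem hasFDerivAt_comp_symm (he : e ∈ IsManifold.maximalAtlas (𝓡 n) ∞ M) {u : Model n}
    (hu : u ∈ e.target) (hρ : MDifferentiableAt (𝓡 n) 𝓘(ℝ, ℝ) ρ (e.symm u)) :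
    HasFDerivAt (ρ ∘ e.symm)
      ((show Model n →L[ℝ] ℝ from differential ρ (e.symm u)).comp (frame e u)) u := by
  have h1 := ((mdifferentiable_of_mem_maximalAtlas he).mdifferentiableAt_symm hu).hasMFDerivAt
  exact (hρ.hasMFDerivAt.comp u h1).hasFDerivAt

omit [IsManifold (𝓡 n) ∞ M] in
theorem contDiffAt_comp_symm (he : e ∈ IsManifold.maximalAtlas (𝓡 n) ∞ M) {u : Model n}
    (hu : u ∈ e.target) (hρ : ContMDiff (𝓡 n) 𝓘(ℝ, ℝ) ∞ ρ) : ContDiffAt ℝ ∞ (ρ ∘ e.symm) u := by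
  rw [← contMDiffAt_iff_contDiffAt]
  exact hρ.contMDiffAt.comp u (contMDiffAt_symm_of_mem_maximalAtlas he hu)

theorem localGrad_ne_zero (hF : IsFinslerStructure F)
    (he : e ∈ IsManifold.maximalAtlas (𝓡 n) ∞ M) {u : Model n}
    (hu : u ∈ e.target) (hx : ¬ IsCriticalPoint n ρ (e.symm u)) : localGrad F ρ e u ≠ 0 := by
  intro h0
  have := frame_localGrad (F := F) (ρ := ρ) he hu
  rw [h0, map_zero] at this
  exact (grad_spec hF hx).1 this.symm

theorem legendre_localGrad (hF : IsFinslerStructure F)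
    (he : e ∈ IsManifold.maximalAtlas (𝓡 n) ∞ M) {u : Model n}
    (hu : u ∈ e.target) (hρ : MDifferentiableAt (𝓡 n) 𝓘(ℝ, ℝ) ρ (e.symm u))
    (hx : ¬ IsCriticalPoint n ρ (e.symm u)) :
    legendre (fun w => localF F e (u, w)) (localGrad F ρ e u) = fderiv ℝ (ρ ∘ e.symm) u := by
  rw [(hasFDerivAt_comp_symm he hu hρ).fderiv]
  ext v
  rw [legendre_localF hF he hu (localGrad_ne_zero hF he hu hx), frame_localGrad he hu,
    (grad_spec hF hx).2]
  rfl

theorem eq_localGrad (hF : IsFinslerStructure F)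
    (he : e ∈ IsManifold.maximalAtlas (𝓡 n) ∞ M) {u : Model n}
    (hu : u ∈ e.target) (hρ : MDifferentiableAt (𝓡 n) 𝓘(ℝ, ℝ) ρ (e.symm u))
    (hx : ¬ IsCriticalPoint n ρ (e.symm u)) {w : Model n} (hw : w ≠ 0)
    (hwl : legendre (fun w => localF F e (u, w)) w = fderiv ℝ (ρ ∘ e.symm) u) :
    w = localGrad F ρ e u :=
  (isMinkowskiNorm_localF hF he hu).legendre_injective hw (localGrad_ne_zero hF he hu hx)
    (hwl.trans (legendre_localGrad hF he hu hρ hx).symm)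

/-- The Finsler gradient is smooth near regular points. -/
theorem contDiffAt_localGrad (hF : IsFinslerStructure F)
    (he : e ∈ IsManifold.maximalAtlas (𝓡 n) ∞ M) (hρ : ContMDiff (𝓡 n) 𝓘(ℝ, ℝ) ∞ ρ)
    {u₀ : Model n} (hu₀ : u₀ ∈ e.target) (hx : ¬ IsCriticalPoint n ρ (e.symm u₀)) :
    ContDiffAt ℝ ∞ (localGrad F ρ e) u₀ := by
  set w₀ := localGrad F ρ e u₀ with hw₀
  have hw₀0 : w₀ ≠ 0 := localGrad_ne_zero hF he hu₀ hx
  have hρ' : ∀ u, MDifferentiableAt (𝓡 n) 𝓘(ℝ, ℝ) ρ (e.symm u) := fun u =>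
    hρ.mdifferentiableAt (by simp)
  -- The gradient solves `f (u, w) = 0`. The derivative of `f` in `w` is the fundamental tensor, an
  -- isomorphism by positive definiteness.
  let f : Model n × Model n → (Model n →L[ℝ] ℝ) := fun p =>
    legendre (fun w => localF F e (p.1, w)) p.2 - fderiv ℝ (ρ ∘ e.symm) p.1
  have hopen : e.target ×ˢ ({0}ᶜ : Set (Model n)) ∈ 𝓝 (u₀, w₀) :=
    (e.open_target.prod isOpen_compl_singleton).mem_nhds ⟨hu₀, hw₀0⟩
  have hf0 : f (u₀, w₀) = 0 := sub_eq_zero.2 (legendre_localGrad hF he hu₀ (hρ' _) hx)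
  have hf : ∀ᶠ p in 𝓝 (u₀, w₀), ContDiffAt ℝ ∞ f p := by
    filter_upwards [hopen] with p hp
    refine (contDiffAt_legendre_localF hF he hp.1 hp.2).sub ?_
    exact ((contDiffAt_comp_symm he hp.1 hρ).fderiv_right (m := ∞) (by simp)).comp p contDiffAt_fst
  obtain ⟨A, hA⟩ := (isMinkowskiNorm_localF hF he hu₀).exists_fundamentalTensor_equiv hw₀0
  obtain ⟨ψ, hψ, hψ0, -⟩ := exists_implicit_contDiffAt A hf (by
    rw [hA]
    exact ((isMinkowskiNorm_localF hF he hu₀).hasFDerivAt_legendre hw₀0).sub_const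
      (fderiv ℝ (ρ ∘ e.symm) u₀))
  have hreg : ∀ᶠ u in 𝓝 u₀, fderiv ℝ (ρ ∘ e.symm) u ≠ 0 := by
    refine ((contDiffAt_comp_symm he hu₀ hρ).fderiv_right (m := ∞)
      (by simp)).continuousAt.eventually_ne ?_
    intro h0
    have := (isMinkowskiNorm_localF hF he hu₀).legendre_self hw₀0
    rw [hw₀, legendre_localGrad hF he hu₀ (hρ' _) hx, h0] at this
    exact (pow_pos ((isMinkowskiNorm_localF hF he hu₀).pos hw₀0) 2).ne (by simpa using this)
  refine hψ.self_of_nhds.1.congr_of_eventuallyEq ?_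
  have hc : ContinuousAt ψ u₀ := hψ.self_of_nhds.1.continuousAt
  filter_upwards [hψ, e.open_target.mem_nhds hu₀, hreg,
    hc.eventually_ne (show ψ u₀ ≠ 0 by rwa [hψ0])] with u h1 h2 h3 h4
  -- The implicit solution `ψ u` is a nonzero solution of the Legendre equation, so global
  -- uniqueness identifies it with the gradient; continuity of the gradient is not needed
  -- beforehand.
  refine (eq_localGrad hF he h2 (hρ' _) (fun hcr => h3 ?_) h4 ?_).symm
  · rw [(hasFDerivAt_comp_symm he h2 (hρ' _)).fderiv]
    have h5 : differential ρ (e.symm u) = 0 := hcr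
    rw [h5]
    rfl
  · exact sub_eq_zero.1 (h1.2.trans hf0)

end Gradient

end Coordinates

/-! ### One-dimensional motion with speed `√𝔟`. -/

section TravelTime

variable {𝔟 : ℝ → ℝ} {a b : ℝ}

/-- The time needed to get from `a` to `c` at speed `√𝔟`. -/
def travelTime (𝔟 : ℝ → ℝ) (a c : ℝ) : ℝ := ∫ s in a..c, 1 / √(𝔟 s)

/-- The position at a given time of the motion on `[a, b]` with speed `√𝔟`. -/
def travelPosition (𝔟 : ℝ → ℝ) (a b : ℝ) : ℝ → ℝ :=
  Function.invFunOn (travelTime 𝔟 a) (Icc a b)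

/-- A continuous speed `√𝔟` on `[a, b]` that is positive inside and needs a finite time. -/
structure IsFiniteTimeSpeed (𝔟 : ℝ → ℝ) (a b : ℝ) : Prop where
  lt : a < b
  continuousOn : ContinuousOn 𝔟 (Icc a b)
  pos : ∀ s ∈ Ioo a b, 0 < 𝔟 s
  integrable : IntervalIntegrable (fun s => 1 / √(𝔟 s)) volume a b

/-- If the integrals of all continuous functions below `1/√𝔟` are uniformly bounded, then `1/√𝔟`
is integrable. -/
theorem intervalIntegrable_of_forall_integral_le (hab : a < b) (hc : ContinuousOn 𝔟 (Icc a b))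
    (hpos : ∀ s ∈ Ioo a b, 0 < 𝔟 s) {C : ℝ}
    (hC : ∀ g : ℝ → ℝ, Continuous g → (∀ s, 0 ≤ g s) → (∀ s ∈ Icc a b, g s * √(𝔟 s) ≤ 1) →
      ∫ s in a..b, g s ≤ C) :
    IntervalIntegrable (fun s => 1 / √(𝔟 s)) volume a b := by
  rw [intervalIntegrable_iff_integrableOn_Ioc_of_le hab.le]
  have hsub : ∀ c ∈ Ioo a b, ∀ d ∈ Ioo a b, Icc c d ⊆ Ioo a b := fun c hc d hd s hs =>
    ⟨hc.1.trans_le hs.1, hs.2.trans_lt hd.2⟩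
  have hcts : ∀ c ∈ Ioo a b, ∀ d ∈ Ioo a b, ContinuousOn (fun s => 1 / √(𝔟 s)) (Icc c d) := by
    intro c hc' d hd
    refine continuousOn_const.div ((hc.mono ?_).sqrt) ?_
    · exact (hsub c hc' d hd).trans Ioo_subset_Icc_self
    · intro s hs
      exact (Real.sqrt_pos.2 (hpos s (hsub c hc' d hd hs))).ne'
  -- approach the interval from inside
  have hA : ∃ A : ℕ → ℝ, (∀ k, A k ∈ Ioo a b) ∧ Tendsto A atTop (𝓝 a) := by
    obtain ⟨A, -, hA, hA'⟩ := exists_seq_strictAnti_tendsto' hab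
    exact ⟨A, hA, hA'⟩
  have hB : ∃ B : ℕ → ℝ, (∀ k, B k ∈ Ioo a b) ∧ Tendsto B atTop (𝓝 b) := by
    obtain ⟨B, -, hB, hB'⟩ := exists_seq_strictMono_tendsto' hab
    exact ⟨B, hB, hB'⟩
  obtain ⟨A, hA, hA'⟩ := hA
  obtain ⟨B, hB, hB'⟩ := hB
  have hle : ∀ᶠ k in atTop, A k < B k := hA'.eventually_lt hB' hab
  refine integrableOn_Ioc_of_intervalIntegral_norm_bounded (I := C)
    (fun k => ((hcts _ (hA k) _ (hB k)).integrableOn_Icc).mono_set Ioc_subset_Icc_self) hA' hB' ?_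
  filter_upwards [hle] with k hk
  obtain ⟨m, hm, hmin⟩ := isCompact_Icc.exists_isMinOn (nonempty_Icc.2 hk.le)
    (hc.mono ((hsub _ (hA k) _ (hB k)).trans Ioo_subset_Icc_self))
  have hε : 0 < 𝔟 m := hpos m (hsub _ (hA k) _ (hB k) hm)
  -- Capping `𝔟` from below by its minimum on `[A k, B k]` gives a continuous function that equals
  -- `1/√𝔟` on that interval and satisfies `g √𝔟 ≤ 1` on `[a, b]`, including at ends where `𝔟`
  -- vanishes.
  let g : ℝ → ℝ := fun s => 1 / √(max (IccExtend hab.le (fun s : Icc a b => 𝔟 s) s) (𝔟 m))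
  have hgpos : ∀ s, 0 < √(max (IccExtend hab.le (fun s : Icc a b => 𝔟 s) s) (𝔟 m)) := fun s =>
    Real.sqrt_pos.2 (hε.trans_le (le_max_right _ _))
  have hgc : Continuous g := by
    have h1 : Continuous (IccExtend hab.le (fun s : Icc a b => 𝔟 s)) :=
      (continuousOn_iff_continuous_domRestrict.1 hc).Icc_extend'
    exact continuous_const.div (h1.max continuous_const).sqrt (fun s => (hgpos s).ne')
  have h0 : ∀ s, 0 ≤ g s := fun s => by positivity
  have h1 : ∀ s ∈ Icc a b, g s * √(𝔟 s) ≤ 1 := by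
    intro s hs
    simp only [g]
    rw [div_mul_eq_mul_div, one_mul, div_le_one (hgpos s)]
    apply Real.sqrt_le_sqrt
    rw [IccExtend_of_mem _ _ hs]
    exact le_max_left _ _
  refine le_trans ?_ (hC g hgc h0 h1)
  rw [← intervalIntegral.integral_of_le hk.le]
  calc ∫ s in (A k)..(B k), ‖1 / √(𝔟 s)‖ = ∫ s in (A k)..(B k), g s := by
        apply intervalIntegral.integral_congr
        intro s hs
        rw [uIcc_of_le hk.le] at hs
        have hs' := Ioo_subset_Icc_self (hsub _ (hA k) _ (hB k) hs)
        simp only [g]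
        rw [Real.norm_of_nonneg (by positivity), IccExtend_of_mem _ _ hs', max_eq_left (hmin hs)]
    _ ≤ ∫ s in a..b, g s := by
        apply intervalIntegral.integral_mono_interval (hA k).1.le hk.le (hB k).2.le
        · exact Eventually.of_forall h0
        · exact hgc.intervalIntegrable _ _

namespace IsFiniteTimeSpeed

variable (h : IsFiniteTimeSpeed 𝔟 a b)
include h

theorem continuousOn_travelTime : ContinuousOn (travelTime 𝔟 a) (Icc a b) := by
  rw [← uIcc_of_le h.lt.le]
  exact intervalIntegral.continuousOn_primitive_interval' h.integrable left_mem_uIcc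

theorem hasDerivAt_travelTime {c : ℝ} (hc : c ∈ Ioo a b) :
    HasDerivAt (travelTime 𝔟 a) (1 / √(𝔟 c)) c := by
  have hcont : ∀ s ∈ Ioo a b, ContinuousAt (fun s => 1 / √(𝔟 s)) s := fun s hs =>
    continuousAt_const.div (h.continuousOn.continuousAt (Icc_mem_nhds hs.1 hs.2)).sqrt
      (Real.sqrt_pos.2 (h.pos s hs)).ne'
  refine intervalIntegral.integral_hasDerivAt_right
    (h.integrable.mono_set ?_) ?_ (hcont c hc)
  · rw [uIcc_of_le hc.1.le, uIcc_of_le h.lt.le]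
    exact Icc_subset_Icc_right hc.2.le
  · exact ContinuousAt.stronglyMeasurableAtFilter isOpen_Ioo hcont c hc

theorem strictMonoOn_travelTime : StrictMonoOn (travelTime 𝔟 a) (Icc a b) := by
  refine strictMonoOn_of_deriv_pos (convex_Icc a b) h.continuousOn_travelTime ?_
  intro c hc
  rw [interior_Icc] at hc
  rw [(h.hasDerivAt_travelTime hc).deriv]
  exact one_div_pos.2 (Real.sqrt_pos.2 (h.pos c hc))

omit h in
theorem travelTime_left : travelTime 𝔟 a a = 0 := intervalIntegral.integral_same

theorem image_travelTime : travelTime 𝔟 a '' Icc a b = Icc 0 (travelTime 𝔟 a b) := by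
  have := h.continuousOn_travelTime.image_Icc_of_monotoneOn h.lt.le
    h.strictMonoOn_travelTime.monotoneOn
  rwa [travelTime_left] at this

theorem travelTime_pos : 0 < travelTime 𝔟 a b := by
  have := h.strictMonoOn_travelTime (left_mem_Icc.2 h.lt.le) (right_mem_Icc.2 h.lt.le) h.lt
  rwa [travelTime_left] at this

theorem travelPosition_travelTime {c : ℝ} (hc : c ∈ Icc a b) :
    travelPosition 𝔟 a b (travelTime 𝔟 a c) = c :=
  h.strictMonoOn_travelTime.injOn.leftInvOn_invFunOn hc

theorem travelPosition_mem {τ : ℝ} (hτ : τ ∈ Icc 0 (travelTime 𝔟 a b)) :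
    travelPosition 𝔟 a b τ ∈ Icc a b := by
  rw [← h.image_travelTime] at hτ
  exact Function.invFunOn_mem hτ

theorem travelTime_travelPosition {τ : ℝ} (hτ : τ ∈ Icc 0 (travelTime 𝔟 a b)) :
    travelTime 𝔟 a (travelPosition 𝔟 a b τ) = τ := by
  rw [← h.image_travelTime] at hτ
  exact Function.invFunOn_eq hτ

theorem travelTime_mem_Ioo {c : ℝ} (hc : c ∈ Icc a b) :
    travelTime 𝔟 a c ∈ Ioo 0 (travelTime 𝔟 a b) ↔ c ∈ Ioo a b := by
  have h1 := h.strictMonoOn_travelTime.lt_iff_lt (left_mem_Icc.2 h.lt.le) hc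
  have h2 := h.strictMonoOn_travelTime.lt_iff_lt hc (right_mem_Icc.2 h.lt.le)
  rw [travelTime_left] at h1
  rw [mem_Ioo, mem_Ioo, h1, h2]

theorem travelPosition_mem_Ioo {τ : ℝ} (hτ : τ ∈ Ioo 0 (travelTime 𝔟 a b)) :
    travelPosition 𝔟 a b τ ∈ Ioo a b := by
  rw [← h.travelTime_mem_Ioo (h.travelPosition_mem (Ioo_subset_Icc_self hτ)),
    h.travelTime_travelPosition (Ioo_subset_Icc_self hτ)]
  exact hτ

/-- The motion inverts the travel time, whose derivative `1/√𝔟` is nonzero. Continuity of the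
inverse comes from monotonicity together with its image being a neighbourhood. -/
theorem hasDerivAt_travelPosition {τ : ℝ} (hτ : τ ∈ Ioo 0 (travelTime 𝔟 a b)) :
    HasDerivAt (travelPosition 𝔟 a b) (√(𝔟 (travelPosition 𝔟 a b τ))) τ := by
  have hr := h.travelPosition_mem_Ioo hτ
  have hmono : StrictMonoOn (travelPosition 𝔟 a b) (Ioo 0 (travelTime 𝔟 a b)) := by
    intro x hx y hy hxy
    rw [← h.strictMonoOn_travelTime.lt_iff_lt (h.travelPosition_mem (Ioo_subset_Icc_self hx))
      (h.travelPosition_mem (Ioo_subset_Icc_self hy)),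
      h.travelTime_travelPosition (Ioo_subset_Icc_self hx),
      h.travelTime_travelPosition (Ioo_subset_Icc_self hy)]
    exact hxy
  have hcont : ContinuousAt (travelPosition 𝔟 a b) τ := by
    refine hmono.continuousAt_of_image_mem_nhds (Ioo_mem_nhds hτ.1 hτ.2) ?_
    refine mem_of_superset (Ioo_mem_nhds hr.1 hr.2) fun c hc => ?_
    exact ⟨travelTime 𝔟 a c, (h.travelTime_mem_Ioo (Ioo_subset_Icc_self hc)).2 hc,
      h.travelPosition_travelTime (Ioo_subset_Icc_self hc)⟩
  have h1 := HasDerivAt.of_local_left_inverse hcont (h.hasDerivAt_travelTime hr)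
    (one_div_pos.2 (Real.sqrt_pos.2 (h.pos _ hr))).ne' (by
      filter_upwards [Ioo_mem_nhds hτ.1 hτ.2] with x hx
      exact h.travelTime_travelPosition (Ioo_subset_Icc_self hx))
  simpa using h1

/-- Differentiating `√(𝔟 ∘ r)` produces the factor `r' = √(𝔟 ∘ r)`, which cancels the root in the
denominator. -/
theorem hasDerivAt_deriv_travelPosition {τ : ℝ} (hτ : τ ∈ Ioo 0 (travelTime 𝔟 a b))
    (hd : DifferentiableAt ℝ 𝔟 (travelPosition 𝔟 a b τ)) :
    HasDerivAt (deriv (travelPosition 𝔟 a b))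
      (1 / 2 * deriv 𝔟 (travelPosition 𝔟 a b τ)) τ := by
  have hpos := Real.sqrt_pos.2 (h.pos _ (h.travelPosition_mem_Ioo hτ))
  have h1 := (hd.hasDerivAt.comp τ (h.hasDerivAt_travelPosition hτ)).sqrt
    (h.pos _ (h.travelPosition_mem_Ioo hτ)).ne'
  have h2 : deriv (travelPosition 𝔟 a b) =ᶠ[𝓝 τ]
      fun τ => √((𝔟 ∘ travelPosition 𝔟 a b) τ) := by
    filter_upwards [Ioo_mem_nhds hτ.1 hτ.2] with x hx
    exact (h.hasDerivAt_travelPosition hx).deriv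
  refine (h1.congr_of_eventuallyEq h2).congr_deriv ?_
  simp only [Function.comp_apply]
  field_simp

/-- `𝔟` is differentiable where its composition with the motion is. -/
theorem differentiableAt_of_comp_travelPosition {τ : ℝ} (hτ : τ ∈ Ioo 0 (travelTime 𝔟 a b))
    (hd : DifferentiableAt ℝ (fun τ => 𝔟 (travelPosition 𝔟 a b τ)) τ) :
    DifferentiableAt ℝ 𝔟 (travelPosition 𝔟 a b τ) := by
  have hr := h.travelPosition_mem_Ioo hτ
  have h1 := (h.hasDerivAt_travelTime hr).differentiableAt
  have h2 : DifferentiableAt ℝ (fun τ => 𝔟 (travelPosition 𝔟 a b τ))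
      (travelTime 𝔟 a (travelPosition 𝔟 a b τ)) := by
    rwa [h.travelTime_travelPosition (Ioo_subset_Icc_self hτ)]
  refine (h2.comp _ h1).congr_of_eventuallyEq ?_
  filter_upwards [Ioo_mem_nhds hr.1 hr.2] with c hc
  simp only [Function.comp_apply]
  rw [h.travelPosition_travelTime (Ioo_subset_Icc_self hc)]

end IsFiniteTimeSpeed

end TravelTime

/-! ### Transnormal functions and finiteness of the total travel time. -/

section Regular

variable {n : ℕ} {M : Type*} [TopologicalSpace M] [ChartedSpace (Model n) M]
  [IsManifold (𝓡 n) ∞ M] {F : TangentBundle (𝓡 n) M → ℝ} {ρ : M → ℝ} {𝔟 : ℝ → ℝ} {a b : ℝ}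

/-- A transnormal function with range `[a, b]` and without critical values in `(a, b)`. -/
structure IsRegularTransnormal (F : TangentBundle (𝓡 n) M → ℝ) (ρ : M → ℝ) (𝔟 : ℝ → ℝ)
    (a b : ℝ) : Prop where
  finsler : IsFinslerStructure F
  transnormal : IsTransnormal F ρ 𝔟
  lt : a < b
  range_eq : range ρ = Icc a b
  regular : ∀ x, ρ x ∈ Ioo a b → ¬ IsCriticalPoint n ρ x

namespace IsRegularTransnormal

variable (h : IsRegularTransnormal F ρ 𝔟 a b)
include h

theorem mem_Icc (x : M) : ρ x ∈ Icc a b := h.range_eq ▸ mem_range_self x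

theorem exists_eq {c : ℝ} (hc : c ∈ Icc a b) : ∃ x, ρ x = c := by
  rw [← h.range_eq] at hc
  exact hc

theorem mdifferentiableAt (x : M) : MDifferentiableAt (𝓡 n) 𝓘(ℝ, ℝ) ρ x :=
  h.transnormal.smooth.mdifferentiableAt (by simp)

theorem fiberF_grad_sq {x : M} (hx : ¬ IsCriticalPoint n ρ x) :
    fiberF F x (grad F ρ x) ^ 2 = 𝔟 (ρ x) := by
  have hm := isMinkowskiNorm_fiberF h.finsler x
  have h0 := (grad_spec h.finsler hx).1
  rw [← h.transnormal.norm_grad x, ← hm.legendre_self h0, ← hm.fundamentalTensor_self h0]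
  rfl

theorem fiberF_grad {x : M} (hx : ¬ IsCriticalPoint n ρ x) :
    fiberF F x (grad F ρ x) = √(𝔟 (ρ x)) := by
  rw [← h.fiberF_grad_sq hx]
  exact (Real.sqrt_sq (h.finsler.nonneg _)).symm

theorem fiberF_grad_pos {x : M} (hx : ¬ IsCriticalPoint n ρ x) :
    0 < fiberF F x (grad F ρ x) :=
  (isMinkowskiNorm_fiberF h.finsler x).pos (grad_spec h.finsler hx).1

theorem speed_pos {c : ℝ} (hc : c ∈ Ioo a b) : 0 < 𝔟 c := by
  obtain ⟨x, rfl⟩ := h.exists_eq (Ioo_subset_Icc_self hc)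
  rw [← h.fiberF_grad_sq (h.regular x hc)]
  exact pow_pos (h.fiberF_grad_pos (h.regular x hc)) 2

theorem differential_grad {x : M} (hx : ¬ IsCriticalPoint n ρ x) :
    differential ρ x (grad F ρ x) = 𝔟 (ρ x) := by
  rw [← (grad_spec h.finsler hx).2, ← h.fiberF_grad_sq hx]
  exact (isMinkowskiNorm_fiberF h.finsler x).legendre_self (grad_spec h.finsler hx).1

/-- Here `dρ(grad ρ) = F(grad ρ)² = 𝔟(ρ)`, divided by `F(grad ρ)`. This is what makes `t` grow at
unit rate along the unit gradient. -/
theorem differential_unitGrad {x : M} (hx : ¬ IsCriticalPoint n ρ x) :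
    differential ρ x (unitGrad F ρ x) = √(𝔟 (ρ x)) := by
  have h1 : differential ρ x (unitGrad F ρ x) =
      (fiberF F x (grad F ρ x))⁻¹ * differential ρ x (grad F ρ x) := by
    simp only [unitGrad, map_smul, smul_eq_mul]
    rfl
  have h2 := h.fiberF_grad_pos hx
  rw [h1, h.differential_grad hx, ← h.fiberF_grad_sq hx, Real.sqrt_sq h2.le]
  field_simp

theorem F_unitGrad {x : M} (hx : ¬ IsCriticalPoint n ρ x) : F ⟨x, unitGrad F ρ x⟩ = 1 := by
  have h2 := h.fiberF_grad_pos hx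
  exact ((isMinkowskiNorm_fiberF h.finsler x).homogeneous (grad F ρ x) _ (inv_pos.2 h2)).trans
    (inv_mul_cancel₀ h2.ne')

/-- At regular points this is `legendre_le` for the gradient; at critical points the left side is
zero. It bounds the rate of change of `ρ` along arbitrary curves. -/
theorem differential_le (x : M) (v : Model n) :
    differential ρ x v ≤ √(𝔟 (ρ x)) * fiberF F x v := by
  by_cases hx : IsCriticalPoint n ρ x
  · have : differential ρ x = 0 := hx
    rw [this]
    exact mul_nonneg (Real.sqrt_nonneg _) (h.finsler.nonneg _)
  · rw [← (grad_spec h.finsler hx).2, ← h.fiberF_grad hx]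
    exact (isMinkowskiNorm_fiberF h.finsler x).legendre_le (grad_spec h.finsler hx).1 v

/-- Points that are close to each other are at finite travel time. -/
theorem eventually_exists_integral_le (x : M) : ∀ᶠ y in 𝓝 x, ∃ C, ∀ g : ℝ → ℝ, Continuous g →
    (∀ s, 0 ≤ g s) → (∀ s ∈ Icc a b, g s * √(𝔟 s) ≤ 1) → |∫ s in ρ x..ρ y, g s| ≤ C := by
  set e := chartAt (Model n) x with he'
  have he : e ∈ IsManifold.maximalAtlas (𝓡 n) ∞ M := IsManifold.chart_mem_maximalAtlas x
  have hxe : x ∈ e.source := mem_chart_source (Model n) x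
  obtain ⟨δ, hδ, hball⟩ := Metric.isOpen_iff.1 e.open_target (e x) (e.map_source hxe)
  have hnear : ∀ᶠ y in 𝓝 x, e y ∈ Metric.ball (e x) δ :=
    (e.continuousAt hxe).eventually_mem (Metric.ball_mem_nhds _ hδ)
  filter_upwards [hnear, e.open_source.mem_nhds hxe] with y hy hye
  rcases eq_or_ne (e y) (e x) with hxy | hxy
  · obtain rfl := e.injOn hye hxe hxy
    exact ⟨0, fun g _ _ _ => by simp⟩
  set w := e y - e x with hw
  have hw0 : w ≠ 0 := sub_ne_zero.2 hxy
  let u : ℝ → Model n := fun s => e x + s • w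
  have hu : ∀ s, HasDerivAt u w s := fun s => by
    simpa [u] using ((hasDerivAt_id s).smul_const w).const_add (e x)
  have hut : ∀ s ∈ Icc (0 : ℝ) 1, u s ∈ e.target := by
    intro s hs
    apply hball
    rw [Metric.mem_ball, dist_eq_norm] at hy ⊢
    simp only [u, add_sub_cancel_left, norm_smul, Real.norm_of_nonneg hs.1]
    exact lt_of_le_of_lt (mul_le_of_le_one_left (norm_nonneg _) hs.2) hy
  have hbd : ∀ v : Model n, v ≠ 0 → ∃ C, ∀ s ∈ Icc (0 : ℝ) 1, localF F e (u s, v) ≤ C := by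
    intro v hv
    have hc : ContinuousOn (fun s => localF F e (u s, v)) (Icc 0 1) := fun s hs =>
      (ContinuousAt.comp (g := localF F e) (f := fun s => (u s, v))
        (contDiffAt_localF h.finsler he (hut s hs) hv).continuousAt
        ((hu s).continuousAt.prodMk continuousAt_const)).continuousWithinAt
    obtain ⟨C, hC⟩ := (isCompact_Icc.image_of_continuousOn hc).bddAbove
    exact ⟨C, fun s hs => hC (mem_image_of_mem _ hs)⟩
  obtain ⟨C₁, hC₁⟩ := hbd w hw0
  -- `F` need not be reversible, so the lower bound on `dρ(w)` requires its own bound on `F(-w)`.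
  obtain ⟨C₂, hC₂⟩ := hbd (-w) (neg_ne_zero.2 hw0)
  refine ⟨max C₁ C₂, fun g hg hg0 hgb => ?_⟩
  have hρu : ∀ s ∈ Icc (0 : ℝ) 1, HasDerivAt (fun s => ρ (e.symm (u s)))
      (differential ρ (e.symm (u s)) (frame e (u s) w)) s := fun s hs =>
    (hasFDerivAt_comp_symm he (hut s hs) (h.mdifferentiableAt _)).comp_hasDerivAt s (hu s)
  -- The segment may meet critical levels, where `1/√𝔟` blows up. With a continuous `g` in its
  -- place, the primitive is differentiable along the segment, with derivative at most `g √𝔟 F ≤ F`,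
  -- a bound independent of `g`.
  have hG : ∀ s ∈ Icc (0 : ℝ) 1, HasDerivAt (fun s => ∫ τ in ρ x..ρ (e.symm (u s)), g τ)
      (g (ρ (e.symm (u s))) * differential ρ (e.symm (u s)) (frame e (u s) w)) s := fun s hs =>
    (intervalIntegral.integral_hasDerivAt_right (hg.intervalIntegrable _ _)
      hg.stronglyMeasurable.stronglyMeasurableAtFilter hg.continuousAt).comp s (hρu s hs)
  have hmv := norm_image_sub_le_of_norm_deriv_le_segment_01' (C := max C₁ C₂)
    (fun s hs => (hG s hs).hasDerivWithinAt) (by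
      intro s hs
      have hs' := Ico_subset_Icc_self hs
      have key : ∀ v C, localF F e (u s, v) ≤ C →
          g (ρ (e.symm (u s))) * differential ρ (e.symm (u s)) (frame e (u s) v) ≤ C := by
        intro v C hv
        have hb := hgb _ (h.mem_Icc (e.symm (u s)))
        have hn : 0 ≤ fiberF F (e.symm (u s)) (frame e (u s) v) := h.finsler.nonneg _
        calc _ ≤ g (ρ (e.symm (u s))) * (√(𝔟 (ρ (e.symm (u s)))) *
              fiberF F (e.symm (u s)) (frame e (u s) v)) :=
              mul_le_mul_of_nonneg_left (h.differential_le _ _) (hg0 _)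
          _ = (g (ρ (e.symm (u s))) * √(𝔟 (ρ (e.symm (u s))))) *
              fiberF F (e.symm (u s)) (frame e (u s) v) := by ring
          _ ≤ 1 * fiberF F (e.symm (u s)) (frame e (u s) v) :=
              mul_le_mul_of_nonneg_right hb hn
          _ ≤ C := by rw [one_mul]; exact hv
      rw [Real.norm_eq_abs, abs_le']
      refine ⟨(key w _ (hC₁ s hs')).trans (le_max_left _ _), ?_⟩
      have := key (-w) _ (hC₂ s hs')
      have hneg : differential ρ (e.symm (u s)) (frame e (u s) (-w)) =
          -differential ρ (e.symm (u s)) (frame e (u s) w) := by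
        rw [map_neg]
        exact map_neg (differential ρ (e.symm (u s))) _
      rw [hneg, mul_neg] at this
      exact this.trans (le_max_right _ _))
  have h1 : u 1 = e y := by simp [u, hw]
  have h0 : u 0 = e x := by simp [u]
  rw [h1, h0, e.left_inv hxe, e.left_inv hye, intervalIntegral.integral_same, sub_zero,
    Real.norm_eq_abs] at hmv
  exact hmv

/-- The bounds add up along chains of points and do not depend on the direction, so connectedness
propagates the local statement. -/
theorem exists_integral_le [PreconnectedSpace M] (x y : M) : ∃ C, ∀ g : ℝ → ℝ, Continuous g →
    (∀ s, 0 ≤ g s) → (∀ s ∈ Icc a b, g s * √(𝔟 s) ≤ 1) → |∫ s in ρ x..ρ y, g s| ≤ C := by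
  refine PreconnectedSpace.induction₂' (fun x y => ∃ C, ∀ g : ℝ → ℝ, Continuous g →
    (∀ s, 0 ≤ g s) → (∀ s ∈ Icc a b, g s * √(𝔟 s) ≤ 1) → |∫ s in ρ x..ρ y, g s| ≤ C) ?_ ⟨?_⟩ x y
  · intro x
    filter_upwards [h.eventually_exists_integral_le x] with y hy
    refine ⟨hy, ?_⟩
    obtain ⟨C, hC⟩ := hy
    refine ⟨C, fun g h1 h2 h3 => ?_⟩
    rw [intervalIntegral.integral_symm, abs_neg]
    exact hC g h1 h2 h3
  · rintro x y z ⟨C, hC⟩ ⟨D, hD⟩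
    refine ⟨C + D, fun g h1 h2 h3 => ?_⟩
    rw [← intervalIntegral.integral_add_adjacent_intervals (b := ρ y)
      (h1.intervalIntegrable _ _) (h1.intervalIntegrable _ _)]
    exact (abs_add_le _ _).trans (add_le_add (hC g h1 h2 h3) (hD g h1 h2 h3))

theorem isFiniteTimeSpeed [PreconnectedSpace M] : IsFiniteTimeSpeed 𝔟 a b := by
  have hc : ContinuousOn 𝔟 (Icc a b) := h.range_eq ▸ h.transnormal.continuousOn
  refine ⟨h.lt, hc, fun s hs => h.speed_pos hs, ?_⟩
  obtain ⟨x, hx⟩ := h.exists_eq (left_mem_Icc.2 h.lt.le)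
  obtain ⟨y, hy⟩ := h.exists_eq (right_mem_Icc.2 h.lt.le)
  obtain ⟨C, hC⟩ := h.exists_integral_le x y
  rw [hx, hy] at hC
  exact intervalIntegrable_of_forall_integral_le h.lt hc (fun s hs => h.speed_pos hs)
    (C := C) (fun g h1 h2 h3 => (le_abs_self _).trans (hC g h1 h2 h3))

end IsRegularTransnormal

end Regular

/-! ### The function `t` and the unit gradient in a chart. -/

section LocalTime

variable {n : ℕ} {M : Type*} [TopologicalSpace M] [ChartedSpace (Model n) M]
  [IsManifold (𝓡 n) ∞ M] {F : TangentBundle (𝓡 n) M → ℝ} {ρ : M → ℝ} {𝔟 : ℝ → ℝ} {a b : ℝ}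
  {e : OpenPartialHomeomorph M (Model n)}

/-- `unitGrad` as a vector of the model space. -/
def unitVec (F : TangentBundle (𝓡 n) M → ℝ) (ρ : M → ℝ) (x : M) : Model n := unitGrad F ρ x

/-- The normalised gradient in the coordinates `e`. -/
def localUnit (F : TangentBundle (𝓡 n) M → ℝ) (ρ : M → ℝ) (e : OpenPartialHomeomorph M (Model n))
    (u : Model n) : Model n :=
  (localF F e (u, localGrad F ρ e u))⁻¹ • localGrad F ρ e u

/-- The coordinate `t` in the coordinates `e`. -/
def localTime (ρ : M → ℝ) (𝔟 : ℝ → ℝ) (a : ℝ) (e : OpenPartialHomeomorph M (Model n))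
    (u : Model n) : ℝ :=
  travelTime 𝔟 a (ρ (e.symm u))

/-- The coordinates of the regular points. -/
def regularTarget (ρ : M → ℝ) (a b : ℝ) (e : OpenPartialHomeomorph M (Model n)) :
    Set (Model n) :=
  e.target ∩ e.symm ⁻¹' (ρ ⁻¹' Ioo a b)

omit [IsManifold (𝓡 n) ∞ M] in
theorem localF_localGrad (he : e ∈ IsManifold.maximalAtlas (𝓡 n) ∞ M) {u : Model n}
    (hu : u ∈ e.target) :
    localF F e (u, localGrad F ρ e u) = fiberF F (e.symm u) (grad F ρ (e.symm u)) := by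
  rw [localF_eq, frame_localGrad he hu]

omit [IsManifold (𝓡 n) ∞ M] in
theorem frame_localUnit (he : e ∈ IsManifold.maximalAtlas (𝓡 n) ∞ M) {u : Model n}
    (hu : u ∈ e.target) : frame e u (localUnit F ρ e u) = unitVec F ρ (e.symm u) := by
  rw [localUnit, map_smul, frame_localGrad he hu, localF_localGrad he hu]
  rfl

namespace IsRegularTransnormal

variable (h : IsRegularTransnormal F ρ 𝔟 a b)
include h

theorem isOpen_regularTarget : IsOpen (regularTarget ρ a b e) :=
  e.isOpen_inter_preimage_symm (isOpen_Ioo.preimage h.transnormal.smooth.continuous)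

theorem not_isCriticalPoint {u : Model n} (hu : u ∈ regularTarget ρ a b e) :
    ¬ IsCriticalPoint n ρ (e.symm u) := h.regular _ hu.2

theorem localF_localGrad_pos (he : e ∈ IsManifold.maximalAtlas (𝓡 n) ∞ M) {u : Model n}
    (hu : u ∈ regularTarget ρ a b e) : 0 < localF F e (u, localGrad F ρ e u) := by
  rw [localF_localGrad he hu.1]
  exact h.fiberF_grad_pos (h.not_isCriticalPoint hu)

theorem localF_localGrad_sq (he : e ∈ IsManifold.maximalAtlas (𝓡 n) ∞ M) {u : Model n}
    (hu : u ∈ regularTarget ρ a b e) :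
    localF F e (u, localGrad F ρ e u) ^ 2 = 𝔟 (ρ (e.symm u)) := by
  rw [localF_localGrad he hu.1]
  exact h.fiberF_grad_sq (h.not_isCriticalPoint hu)

theorem contDiffAt_localF_localGrad (he : e ∈ IsManifold.maximalAtlas (𝓡 n) ∞ M) {u : Model n}
    (hu : u ∈ regularTarget ρ a b e) :
    ContDiffAt ℝ ∞ (fun u => localF F e (u, localGrad F ρ e u)) u :=
  ContDiffAt.comp u (g := localF F e) (f := fun u => (u, localGrad F ρ e u))
    (contDiffAt_localF h.finsler he hu.1
      (localGrad_ne_zero h.finsler he hu.1 (h.not_isCriticalPoint hu)))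
    (contDiffAt_id.prodMk (contDiffAt_localGrad h.finsler he h.transnormal.smooth hu.1
      (h.not_isCriticalPoint hu)))

theorem contDiffAt_localUnit (he : e ∈ IsManifold.maximalAtlas (𝓡 n) ∞ M) {u : Model n}
    (hu : u ∈ regularTarget ρ a b e) : ContDiffAt ℝ ∞ (localUnit F ρ e) u :=
  ((h.contDiffAt_localF_localGrad he hu).inv (h.localF_localGrad_pos he hu).ne').smul
    (contDiffAt_localGrad h.finsler he h.transnormal.smooth hu.1 (h.not_isCriticalPoint hu))

theorem localUnit_ne_zero (he : e ∈ IsManifold.maximalAtlas (𝓡 n) ∞ M) {u : Model n}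
    (hu : u ∈ regularTarget ρ a b e) : localUnit F ρ e u ≠ 0 :=
  smul_ne_zero (inv_ne_zero (h.localF_localGrad_pos he hu).ne')
    (localGrad_ne_zero h.finsler he hu.1 (h.not_isCriticalPoint hu))

theorem hasFDerivAt_localTime (hs : IsFiniteTimeSpeed 𝔟 a b)
    (he : e ∈ IsManifold.maximalAtlas (𝓡 n) ∞ M)
    {u : Model n} (hu : u ∈ regularTarget ρ a b e) :
    HasFDerivAt (localTime ρ 𝔟 a e)
      ((localF F e (u, localGrad F ρ e u))⁻¹ • fderiv ℝ (ρ ∘ e.symm) u) u := by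
  have h1 := (hs.hasDerivAt_travelTime hu.2).comp_hasFDerivAt u
    ((contDiffAt_comp_symm he hu.1 h.transnormal.smooth).differentiableAt (by simp)).hasFDerivAt
  rw [one_div, ← h.localF_localGrad_sq he hu, Real.sqrt_sq (h.localF_localGrad_pos he hu).le] at h1
  exact h1

/-- The formula through `travelTime` only shows differentiability, as `𝔟` is merely continuous. But
the derivative it yields, `dρ / F(grad ρ)`, no longer mentions `𝔟` and is smooth. -/
theorem contDiffAt_localTime (hs : IsFiniteTimeSpeed 𝔟 a b)
    (he : e ∈ IsManifold.maximalAtlas (𝓡 n) ∞ M)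
    {u : Model n} (hu : u ∈ regularTarget ρ a b e) : ContDiffAt ℝ ∞ (localTime ρ 𝔟 a e) u := by
  have hopen := h.isOpen_regularTarget (e := e)
  refine ContDiffOn.contDiffAt ?_ (hopen.mem_nhds hu)
  rw [contDiffOn_infty_iff_fderiv_of_isOpen hopen]
  refine ⟨fun v hv =>
    (h.hasFDerivAt_localTime hs he hv).differentiableAt.differentiableWithinAt, ?_⟩
  have h1 : ContDiffOn ℝ ∞ (fun u => (localF F e (u, localGrad F ρ e u))⁻¹ •
      fderiv ℝ (ρ ∘ e.symm) u) (regularTarget ρ a b e) := fun v hv =>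
    (((h.contDiffAt_localF_localGrad he hv).inv (h.localF_localGrad_pos he hv).ne').smul
      ((contDiffAt_comp_symm he hv.1 h.transnormal.smooth).fderiv_right
        (m := ∞) (by simp))).contDiffWithinAt
  exact h1.congr fun v hv => (h.hasFDerivAt_localTime hs he hv).fderiv

/-- Both `dt` and the unit gradient carry a factor `1 / F(grad ρ)`, and `dρ(grad ρ) = F(grad ρ)²`.
-/
theorem fderiv_localTime_localUnit (hs : IsFiniteTimeSpeed 𝔟 a b)
    (he : e ∈ IsManifold.maximalAtlas (𝓡 n) ∞ M)
    {u : Model n} (hu : u ∈ regularTarget ρ a b e) :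
    fderiv ℝ (localTime ρ 𝔟 a e) u (localUnit F ρ e u) = 1 := by
  have hpos := h.localF_localGrad_pos he hu
  have hx := h.not_isCriticalPoint hu
  rw [(h.hasFDerivAt_localTime hs he hu).fderiv,
    ← legendre_localGrad h.finsler he hu.1 (h.mdifferentiableAt _) hx, localUnit, map_smul,
    smul_apply,
    (isMinkowskiNorm_localF h.finsler he hu.1).legendre_self
      (localGrad_ne_zero h.finsler he hu.1 hx), smul_eq_mul, smul_eq_mul]
  field_simp

end IsRegularTransnormal

end LocalTime

/-! ### Straightening the unit gradient with `t` as first coordinate. -/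

section FlowBox

variable {m : ℕ} {M : Type*} [TopologicalSpace M] [ChartedSpace (Model (m + 1)) M]
  [IsManifold (𝓡 (m + 1)) ∞ M] {F : TangentBundle (𝓡 (m + 1)) M → ℝ} {ρ : M → ℝ} {𝔟 : ℝ → ℝ}
  {a b : ℝ}

/-- Coordinates on a set of regular points whose first coordinate is `t` and whose first coordinate
field is the normalised gradient. -/
structure IsFlowBox (F : TangentBundle (𝓡 (m + 1)) M → ℝ) (ρ : M → ℝ) (𝔟 : ℝ → ℝ) (a b : ℝ)
    (e : OpenPartialHomeomorph M (Model (m + 1))) : Prop where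
  mem_atlas : e ∈ IsManifold.maximalAtlas (𝓡 (m + 1)) ∞ M
  regular : ∀ x ∈ e.source, ρ x ∈ Ioo a b
  coordVec_zero : ∀ x ∈ e.source, coordVec e 0 x = unitGrad F ρ x
  time : ∀ x ∈ e.source, e x 0 = travelTime 𝔟 a (ρ x)

/-- A vector field `X` on a vector space with a function `θ` of derivative `1` along `X` can be
straightened such that `θ` is the first coordinate. -/
theorem exists_straightening {X : Model (m + 1) → Model (m + 1)} {θ : Model (m + 1) → ℝ}
    {U : Set (Model (m + 1))} (hU : IsOpen U) (hX : ∀ u ∈ U, ContDiffAt ℝ ∞ X u)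
    (hX0 : ∀ u ∈ U, X u ≠ 0) (hθ : ∀ u ∈ U, ContDiffAt ℝ ∞ θ u)
    (hθX : ∀ u ∈ U, fderiv ℝ θ u (X u) = 1) {u₀ : Model (m + 1)} (hu₀ : u₀ ∈ U) :
    ∃ T : OpenPartialHomeomorph (Model (m + 1)) (Model (m + 1)), u₀ ∈ T.target ∧
      (∀ z ∈ T.source, ContDiffAt ℝ ∞ T z ∧ T z ∈ U ∧ θ (T z) = z 0 ∧
        fderiv ℝ T z (EuclideanSpace.single 0 1) = X (T z)) ∧
      ∀ y ∈ T.target, ContDiffAt ℝ ∞ T.symm y := by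
  set e₀ : Model (m + 1) := EuclideanSpace.single 0 1 with he₀
  have he₀0 : e₀ ≠ 0 := by
    intro h0
    have := congrArg (fun v : Model (m + 1) => v 0) h0
    simp [he₀] at this
  obtain ⟨A, hA⟩ := SeparatingDual.exists_continuousLinearEquiv_apply_eq (R := ℝ) he₀0 (hX0 u₀ hu₀)
  obtain ⟨α, hα⟩ := exists_contDiffAt_flow (X := X) (x₀ := u₀)
    (by filter_upwards [hU.mem_nhds hu₀] with u hu using hX u hu)
  have hα0 := hα.self_of_nhds
  have hαc : ContinuousAt α (u₀, 0) := hα0.1.continuousAt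
  have hαU : ∀ᶠ p in 𝓝 (u₀, (0 : ℝ)), α p ∈ U :=
    hαc.eventually_mem (hU.mem_nhds (by rw [hα0.2.1]; exact hu₀))
  -- on a product neighbourhood, `θ` increases with unit speed along the flow
  obtain ⟨δ, hδ, hball⟩ := Metric.eventually_nhds_iff_ball.1 (hα.and hαU)
  have hprod : ∀ x ∈ Metric.ball u₀ δ, ∀ s ∈ Ioo (-δ) δ, (x, s) ∈ Metric.ball (u₀, (0 : ℝ)) δ := by
    intro x hx s hs
    rw [← ball_prod_same]
    exact ⟨hx, by rw [Metric.mem_ball, Real.dist_0_eq_abs]; exact abs_lt.2 hs⟩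
  have hθα : ∀ x ∈ Metric.ball u₀ δ, ∀ s ∈ Ioo (-δ) δ, θ (α (x, s)) = θ x + s := by
    intro x hx s hs
    have hd : ∀ s ∈ Ioo (-δ) δ, HasDerivAt (fun s => θ (α (x, s)) - s) 0 s := by
      intro s hs
      obtain ⟨⟨-, -, h1⟩, h2⟩ := hball _ (hprod x hx s hs)
      have h3 := ((hθ _ h2).differentiableAt (by simp)).hasFDerivAt.comp_hasDerivAt s h1
      rw [hθX _ h2] at h3
      simpa using! h3.sub (hasDerivAt_id s)
    have h0 : (0 : ℝ) ∈ Ioo (-δ) δ := ⟨by linarith, hδ⟩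
    have := isOpen_Ioo.is_const_of_deriv_eq_zero isPreconnected_Ioo
      (fun s hs => (hd s hs).differentiableAt.differentiableWithinAt)
      (fun s hs => (hd s hs).deriv) hs h0
    simp only [(hball _ (hprod x hx 0 h0)).1.2.1, sub_zero] at this
    linarith
  let P : Model (m + 1) →L[ℝ] ℝ := EuclideanSpace.proj 0
  have hP : ∀ z, P z = z 0 := fun z => rfl
  have hPe : P e₀ = 1 := by simp [hP, he₀]
  -- `B z = A (z - z₀ e₀)` kills `e₀` and maps onto a hyperplane transverse to `X u₀ = A e₀`; `u₀ +
  -- B z` is the starting point of the flow.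
  let B : Model (m + 1) →L[ℝ] Model (m + 1) :=
    (A : Model (m + 1) →L[ℝ] Model (m + 1)).comp
      (ContinuousLinearMap.id ℝ _ - P.smulRight e₀)
  have hB : ∀ z, B z = A z - P z • X u₀ := fun z => by
    simp [B, ← hA]
  have hBe : B e₀ = 0 := by rw [hB, hPe, hA, one_smul, sub_self]
  let y : Model (m + 1) → Model (m + 1) := fun z => u₀ + B z
  -- Since `θ` grows at unit rate along the flow, the flow time `z₀ - θ (y z)` makes it arrive with
  -- value exactly `z₀`.
  let q : Model (m + 1) → Model (m + 1) × ℝ := fun z => (y z, P z - θ (y z))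
  let Ξ : Model (m + 1) → Model (m + 1) := fun z => α (q z)
  set zb : Model (m + 1) := θ u₀ • e₀ with hzb
  have hyb : y zb = u₀ := by simp [y, hzb, hBe]
  have hqb : q zb = (u₀, 0) := by
    have h1 : P zb = θ u₀ := by rw [hzb, map_smul, hPe, smul_eq_mul, mul_one]
    simp only [q, hyb, h1, sub_self]
  have hyd : ∀ z, HasFDerivAt y B z := fun z => B.hasFDerivAt.const_add u₀
  have hys : ContDiff ℝ ∞ y := contDiff_const.add B.contDiff
  have hyU : ∀ᶠ z in 𝓝 zb, y z ∈ U :=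
    hys.continuous.continuousAt.eventually_mem (hU.mem_nhds (by rw [hyb]; exact hu₀))
  have hqs : ∀ z, y z ∈ U → ContDiffAt ℝ ∞ q z := fun z hz =>
    hys.contDiffAt.prodMk (P.contDiff.contDiffAt.sub ((hθ _ hz).comp z hys.contDiffAt))
  have hyb' : y zb ∈ U := by rw [hyb]; exact hu₀
  have hqc : ∀ᶠ z in 𝓝 zb, y z ∈ Metric.ball u₀ δ ∧ P z - θ (y z) ∈ Ioo (-δ) δ := by
    have h1 := (hqs zb hyb').continuousAt.tendsto
    rw [hqb] at h1
    exact h1.eventually (prod_mem_nhds (Metric.ball_mem_nhds u₀ hδ)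
      (Ioo_mem_nhds (by linarith) hδ))
  have hgood : ∀ᶠ z in 𝓝 zb, ContDiffAt ℝ ∞ Ξ z ∧ Ξ z ∈ U ∧ θ (Ξ z) = z 0 ∧
      fderiv ℝ Ξ z e₀ = X (Ξ z) := by
    filter_upwards [hqc, hyU] with z hz hzU
    obtain ⟨⟨h1, h2, h3⟩, h4⟩ := hball _ (hprod _ hz.1 _ hz.2)
    have hs : ContDiffAt ℝ ∞ Ξ z := h1.comp z (hqs z hzU)
    refine ⟨hs, h4, ?_, ?_⟩
    · rw [hθα _ hz.1 _ hz.2, add_sub_cancel, hP]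
    · have h5 : HasDerivAt (fun s : ℝ => Ξ (z + s • e₀)) (fderiv ℝ Ξ z e₀) 0 := by
        have h6 : HasFDerivAt Ξ (fderiv ℝ Ξ z) (z + (0 : ℝ) • e₀) := by
          rw [zero_smul, add_zero]; exact (hs.differentiableAt (by simp)).hasFDerivAt
        have h7 : HasDerivAt (fun s : ℝ => z + s • e₀) e₀ 0 := by
          simpa using ((hasDerivAt_id (0 : ℝ)).smul_const e₀).const_add z
        exact h6.comp_hasDerivAt 0 h7
      -- Moving `z` along `e₀` keeps the starting point and only increases the flow time, so the
      -- derivative in this direction is `X`.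
      have h8 : (fun s : ℝ => Ξ (z + s • e₀)) =
          fun s => α (y z, (P z - θ (y z)) + s) := by
        funext s
        have h9 : y (z + s • e₀) = y z := by simp [y, hBe]
        simp only [Ξ, q, h9, map_add, map_smul, hPe, smul_eq_mul, mul_one]
        congr 2
        ring
      rw [h8] at h5
      have h10 : HasDerivAt (fun s => α (y z, (P z - θ (y z)) + s)) (X (Ξ z)) 0 := by
        have h3' : HasDerivAt (fun s => α (y z, s)) (X (Ξ z)) ((P z - θ (y z)) + 0) := by
          rw [add_zero]; exact h3
        simpa [Function.comp_def] using h3'.scomp (0 : ℝ) ((hasDerivAt_id (0 : ℝ)).const_add (P z - θ (y z)))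
      exact h5.unique h10
  -- the derivative at the base point
  have hαd := (hα0.1.differentiableAt (by simp)).hasFDerivAt
  set L := fderiv ℝ α (u₀, 0) with hL
  have hL1 : ∀ v, L (v, 0) = v := by
    intro v
    have h1 : HasFDerivAt (fun x => α (x, 0)) (L.comp (ContinuousLinearMap.inl ℝ _ _)) u₀ :=
      hαd.comp u₀ (hasFDerivAt_prodMk_left u₀ 0)
    have h2 : HasFDerivAt (fun x => α (x, 0)) (ContinuousLinearMap.id ℝ (Model (m + 1))) u₀ := by
      refine (hasFDerivAt_id u₀).congr_of_eventuallyEq ?_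
      filter_upwards [Metric.ball_mem_nhds u₀ hδ] with x hx
      exact (hball _ (hprod x hx 0 ⟨by linarith, hδ⟩)).1.2.1
    exact DFunLike.congr_fun (h1.unique h2) v
  have hL2 : L (0, 1) = X u₀ := by
    have h1 : HasDerivAt (fun s => α (u₀, s)) (L (0, 1)) 0 := by
      have h2 : HasFDerivAt (fun s => α (u₀, s)) (L.comp (ContinuousLinearMap.inr ℝ _ _)) 0 :=
        hαd.comp 0 (hasFDerivAt_prodMk_right u₀ 0)
      simpa using h2.hasDerivAt
    have h2 := hα0.2.2
    have h3 : α (u₀, 0) = u₀ := hα0.2.1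
    simp only [h3] at h2
    exact h1.unique h2
  have hL3 : ∀ v s, L (v, s) = v + s • X u₀ := by
    intro v s
    have : ((v, s) : Model (m + 1) × ℝ) = (v, 0) + s • (0, 1) := by simp
    rw [this, map_add, map_smul, hL1, hL2]
  have hθd := ((hθ u₀ hu₀).differentiableAt (by simp)).hasFDerivAt
  have hqd : HasFDerivAt q (B.prod (P - (fderiv ℝ θ u₀).comp B)) zb := by
    refine (hyd zb).prodMk (P.hasFDerivAt.sub (HasFDerivAt.comp zb ?_ (hyd zb)))
    rw [hyb]; exact hθd
  have hΞd : HasFDerivAt Ξ (L.comp (B.prod (P - (fderiv ℝ θ u₀).comp B))) zb := by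
    refine HasFDerivAt.comp zb ?_ hqd
    rw [hqb]; exact hαd
  have hD : ∀ v, L.comp (B.prod (P - (fderiv ℝ θ u₀).comp B)) v =
      A v - fderiv ℝ θ u₀ (B v) • X u₀ := by
    intro v
    simp only [ContinuousLinearMap.comp_apply, ContinuousLinearMap.prod_apply, _root_.sub_apply,
      hL3, sub_smul]
    rw [hB v]
    abel
  -- If the derivative kills `v`, then `A v` is a multiple of `A e₀`, so `v` is a multiple of `e₀`.
  -- Then `B v = 0`, the multiple `dθ(B v)` is zero, and `v = 0`.
  have hinj : Function.Injective (L.comp (B.prod (P - (fderiv ℝ θ u₀).comp B))) := by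
    rw [injective_iff_map_eq_zero]
    intro v hv
    rw [hD, sub_eq_zero, ← hA, ← map_smul] at hv
    have h1 := A.injective hv
    have h2 : B v = 0 := by rw [h1, map_smul, hBe, smul_zero]
    rw [h1, h2, map_zero, zero_smul]
  let D : Model (m + 1) ≃L[ℝ] Model (m + 1) :=
    (LinearEquiv.ofInjectiveOfFinrankEq
      (L.comp (B.prod (P - (fderiv ℝ θ u₀).comp B))).toLinearMap hinj rfl).toContinuousLinearEquiv
  obtain ⟨T, hzT, hTΞ, -, hTs⟩ := exists_openPartialHomeomorph_contDiffAt (f := Ξ) (a := zb) D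
    (hgood.mono fun z hz => hz.1) hΞd
  obtain ⟨V, hV, hVo, hzV⟩ := eventually_nhds_iff.1 hgood
  refine ⟨T.restrOpen V hVo, ?_, ?_, fun w hw => ?_⟩
  · have h1 := (T.restrOpen V hVo).map_source (x := zb) ⟨hzT, hzV⟩
    have h2 : (T.restrOpen V hVo) zb = u₀ := by
      change T zb = u₀
      rw [hTΞ]
      change α (q zb) = u₀
      rw [hqb]
      exact hα0.2.1
    rwa [h2] at h1
  · intro z hz
    have hTz : ⇑(T.restrOpen V hVo) = Ξ := hTΞ
    rw [hTz]
    exact hV z hz.2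
  · exact hTs w hw.1

/-- Flow boxes exist around every regular point. -/
theorem IsRegularTransnormal.exists_isFlowBox (h : IsRegularTransnormal F ρ 𝔟 a b)
    (hs : IsFiniteTimeSpeed 𝔟 a b) {x₀ : M} (hx₀ : ρ x₀ ∈ Ioo a b) :
    ∃ e : OpenPartialHomeomorph M (Model (m + 1)), IsFlowBox F ρ 𝔟 a b e ∧ x₀ ∈ e.source := by
  set c := chartAt (Model (m + 1)) x₀ with hc'
  have hc : c ∈ IsManifold.maximalAtlas (𝓡 (m + 1)) ∞ M := IsManifold.chart_mem_maximalAtlas x₀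
  have hxc : x₀ ∈ c.source := mem_chart_source (Model (m + 1)) x₀
  obtain ⟨T, hT₀, hT, hTs⟩ := exists_straightening (X := localUnit F ρ c)
    (θ := localTime ρ 𝔟 a c) (h.isOpen_regularTarget (e := c))
    (fun u hu => h.contDiffAt_localUnit hc hu) (fun u hu => h.localUnit_ne_zero hc hu)
    (fun u hu => h.contDiffAt_localTime hs hc hu)
    (fun u hu => h.fderiv_localTime_localUnit hs hc hu) (u₀ := c x₀)
    ⟨c.map_source hxc, by rw [mem_preimage, c.left_inv hxc]; exact hx₀⟩
  have hsrc : ∀ x ∈ (c.trans T.symm).source, x ∈ c.source ∧ c x ∈ T.target := by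
    intro x hx
    simpa using hx
  refine ⟨c.trans T.symm, ⟨?_, ?_, ?_, ?_⟩, ?_⟩
  · apply OpenPartialHomeomorph.mem_maximalAtlas_of_contMDiffOn
    · have h1 : ContMDiffOn (𝓡 (m + 1)) (𝓡 (m + 1)) ∞ T.symm T.target :=
        contMDiffOn_iff_contDiffOn.2 fun y hy => (hTs y hy).contDiffWithinAt
      exact h1.comp ((contMDiffOn_of_mem_maximalAtlas hc).mono fun x hx => (hsrc x hx).1)
        fun x hx => (hsrc x hx).2
    · have h1 : ContMDiffOn (𝓡 (m + 1)) (𝓡 (m + 1)) ∞ T T.source :=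
        contMDiffOn_iff_contDiffOn.2 fun y hy => (hT y hy).1.contDiffWithinAt
      exact (contMDiffOn_symm_of_mem_maximalAtlas hc).comp
        (h1.mono fun z hz => by simpa using hz.1) fun z hz => by
          have : z ∈ T.source := by simpa using hz.1
          exact (hT z this).2.1.1
  · intro x hx
    obtain ⟨hx1, hx2⟩ := hsrc x hx
    have h1 := (hT _ (T.map_target hx2)).2.1.2
    rwa [T.right_inv hx2, mem_preimage, c.left_inv hx1] at h1
  · intro x hx
    obtain ⟨hx1, hx2⟩ := hsrc x hx
    set z := T.symm (c x) with hz
    have hzT : z ∈ T.source := T.map_target hx2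
    have hTz : T z = c x := T.right_inv hx2
    have h1 : HasMFDerivAt 𝓘(ℝ, Model (m + 1)) 𝓘(ℝ, Model (m + 1)) T z (fderiv ℝ T z) :=
      ((hT z hzT).1.differentiableAt (by simp)).hasFDerivAt.hasMFDerivAt
    have h2 := ((mdifferentiable_of_mem_maximalAtlas hc).mdifferentiableAt_symm
      (hT z hzT).2.1.1).hasMFDerivAt
    have h3 := (h2.comp z h1).mfderiv
    have h4 : frame (c.trans T.symm) z (EuclideanSpace.single 0 1) =
        frame c (T z) (fderiv ℝ T z (EuclideanSpace.single 0 1)) :=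
      DFunLike.congr_fun h3 (EuclideanSpace.single 0 1)
    rw [(hT z hzT).2.2.2, frame_localUnit hc (hT z hzT).2.1.1, hTz, c.left_inv hx1] at h4
    exact h4
  · intro x hx
    obtain ⟨hx1, hx2⟩ := hsrc x hx
    have h1 := (hT _ (T.map_target hx2)).2.2.1
    rw [T.right_inv hx2, localTime, c.left_inv hx1] at h1
    exact h1.symm
  · simpa using ⟨hxc, hT₀⟩

end FlowBox

/-! ### One-sided limits from monotone sequences. -/

section OneSidedLimits

/-- A function on the line has a left limit if it converges along all monotone sequences. -/
theorem exists_tendsto_nhdsLT_of_forall_monotone {X : Type*} [TopologicalSpace X] [T2Space X]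
    {f : ℝ → X} {α β : ℝ} (hαβ : α < β)
    (H : ∀ u : ℕ → ℝ, Monotone u → (∀ i, u i ∈ Ioo α β) → Tendsto u atTop (𝓝 β) →
      ∃ p, Tendsto (f ∘ u) atTop (𝓝 p)) : ∃ p, Tendsto f (𝓝[<] β) (𝓝 p) := by
  obtain ⟨v, hv, hvm, hvt⟩ := exists_seq_strictMono_tendsto' hαβ
  obtain ⟨p, hp⟩ := H v hv.monotone hvm hvt
  refine ⟨p, ?_⟩
  by_contra hcon
  obtain ⟨U, hU, hfr⟩ := not_tendsto_iff_exists_frequently_notMem.1 hcon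
  -- interleave the sequence `v` with points that are mapped outside `U`
  have step : ∀ (k : ℕ) (c : Ioo α β), ∃ s : Ioo α β, (c : ℝ) < s ∧ v k < s ∧
      (Even k → ∃ i ≥ k, (s : ℝ) = v i) ∧ (¬ Even k → f s ∉ U) := by
    intro k c
    by_cases hk : Even k
    · obtain ⟨i, hi, hik⟩ := ((hvt.eventually (lt_mem_nhds c.2.2)).and
        (eventually_gt_atTop k)).exists
      exact ⟨⟨v i, hvm i⟩, hi, hv hik, fun _ => ⟨i, hik.le, rfl⟩, fun h => absurd hk h⟩
    · have h1 : ∀ᶠ s in 𝓝[<] β, s ∈ Ioo (max (c : ℝ) (v k)) β :=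
        Ioo_mem_nhdsLT (max_lt c.2.2 (hvm k).2)
      obtain ⟨s, hs, hs'⟩ := (hfr.and_eventually h1).exists
      exact ⟨⟨s, c.2.1.trans ((le_max_left _ _).trans_lt hs'.1), hs'.2⟩,
        (le_max_left _ _).trans_lt hs'.1, (le_max_right _ _).trans_lt hs'.1,
        fun h => absurd h hk, fun _ => hs⟩
  choose g hg1 hg2 hg3 hg4 using step
  let u : ℕ → Ioo α β := fun k => Nat.rec ⟨v 0, hvm 0⟩ (fun k c => g k c) k
  have hus : ∀ k, u (k + 1) = g k (u k) := fun k => rfl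
  have hut : Tendsto (fun k => (u (k + 1)).val) atTop (𝓝 β) :=
    tendsto_of_tendsto_of_tendsto_of_le_of_le hvt tendsto_const_nhds
      (fun k => by rw [hus]; exact (hg2 k (u k)).le) (fun k => (u (k + 1)).2.2.le)
  let w : ℕ → ℝ := fun k => (u k).val
  have hmono : Monotone w := monotone_nat_of_le_succ fun k => (hg1 k (u k)).le
  have hut' : Tendsto w atTop (𝓝 β) := (tendsto_add_atTop_iff_nat (f := w) 1).1 hut
  obtain ⟨q, hq⟩ := H _ hmono (fun k => (u k).2) hut'
  have hq' : Tendsto (fun k => f (u (k + 1))) atTop (𝓝 q) :=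
    (tendsto_add_atTop_iff_nat (f := f ∘ w) 1).2 hq
  have heven : Tendsto (fun k : ℕ => 2 * k) atTop atTop :=
    tendsto_atTop_mono (fun k => by simp only [id]; omega) tendsto_id
  have hodd : Tendsto (fun k : ℕ => 2 * k + 1) atTop atTop :=
    tendsto_atTop_mono (fun k => by simp only [id]; omega) tendsto_id
  choose i hi hi' using fun k : ℕ => hg3 (2 * k) (u (2 * k)) (even_two_mul k)
  have h1 : Tendsto (fun k => f (u (2 * k + 1))) atTop (𝓝 p) := by
    have h2 : Tendsto i atTop atTop := tendsto_atTop_mono hi heven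
    refine (hp.comp h2).congr fun k => ?_
    simp only [Function.comp_apply, hus, ← hi']
  -- The even steps run along `v` and force the common limit to be `p`; the odd steps stay outside
  -- the neighbourhood `U` of `p`.
  have hpq : p = q := tendsto_nhds_unique h1 (hq'.comp heven)
  have h3 : ∀ᶠ k : ℕ in atTop, f (u (2 * k + 1 + 1)) ∈ U :=
    (hq'.comp hodd).eventually (hpq ▸ hU)
  obtain ⟨k, hk⟩ := h3.exists
  rw [hus] at hk
  exact hg4 (2 * k + 1) _ (by simp) hk

/-- A function on the line has a right limit if it converges along all antitone sequences. -/
theorem exists_tendsto_nhdsGT_of_forall_antitone {X : Type*} [TopologicalSpace X] [T2Space X]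
    {f : ℝ → X} {α β : ℝ} (hαβ : α < β)
    (H : ∀ u : ℕ → ℝ, Antitone u → (∀ i, u i ∈ Ioo α β) → Tendsto u atTop (𝓝 α) →
      ∃ p, Tendsto (f ∘ u) atTop (𝓝 p)) : ∃ p, Tendsto f (𝓝[>] α) (𝓝 p) := by
  obtain ⟨p, hp⟩ := exists_tendsto_nhdsLT_of_forall_monotone (f := fun s => f (-s))
    (neg_lt_neg hαβ) (fun u hu hum hut => by
      refine H (fun k => -u k) hu.neg (fun k => ?_) ?_
      · have := hum k
        exact ⟨by linarith [this.2], by linarith [this.1]⟩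
      · simpa using hut.neg)
  refine ⟨p, ?_⟩
  have h1 : Tendsto (fun s : ℝ => -s) (𝓝[>] α) (𝓝[<] (-α)) := tendsto_neg_nhdsGT
  simpa [Function.comp_def] using hp.comp h1

end OneSidedLimits

/-! ### Horizontal curves: local form, uniqueness and limits. -/

section Horizontal

variable {m : ℕ} {M : Type*} [TopologicalSpace M] [ChartedSpace (Model (m + 1)) M]
  {F : TangentBundle (𝓡 (m + 1)) M → ℝ} {ρ : M → ℝ} {𝔟 : ℝ → ℝ}
  {a b : ℝ}

/-- `γ` is on `S` an integral curve of the normalised gradient inside the regular points, with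
parameter `t`. -/
def IsHorizontalOn (F : TangentBundle (𝓡 (m + 1)) M → ℝ) (ρ : M → ℝ) (𝔟 : ℝ → ℝ) (a b : ℝ)
    (γ : ℝ → M) (S : Set ℝ) : Prop :=
  ∀ s ∈ S, HasMFDerivAt 𝓘(ℝ, ℝ) (𝓡 (m + 1)) γ s
      ((1 : ℝ →L[ℝ] ℝ).smulRight (unitGrad F ρ (γ s))) ∧
    ρ (γ s) ∈ Ioo a b ∧ travelTime 𝔟 a (ρ (γ s)) = s

theorem IsHorizontalOn.mono {γ : ℝ → M} {S S' : Set ℝ} (hγ : IsHorizontalOn F ρ 𝔟 a b γ S)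
    (hS : S' ⊆ S) : IsHorizontalOn F ρ 𝔟 a b γ S' := fun s hs => hγ s (hS hs)

theorem IsHorizontalOn.continuousAt {γ : ℝ → M} {S : Set ℝ}
    (hγ : IsHorizontalOn F ρ 𝔟 a b γ S) {s : ℝ} (hs : s ∈ S) : ContinuousAt γ s :=
  (hγ s hs).1.continuousAt

theorem IsHorizontalOn.congr_of_eventuallyEq {γ γ' : ℝ → M} {S S' : Set ℝ}
    (hγ : IsHorizontalOn F ρ 𝔟 a b γ S)
    (h : ∀ s ∈ S', s ∈ S ∧ γ' =ᶠ[𝓝 s] γ) : IsHorizontalOn F ρ 𝔟 a b γ' S' := by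
  intro s hs
  obtain ⟨hsS, heq⟩ := h s hs
  have h0 := hγ s hsS
  rw [← heq.eq_of_nhds] at h0
  exact ⟨h0.1.congr_of_eventuallyEq heq, h0.2⟩

/-- Horizontal curves on two open sets that agree on the intersection can be glued. -/
theorem IsHorizontalOn.piecewise {γ γ' : ℝ → M} {S S' : Set ℝ} [∀ s, Decidable (s ∈ S)]
    (hS : IsOpen S) (hS' : IsOpen S')
    (hγ : IsHorizontalOn F ρ 𝔟 a b γ S) (hγ' : IsHorizontalOn F ρ 𝔟 a b γ' S')
    (h : ∀ s ∈ S, s ∈ S' → γ s = γ' s) :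
    IsHorizontalOn F ρ 𝔟 a b (S.piecewise γ γ') (S ∪ S') := by
  rintro s (hs | hs)
  · exact hγ.congr_of_eventuallyEq (S' := S) (fun s hs => ⟨hs, by
      filter_upwards [hS.mem_nhds hs] with τ hτ
      exact piecewise_eq_of_mem _ _ _ hτ⟩) s hs
  · exact hγ'.congr_of_eventuallyEq (S' := S') (fun s hs => ⟨hs, by
      filter_upwards [hS'.mem_nhds hs] with τ hτ
      by_cases hτS : τ ∈ S
      · rw [piecewise_eq_of_mem _ _ _ hτS, h τ hτS hτ]
      · exact piecewise_eq_of_notMem _ _ _ hτS⟩) s hs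

variable [IsManifold (𝓡 (m + 1)) ∞ M] {e : OpenPartialHomeomorph M (Model (m + 1))}

/-- The line through `p` in direction of the first coordinate of `e`, with parameter `t`. -/
def flowLine (ρ : M → ℝ) (𝔟 : ℝ → ℝ) (a : ℝ) (e : OpenPartialHomeomorph M (Model (m + 1)))
    (p : M) (s : ℝ) : Model (m + 1) :=
  e p + (s - travelTime 𝔟 a (ρ p)) • EuclideanSpace.single 0 1

omit [IsManifold (𝓡 (m + 1)) ∞ M] in
theorem hasDerivAt_flowLine (p : M) (s : ℝ) :
    HasDerivAt (flowLine ρ 𝔟 a e p) (EuclideanSpace.single 0 1) s := by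
  exact ((((hasDerivAt_id s).sub_const (travelTime 𝔟 a (ρ p))).smul_const
    (EuclideanSpace.single 0 1 : Model (m + 1))).const_add (e p)).congr_deriv (one_smul _ _)

omit [ChartedSpace (Model (m + 1)) M] [IsManifold (𝓡 (m + 1)) ∞ M] in
theorem flowLine_time (p : M) : flowLine ρ 𝔟 a e p (travelTime 𝔟 a (ρ p)) = e p := by
  simp [flowLine]

omit [IsManifold (𝓡 (m + 1)) ∞ M] in
theorem continuous_flowLine (p : M) : Continuous (flowLine ρ 𝔟 a e p) :=
  continuous_iff_continuousAt.2 fun s => (hasDerivAt_flowLine p s).continuousAt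

omit [IsManifold (𝓡 (m + 1)) ∞ M] in
theorem isOpen_preimage_flowLine (p : M) : IsOpen (flowLine ρ 𝔟 a e p ⁻¹' e.target) :=
  e.open_target.preimage (continuous_flowLine p)

namespace IsFlowBox

variable (he : IsFlowBox F ρ 𝔟 a b e)
include he

theorem isHorizontalOn_flowLine {p : M} (hp : p ∈ e.source) :
    IsHorizontalOn F ρ 𝔟 a b (fun s => e.symm (flowLine ρ 𝔟 a e p s))
      (flowLine ρ 𝔟 a e p ⁻¹' e.target) := by
  intro s hs
  have hs' : e.symm (flowLine ρ 𝔟 a e p s) ∈ e.source := e.map_target hs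
  refine ⟨?_, he.regular _ hs', ?_⟩
  · have h1 := (((mdifferentiable_of_mem_maximalAtlas he.mem_atlas).mdifferentiableAt_symm
      hs).hasMFDerivAt).comp s (hasDerivAt_flowLine p s).hasFDerivAt.hasMFDerivAt
    refine h1.congr_mfderiv ?_
    ext
    have h2 : frame e (e (e.symm (flowLine ρ 𝔟 a e p s))) (EuclideanSpace.single 0 1) =
        unitVec F ρ (e.symm (flowLine ρ 𝔟 a e p s)) := he.coordVec_zero _ hs'
    rw [e.right_inv hs] at h2
    change frame e (flowLine ρ 𝔟 a e p s) ((1 : ℝ) • EuclideanSpace.single 0 1) =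
      (1 : ℝ) • unitVec F ρ _
    rw [one_smul, one_smul, h2]
  · rw [← he.time _ hs', e.right_inv hs]
    simp [flowLine, he.time p hp]

theorem contMDiffAt_flowLine {p : M} {s : ℝ} (hs : s ∈ flowLine ρ 𝔟 a e p ⁻¹' e.target) :
    ContMDiffAt 𝓘(ℝ, ℝ) (𝓡 (m + 1)) ∞ (fun s => e.symm (flowLine ρ 𝔟 a e p s)) s := by
  have h1 : ContDiff ℝ ∞ (flowLine ρ 𝔟 a e p) :=
    contDiff_const.add ((contDiff_id.sub contDiff_const).smul contDiff_const)
  exact ContMDiffAt.comp s (contMDiffAt_symm_of_mem_maximalAtlas he.mem_atlas hs)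
    h1.contMDiff.contMDiffAt

/-- In a flow box, horizontal curves are straight lines. -/
theorem exists_eq_add {γ : ℝ → M} {α β : ℝ} (hγ : IsHorizontalOn F ρ 𝔟 a b γ (Ioo α β))
    (hmem : ∀ s ∈ Ioo α β, γ s ∈ e.source) :
    ∃ k, ∀ s ∈ Ioo α β, e (γ s) = k + s • EuclideanSpace.single 0 1 := by
  have hd : ∀ s ∈ Ioo α β, HasDerivAt
      (fun s => e (γ s) - s • (EuclideanSpace.single 0 1 : Model (m + 1))) 0 s := by
    intro s hs
    have h1 := (((mdifferentiable_of_mem_maximalAtlas he.mem_atlas).mdifferentiableAt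
      (hmem s hs)).hasMFDerivAt).comp s (hγ s hs).1
    have h2 : HasDerivAt (fun s => e (γ s)) (EuclideanSpace.single 0 1 : Model (m + 1)) s := by
      have h3 : HasFDerivAt (fun s => e (γ s))
          ((coframe e (γ s)).comp ((1 : ℝ →L[ℝ] ℝ).smulRight (unitVec F ρ (γ s)))) s :=
        h1.hasFDerivAt
      refine h3.hasDerivAt.congr_deriv ?_
      change coframe e (γ s) ((1 : ℝ) • unitVec F ρ (γ s)) = _
      rw [one_smul]
      have h4 : unitVec F ρ (γ s) = frame e (e (γ s)) (EuclideanSpace.single 0 1) :=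
        (he.coordVec_zero _ (hmem s hs)).symm
      rw [h4]
      have h5 := coframe_frame he.mem_atlas (e.map_source (hmem s hs))
        (EuclideanSpace.single 0 1)
      rwa [e.left_inv (hmem s hs)] at h5
    simpa using! h2.sub
      ((hasDerivAt_id s).smul_const (EuclideanSpace.single 0 1 : Model (m + 1)))
  rcases (Ioo α β).eq_empty_or_nonempty with h0 | ⟨s₀, hs₀⟩
  · exact ⟨0, fun s hs => by rw [h0] at hs; exact hs.elim⟩
  · refine ⟨e (γ s₀) - s₀ • EuclideanSpace.single 0 1, fun s hs => ?_⟩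
    have := isOpen_Ioo.is_const_of_deriv_eq_zero isPreconnected_Ioo
      (fun s hs => (hd s hs).differentiableAt.differentiableWithinAt)
      (fun s hs => (hd s hs).deriv) hs₀ hs
    rw [this, sub_add_cancel]

/-- A horizontal curve that accumulates at a point `p` of a flow box within an interval is the flow
line through `p` on that interval. -/
theorem eq_flowLine {γ : ℝ → M} {α β : ℝ} (hγ : IsHorizontalOn F ρ 𝔟 a b γ (Ioo α β))
    (hmem : ∀ s ∈ Ioo α β, γ s ∈ e.source) {p : M} (hp : p ∈ e.source) {l : Filter ℝ} [l.NeBot]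
    (hl : Ioo α β ∈ l) (hl' : l ≤ 𝓝 (travelTime 𝔟 a (ρ p))) (hlim : Tendsto γ l (𝓝 p)) :
    ∀ s ∈ Ioo α β, γ s = e.symm (flowLine ρ 𝔟 a e p s) := by
  obtain ⟨k, hk⟩ := he.exists_eq_add hγ hmem
  have h1 : Tendsto (fun s => e (γ s)) l (𝓝 (e p)) := (e.continuousAt hp).tendsto.comp hlim
  have h2 : Tendsto (fun s : ℝ => k + s • (EuclideanSpace.single 0 1 : Model (m + 1))) l
      (𝓝 (k + travelTime 𝔟 a (ρ p) • EuclideanSpace.single 0 1)) :=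
    tendsto_const_nhds.add ((tendsto_id.mono_left hl').smul_const _)
  -- The offset of the line is determined by passing to the limit along `l`; the curve need not be
  -- defined or continuous at the limiting parameter.
  have h3 : e p = k + travelTime 𝔟 a (ρ p) • EuclideanSpace.single 0 1 :=
    tendsto_nhds_unique h1 (h2.congr' (by
      filter_upwards [hl] with s hs
      exact (hk s hs).symm))
  intro s hs
  rw [flowLine, h3, ← e.left_inv (hmem s hs), hk s hs]
  congr 1
  module

theorem eventuallyEq_flowLine {γ : ℝ → M} {S : Set ℝ} (hS : IsOpen S)
    (hγ : IsHorizontalOn F ρ 𝔟 a b γ S) {s : ℝ} (hs : s ∈ S) (hp : γ s ∈ e.source) :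
    γ =ᶠ[𝓝 s] fun τ => e.symm (flowLine ρ 𝔟 a e (γ s) τ) := by
  have h1 : S ∩ γ ⁻¹' e.source ∈ 𝓝 s :=
    inter_mem (hS.mem_nhds hs) ((hγ.continuousAt hs).preimage_mem_nhds (e.open_source.mem_nhds hp))
  obtain ⟨α, β, hαβ, hsub⟩ := (mem_nhds_iff_exists_Ioo_subset).1 h1
  have h2 := he.eq_flowLine (hγ.mono fun τ hτ => (hsub hτ).1) (fun τ hτ => (hsub hτ).2) hp
    (l := 𝓝 s) (Ioo_mem_nhds hαβ.1 hαβ.2) (by rw [(hγ s hs).2.2]) (hγ.continuousAt hs)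
  filter_upwards [Ioo_mem_nhds hαβ.1 hαβ.2] with τ hτ using h2 τ hτ

end IsFlowBox

namespace IsRegularTransnormal

variable (h : IsRegularTransnormal F ρ 𝔟 a b) (hs : IsFiniteTimeSpeed 𝔟 a b)
include h

-- In a flow box the curve is a straight line. Smoothness makes it an admissible competitor in
-- `finslerDist`.
include hs in
theorem contMDiffAt_of_isHorizontalOn {γ : ℝ → M} {S : Set ℝ} (hS : IsOpen S)
    (hγ : IsHorizontalOn F ρ 𝔟 a b γ S) {s : ℝ} (hsS : s ∈ S) :
    ContMDiffAt 𝓘(ℝ, ℝ) (𝓡 (m + 1)) ∞ γ s := by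
  obtain ⟨e, he, hp⟩ := h.exists_isFlowBox hs (hγ s hsS).2.1
  refine (he.contMDiffAt_flowLine ?_).congr_of_eventuallyEq (he.eventuallyEq_flowLine hS hγ hsS hp)
  have h1 : flowLine ρ 𝔟 a e (γ s) (travelTime 𝔟 a (ρ (γ s))) ∈ e.target := by
    rw [flowLine_time]; exact e.map_source hp
  rwa [(hγ s hsS).2.2] at h1

-- Agreement at a parameter spreads to a neighbourhood, since both curves are the same flow line
-- there. It is also a closed condition because `M` is Hausdorff, and an interval is connected.
include hs in
theorem eqOn_of_isHorizontalOn [T2Space M] {γ γ' : ℝ → M} {α β : ℝ}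
    (hγ : IsHorizontalOn F ρ 𝔟 a b γ (Ioo α β)) (hγ' : IsHorizontalOn F ρ 𝔟 a b γ' (Ioo α β))
    {s₀ : ℝ} (hs₀ : s₀ ∈ Ioo α β) (heq : γ s₀ = γ' s₀) : EqOn γ γ' (Ioo α β) := by
  have hloc : ∀ s ∈ Ioo α β, γ s = γ' s → γ =ᶠ[𝓝 s] γ' := by
    intro s hs' hss
    obtain ⟨e, he, hp⟩ := h.exists_isFlowBox hs (hγ s hs').2.1
    have h1 := he.eventuallyEq_flowLine isOpen_Ioo hγ hs' hp
    have h2 := he.eventuallyEq_flowLine isOpen_Ioo hγ' hs' (hss ▸ hp)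
    rw [← hss] at h2
    exact h1.trans h2.symm
  have hsub : Ioo α β ⊆ {s | γ =ᶠ[𝓝 s] γ'} := by
    refine isPreconnected_Ioo.subset_of_closure_inter_subset isOpen_setOfPred_eventually_nhds
      ⟨s₀, hs₀, hloc s₀ hs₀ heq⟩ ?_
    rintro s ⟨hsc, hsI⟩
    refine hloc s hsI ?_
    have h1 : ∃ᶠ τ in 𝓝 s, γ τ = γ' τ :=
      (mem_closure_iff_frequently.1 hsc).mono fun τ hτ =>
        (show γ =ᶠ[𝓝 τ] γ' from hτ).eq_of_nhds
    by_contra hne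
    have h2 := (hγ.continuousAt hsI).tendsto.prodMk_nhds (hγ'.continuousAt hsI).tendsto
    have h3 : ∀ᶠ τ in 𝓝 s, (γ τ, γ' τ) ∈ (diagonal M)ᶜ :=
      h2.eventually_mem (isClosed_diagonal.isOpen_compl.mem_nhds hne)
    exact (h1.and_eventually h3).exists.elim fun τ hτ => hτ.2 hτ.1
  exact fun s hs' => (hsub hs').eq_of_nhds

include hs in
/-- Horizontal curves are parametrised by arc length. -/
theorem finslerDist_le {γ : ℝ → M} {α β : ℝ} (hγ : IsHorizontalOn F ρ 𝔟 a b γ (Ioo α β))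
    {s s' : ℝ} (hs₁ : s ∈ Ioo α β) (hs₂ : s' ∈ Ioo α β) (hss : s ≤ s') :
    finslerDist F (γ s) (γ s') ≤ ENNReal.ofReal (s' - s) := by
  have hsub : Icc s s' ⊆ Ioo α β := fun τ hτ => ⟨hs₁.1.trans_le hτ.1, hτ.2.trans_lt hs₂.2⟩
  have hlen : finslerLength F γ s s' = ENNReal.ofReal (s' - s) := by
    rw [finslerLength, setLIntegral_congr_fun (g := fun _ => 1) measurableSet_Icc]
    · simp
    · intro τ hτ
      have h1 := hγ τ (hsub hτ)
      have h2 : mfderiv 𝓘(ℝ, ℝ) (𝓡 (m + 1)) γ τ (1 : ℝ) = unitGrad F ρ (γ τ) := by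
        rw [h1.1.mfderiv]
        exact one_smul ℝ (unitGrad F ρ (γ τ))
      simp only [h2, h.F_unitGrad (h.regular _ h1.2.1), ENNReal.ofReal_one]
  rw [← hlen]
  refine iInf_le_of_le γ (iInf_le_of_le s (iInf_le_of_le s' (iInf_le _ ⟨hss, ?_, rfl, rfl⟩)))
  -- One subinterval suffices; the partition is constant `s'` from index 1 on, as monotonicity is
  -- required on all of `ℕ`.
  refine ⟨1, fun i => if i = 0 then s else s', ?_, by simp, by simp, ?_⟩
  · refine monotone_nat_of_le_succ fun i => ?_
    by_cases hi : i = 0 <;> simp [hi, hss]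
  · intro i hi
    obtain rfl : i = 0 := by omega
    simp only [if_true, zero_add, one_ne_zero, if_false]
    exact fun τ hτ => (h.contMDiffAt_of_isHorizontalOn hs isOpen_Ioo hγ (hsub hτ)).contMDiffWithinAt

include hs in
theorem exists_tendsto_nhdsLT [T2Space M] (hc : IsComplete F) {γ : ℝ → M} {α β : ℝ} (hαβ : α < β)
    (hγ : IsHorizontalOn F ρ 𝔟 a b γ (Ioo α β)) : ∃ p, Tendsto γ (𝓝[<] β) (𝓝 p) := by
  -- Arc length bounds only the distance from an earlier to a later point of the curve, so the
  -- Cauchy condition is available only along monotone sequences.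
  refine exists_tendsto_nhdsLT_of_forall_monotone hαβ fun u hu hum hut => ?_
  refine hc.forward _ fun ε hε => ?_
  obtain ⟨δ, -, hδ, hδε⟩ := ENNReal.lt_iff_exists_real_btwn.1 hε
  have hδ0 : 0 < δ := ENNReal.ofReal_pos.1 hδ
  obtain ⟨N, hN⟩ := eventually_atTop.1 (hut.eventually (lt_mem_nhds (sub_lt_self β hδ0)))
  refine ⟨N, fun i j hi hij => lt_of_le_of_lt ?_ hδε⟩
  refine (h.finslerDist_le hs hγ (hum i) (hum j) (hu hij)).trans (ENNReal.ofReal_le_ofReal ?_)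
  linarith [hN i hi, (hum j).2]

include hs in
theorem exists_tendsto_nhdsGT [T2Space M] (hc : IsComplete F) {γ : ℝ → M} {α β : ℝ} (hαβ : α < β)
    (hγ : IsHorizontalOn F ρ 𝔟 a b γ (Ioo α β)) : ∃ p, Tendsto γ (𝓝[>] α) (𝓝 p) := by
  -- For decreasing parameters, later terms of the sequence lie earlier on the curve; this is the
  -- backward Cauchy condition.
  refine exists_tendsto_nhdsGT_of_forall_antitone hαβ fun u hu hum hut => ?_
  refine hc.backward _ fun ε hε => ?_
  obtain ⟨δ, -, hδ, hδε⟩ := ENNReal.lt_iff_exists_real_btwn.1 hε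
  have hδ0 : 0 < δ := ENNReal.ofReal_pos.1 hδ
  obtain ⟨N, hN⟩ := eventually_atTop.1 (hut.eventually (gt_mem_nhds (lt_add_of_pos_right α hδ0)))
  refine ⟨N, fun i j hi hij => lt_of_le_of_lt ?_ hδε⟩
  refine (h.finslerDist_le hs hγ (hum j) (hum i) (hu hij)).trans (ENNReal.ofReal_le_ofReal ?_)
  linarith [hN i hi, (hum j).1]

theorem continuous_time (hs : IsFiniteTimeSpeed 𝔟 a b) :
    Continuous (fun x => travelTime 𝔟 a (ρ x)) :=
  hs.continuousOn_travelTime.comp_continuous h.transnormal.smooth.continuous h.mem_Icc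

end IsRegularTransnormal

end Horizontal

/-! ### Extension of horizontal curves to geodesics over `[0, T]`. -/

section Geodesics

variable {m : ℕ} {M : Type*} [TopologicalSpace M] [T2Space M] [ChartedSpace (Model (m + 1)) M]
  [IsManifold (𝓡 (m + 1)) ∞ M] {F : TangentBundle (𝓡 (m + 1)) M → ℝ} {ρ : M → ℝ} {𝔟 : ℝ → ℝ}
  {a b : ℝ}

namespace IsRegularTransnormal

variable (h : IsRegularTransnormal F ρ 𝔟 a b) (hs : IsFiniteTimeSpeed 𝔟 a b)
include h hs

theorem mem_Ioo_of_time_mem {x : M} (hx : travelTime 𝔟 a (ρ x) ∈ Ioo 0 (travelTime 𝔟 a b)) :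
    ρ x ∈ Ioo a b := (hs.travelTime_mem_Ioo (h.mem_Icc x)).1 hx

/-- A horizontal curve with a regular limit at its right end can be extended. -/
theorem exists_extension_right (hc : IsComplete F) {γ : ℝ → M} {α β : ℝ} (hα : 0 ≤ α)
    (hαβ : α < β) (hβ : β < travelTime 𝔟 a b) (hγ : IsHorizontalOn F ρ 𝔟 a b γ (Ioo α β)) :
    ∃ γ' β', β < β' ∧ IsHorizontalOn F ρ 𝔟 a b γ' (Ioo α β') ∧ EqOn γ' γ (Ioo α β) := by
  classical
  obtain ⟨p, hp⟩ := h.exists_tendsto_nhdsLT hs hc hαβ hγ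
  -- By continuity the limit point has `t = β`, strictly between `0` and `T`; so it is regular and
  -- has a flow box, whose line through `p` continues the curve.
  have htp : travelTime 𝔟 a (ρ p) = β := by
    have h1 := (h.continuous_time hs).continuousAt.tendsto.comp hp
    refine tendsto_nhds_unique h1 ((tendsto_id.mono_left nhdsWithin_le_nhds).congr' ?_)
    filter_upwards [Ioo_mem_nhdsLT hαβ] with s hs' using (hγ s hs').2.2.symm
  have hpr : ρ p ∈ Ioo a b :=
    h.mem_Ioo_of_time_mem hs (by rw [htp]; exact ⟨hα.trans_lt hαβ, hβ⟩)
  obtain ⟨e, he, hpe⟩ := h.exists_isFlowBox hs hpr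
  have h1 : ∀ᶠ s in 𝓝[<] β, γ s ∈ e.source := hp.eventually_mem (e.open_source.mem_nhds hpe)
  obtain ⟨α', hα', hsub⟩ := (mem_nhdsLT_iff_exists_mem_Ico_Ioo_subset hαβ).1 h1
  have h2 : IsHorizontalOn F ρ 𝔟 a b γ (Ioo α' β) := hγ.mono (Ioo_subset_Ioo_left hα'.1)
  have h3 := he.eq_flowLine h2 hsub hpe (l := 𝓝[<] β) (Ioo_mem_nhdsLT hα'.2)
    (by rw [htp]; exact nhdsWithin_le_nhds) hp
  have h4 : flowLine ρ 𝔟 a e p ⁻¹' e.target ∈ 𝓝 β := by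
    refine (isOpen_preimage_flowLine p).mem_nhds ?_
    rw [← htp, mem_preimage, flowLine_time]
    exact e.map_source hpe
  obtain ⟨l, u, hlu, hsub'⟩ := mem_nhds_iff_exists_Ioo_subset.1 h4
  have h5 := (he.isHorizontalOn_flowLine hpe).mono
    (S' := Ioo (max l α') u) (fun s hs' => hsub' ⟨(le_max_left _ _).trans_lt hs'.1, hs'.2⟩)
  have h6 := IsHorizontalOn.piecewise isOpen_Ioo isOpen_Ioo hγ h5 (fun s hs1 hs2 =>
    h3 s ⟨(le_max_right _ _).trans_lt hs2.1, hs1.2⟩)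
  refine ⟨_, u, hlu.2, h6.mono fun s hs' => ?_, fun s hs' => piecewise_eq_of_mem _ _ _ hs'⟩
  rcases lt_or_ge s β with hlt | hge
  · exact Or.inl ⟨hs'.1, hlt⟩
  · exact Or.inr ⟨(max_lt hlu.1 hα'.2).trans_le hge, hs'.2⟩

/-- A horizontal curve with a regular limit at its left end can be extended. -/
theorem exists_extension_left (hc : IsComplete F) {γ : ℝ → M} {α β : ℝ} (hα : 0 < α)
    (hαβ : α < β) (hβ : β ≤ travelTime 𝔟 a b) (hγ : IsHorizontalOn F ρ 𝔟 a b γ (Ioo α β)) :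
    ∃ γ' α', α' < α ∧ IsHorizontalOn F ρ 𝔟 a b γ' (Ioo α' β) ∧ EqOn γ' γ (Ioo α β) := by
  classical
  obtain ⟨p, hp⟩ := h.exists_tendsto_nhdsGT hs hc hαβ hγ
  have htp : travelTime 𝔟 a (ρ p) = α := by
    have h1 := (h.continuous_time hs).continuousAt.tendsto.comp hp
    refine tendsto_nhds_unique h1 ((tendsto_id.mono_left nhdsWithin_le_nhds).congr' ?_)
    filter_upwards [Ioo_mem_nhdsGT hαβ] with s hs' using (hγ s hs').2.2.symm
  have hpr : ρ p ∈ Ioo a b :=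
    h.mem_Ioo_of_time_mem hs (by rw [htp]; exact ⟨hα, hαβ.trans_le hβ⟩)
  obtain ⟨e, he, hpe⟩ := h.exists_isFlowBox hs hpr
  have h1 : ∀ᶠ s in 𝓝[>] α, γ s ∈ e.source := hp.eventually_mem (e.open_source.mem_nhds hpe)
  obtain ⟨β', hβ', hsub⟩ := (mem_nhdsGT_iff_exists_mem_Ioc_Ioo_subset hαβ).1 h1
  have h2 : IsHorizontalOn F ρ 𝔟 a b γ (Ioo α β') := hγ.mono (Ioo_subset_Ioo_right hβ'.2)
  have h3 := he.eq_flowLine h2 hsub hpe (l := 𝓝[>] α) (Ioo_mem_nhdsGT hβ'.1)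
    (by rw [htp]; exact nhdsWithin_le_nhds) hp
  have h4 : flowLine ρ 𝔟 a e p ⁻¹' e.target ∈ 𝓝 α := by
    refine (isOpen_preimage_flowLine p).mem_nhds ?_
    rw [← htp, mem_preimage, flowLine_time]
    exact e.map_source hpe
  obtain ⟨l, u, hlu, hsub'⟩ := mem_nhds_iff_exists_Ioo_subset.1 h4
  have h5 := (he.isHorizontalOn_flowLine hpe).mono
    (S' := Ioo l (min u β')) (fun s hs' => hsub' ⟨hs'.1, hs'.2.trans_le (min_le_left _ _)⟩)
  have h6 := IsHorizontalOn.piecewise isOpen_Ioo isOpen_Ioo hγ h5 (fun s hs1 hs2 =>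
    h3 s ⟨hs1.1, hs2.2.trans_le (min_le_right _ _)⟩)
  refine ⟨_, l, hlu.1, h6.mono fun s hs' => ?_, fun s hs' => piecewise_eq_of_mem _ _ _ hs'⟩
  rcases lt_or_ge α s with hlt | hge
  · exact Or.inl ⟨hlt, hs'.2⟩
  · exact Or.inr ⟨hs'.1, hge.trans_lt (lt_min hlu.2 hβ'.1)⟩

/-- Through every regular point there is a horizontal curve on `(0, T)`. -/
theorem exists_isHorizontalOn (hc : IsComplete F) {x : M} (hx : ρ x ∈ Ioo a b) :
    ∃ γ : ℝ → M, IsHorizontalOn F ρ 𝔟 a b γ (Ioo 0 (travelTime 𝔟 a b)) ∧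
      γ (travelTime 𝔟 a (ρ x)) = x := by
  classical
  set T := travelTime 𝔟 a b with hT
  set τ₀ := travelTime 𝔟 a (ρ x) with hτ₀
  have hτ₀T : τ₀ ∈ Ioo 0 T := (hs.travelTime_mem_Ioo (h.mem_Icc x)).2 hx
  let Q : ℝ → ℝ → (ℝ → M) → Prop := fun α β γ =>
    τ₀ ∈ Ioo α β ∧ IsHorizontalOn F ρ 𝔟 a b γ (Ioo α β) ∧ γ τ₀ = x
  -- `J` is the union of all intervals that carry a horizontal curve through `x` at time `τ₀`; by
  -- uniqueness these curves glue to a single curve `γ₀` on `J`.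
  let J : Set ℝ := {s | ∃ α β γ, s ∈ Ioo α β ∧ Q α β γ}
  have hJdef : ∀ s, s ∈ J ↔ ∃ α β γ, s ∈ Ioo α β ∧ Q α β γ := fun s => Iff.rfl
  have hJ : ∀ s : J, ∃ α β γ, (s : ℝ) ∈ Ioo α β ∧ Q α β γ := fun s => s.2
  choose A B G hAB hQ using hJ
  have hQJ : ∀ {α β γ}, Q α β γ → Ioo α β ⊆ J := fun {α β γ} hq s hs' =>
    (hJdef s).2 ⟨α, β, γ, hs', hq⟩
  have hJT : J ⊆ Ioo 0 T := by
    rintro s ⟨α, β, γ, hs', -, hγ, -⟩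
    have h1 := hγ s hs'
    rw [← h1.2.2]
    exact (hs.travelTime_mem_Ioo (h.mem_Icc _)).2 h1.2.1
  have hopen : IsOpen J := by
    rw [isOpen_iff_mem_nhds]
    rintro s ⟨α, β, γ, hs', hq⟩
    exact mem_of_superset (Ioo_mem_nhds hs'.1 hs'.2) (hQJ hq)
  have hagree : ∀ {α β γ α' β' γ'}, Q α β γ → Q α' β' γ' → ∀ s ∈ Ioo α β, s ∈ Ioo α' β' →
      γ s = γ' s := by
    intro α β γ α' β' γ' hq hq' s h1 h2
    have h3 : Ioo (max α α') (min β β') = Ioo α β ∩ Ioo α' β' := Ioo_inter_Ioo.symm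
    refine h.eqOn_of_isHorizontalOn hs (hq.2.1.mono (h3.trans_subset inter_subset_left))
      (hq'.2.1.mono (h3.trans_subset inter_subset_right)) (s₀ := τ₀) ?_
      (hq.2.2.trans hq'.2.2.symm) ?_
    · rw [h3]; exact ⟨hq.1, hq'.1⟩
    · rw [h3]; exact ⟨h1, h2⟩
  let γ₀ : ℝ → M := fun s => if hs' : s ∈ J then G ⟨s, hs'⟩ s else x
  have hγ₀ : ∀ {α β γ}, Q α β γ → ∀ s ∈ Ioo α β, γ₀ s = γ s := by
    intro α β γ hq s hs'
    have hsJ := hQJ hq hs'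
    simp only [γ₀, dif_pos hsJ]
    exact hagree (hQ ⟨s, hsJ⟩) hq s (hAB ⟨s, hsJ⟩) hs'
  have hhor : IsHorizontalOn F ρ 𝔟 a b γ₀ J := by
    intro s hsJ
    refine (hQ ⟨s, hsJ⟩).2.1.congr_of_eventuallyEq (S' := {s}) ?_ s rfl
    intro s' hs'
    obtain rfl : s' = s := hs'
    refine ⟨hAB ⟨s', hsJ⟩, ?_⟩
    filter_upwards [Ioo_mem_nhds (hAB ⟨s', hsJ⟩).1 (hAB ⟨s', hsJ⟩).2] with τ hτ
    exact hγ₀ (hQ _) τ hτ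
  -- the interval contains the starting point
  have hτ₀J : τ₀ ∈ J := by
    obtain ⟨e, he, hxe⟩ := h.exists_isFlowBox hs hx
    have h1 : flowLine ρ 𝔟 a e x ⁻¹' e.target ∈ 𝓝 τ₀ := by
      refine (isOpen_preimage_flowLine x).mem_nhds ?_
      rw [mem_preimage, hτ₀, flowLine_time]
      exact e.map_source hxe
    obtain ⟨l, u, hlu, hsub⟩ := mem_nhds_iff_exists_Ioo_subset.1 h1
    refine (hJdef _).2 ⟨l, u, _, hlu, hlu, (he.isHorizontalOn_flowLine hxe).mono hsub, ?_⟩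
    simp only [hτ₀, flowLine_time]
    exact e.left_inv hxe
  have hγ₀τ : γ₀ τ₀ = x := by
    obtain ⟨α, β, γ, hs', hq⟩ := hτ₀J
    rw [hγ₀ hq τ₀ hs']
    exact hq.2.2
  have hconn : ∀ s ∈ J, uIcc τ₀ s ⊆ J := by
    rintro s ⟨α, β, γ, hs', hq⟩
    exact (ordConnected_Ioo.uIcc_subset hq.1 hs').trans (hQJ hq)
  obtain ⟨α₀, β₀, γ', -, hq₀⟩ := id hτ₀J
  -- `J` is open, so it remains to exclude boundary points in `(0, T)`: at such a point one of the
  -- extension lemmas would push the curve past it.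
  have hall : Ioo 0 T ⊆ J := by
    refine isPreconnected_Ioo.subset_of_closure_inter_subset hopen ⟨τ₀, hτ₀T, hτ₀J⟩ ?_
    rintro s ⟨hsc, hsT⟩
    by_contra hsJ
    rcases lt_trichotomy s τ₀ with hlt | heq | hgt
    · have hsub : Ioo s β₀ ⊆ J := by
        intro τ hτ
        rcases lt_or_ge α₀ τ with h1 | h1
        · exact hQJ hq₀ ⟨h1, hτ.2⟩
        · obtain ⟨τ', hτ', hτ'J⟩ := mem_closure_iff_nhds.1 hsc (Iio τ) (Iio_mem_nhds hτ.1)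
          refine hconn τ' hτ'J ?_
          rw [uIcc_of_ge ((show τ' < τ from hτ').le.trans (h1.trans hq₀.1.1.le))]
          exact ⟨(show τ' < τ from hτ').le, h1.trans hq₀.1.1.le⟩
      have hβ₀ : min β₀ T ≤ T := min_le_right _ _
      obtain ⟨γ₁, α₁, h1, h2, h3⟩ := h.exists_extension_left hs hc hsT.1
        (hlt.trans (lt_min hq₀.1.2 hτ₀T.2)) hβ₀
        (hhor.mono ((Ioo_subset_Ioo_right (min_le_left _ _)).trans hsub))
      refine hsJ ((hJdef _).2 ⟨α₁, min β₀ T, γ₁, ⟨h1, hlt.trans (lt_min hq₀.1.2 hτ₀T.2)⟩,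
        ⟨h1.trans hlt, lt_min hq₀.1.2 hτ₀T.2⟩, h2, ?_⟩)
      rw [h3 ⟨hlt, lt_min hq₀.1.2 hτ₀T.2⟩, hγ₀τ]
    · exact hsJ (heq ▸ hτ₀J)
    · have hsub : Ioo α₀ s ⊆ J := by
        intro τ hτ
        rcases lt_or_ge τ β₀ with h1 | h1
        · exact hQJ hq₀ ⟨hτ.1, h1⟩
        · obtain ⟨τ', hτ', hτ'J⟩ := mem_closure_iff_nhds.1 hsc (Ioi τ) (Ioi_mem_nhds hτ.2)
          refine hconn τ' hτ'J ?_
          rw [uIcc_of_le ((hq₀.1.2.le.trans h1).trans (show τ < τ' from hτ').le)]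
          exact ⟨hq₀.1.2.le.trans h1, (show τ < τ' from hτ').le⟩
      have hα₀ : 0 ≤ max α₀ 0 := le_max_right _ _
      have hlt := max_lt hq₀.1.1 hτ₀T.1
      obtain ⟨γ₁, β₁, h1, h2, h3⟩ := h.exists_extension_right hs hc hα₀
        (hlt.trans hgt) hsT.2
        (hhor.mono ((Ioo_subset_Ioo_left (le_max_left _ _)).trans hsub))
      refine hsJ ((hJdef _).2 ⟨max α₀ 0, β₁, γ₁, ⟨hlt.trans hgt, h1⟩,
        ⟨hlt, hgt.trans h1⟩, h2, ?_⟩)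
      rw [h3 ⟨hlt, hgt⟩, hγ₀τ]
  exact ⟨γ₀, hhor.mono hall, hγ₀τ⟩

/-- Every regular point lies on a horizontal geodesic from `ρ = a` to `ρ = b`. -/
theorem exists_isHorizontalGeodesic (hc : IsComplete F) {x : M} (hx : ρ x ∈ Ioo a b) :
    ∃ γ : ℝ → M, IsHorizontalGeodesic F ρ a b γ (travelTime 𝔟 a b) ∧
      γ (travelTime 𝔟 a (ρ x)) = x ∧
      ∀ τ ∈ Icc 0 (travelTime 𝔟 a b), travelTime 𝔟 a (ρ (γ τ)) = τ := by
  obtain ⟨γ, hγ, hγx⟩ := h.exists_isHorizontalOn hs hc hx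
  set T := travelTime 𝔟 a b with hT
  have hT0 : 0 < T := hs.travelTime_pos
  obtain ⟨p, hp⟩ := h.exists_tendsto_nhdsGT hs hc hT0 hγ
  obtain ⟨q, hq⟩ := h.exists_tendsto_nhdsLT hs hc hT0 hγ
  let γ' : ℝ → M := extendFrom (Ioo 0 T) γ
  have hcont₀ : ContinuousOn γ (Ioo 0 T) := fun s hs' =>
    (hγ.continuousAt hs').continuousWithinAt
  have : LocallyCompactSpace M := ChartedSpace.locallyCompactSpace (Model (m + 1)) M
  have hcont : ContinuousOn γ' (Icc 0 T) := continuousOn_Icc_extendFrom_Ioo hcont₀ hp hq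
  have heq : ∀ s ∈ Ioo 0 T, γ' s = γ s := extendFrom_extends hcont₀
  -- The identity on the open interval extends to its closure by continuity; at `0` it places the
  -- initial point on the level `a`.
  have htime : ∀ τ ∈ Icc 0 T, travelTime 𝔟 a (ρ (γ' τ)) = τ := by
    have h1 : EqOn (fun τ => travelTime 𝔟 a (ρ (γ' τ))) id (Ioo 0 T) := fun τ hτ => by
      simp only [heq τ hτ, (hγ τ hτ).2.2, id]
    have h2 := h1.of_subset_closure ((h.continuous_time hs).comp_continuousOn hcont)
      continuousOn_id Ioo_subset_Icc_self (by rw [closure_Ioo hT0.ne])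
    exact fun τ hτ => h2 hτ
  have hx' : travelTime 𝔟 a (ρ x) ∈ Ioo 0 T := (hs.travelTime_mem_Ioo (h.mem_Icc x)).2 hx
  refine ⟨γ', ⟨hcont, ?_, ?_, ?_⟩, (heq _ hx').trans hγx, htime⟩
  · have h1 := htime 0 (left_mem_Icc.2 hT0.le)
    exact hs.strictMonoOn_travelTime.injOn (h.mem_Icc _) (left_mem_Icc.2 h.lt.le)
      (h1.trans IsFiniteTimeSpeed.travelTime_left.symm)
  · intro s hs'
    rw [heq s hs']
    exact (hγ s hs').2.1
  · intro s hs'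
    have h1 := hγ.congr_of_eventuallyEq (γ' := γ') (S' := Ioo 0 T) fun s hs' => ⟨hs', by
      filter_upwards [Ioo_mem_nhds hs'.1 hs'.2] with τ hτ using heq τ hτ⟩
    exact (h1 s hs').1.hasMFDerivWithinAt

/-- The parameter of a horizontal geodesic is the travel time. -/
theorem time_eq_of_isHorizontalGeodesic {γ : ℝ → M} {l : ℝ} (hl : 0 < l)
    (hγ : IsHorizontalGeodesic F ρ a b γ l) : travelTime 𝔟 a (ρ (γ l)) = l := by
  have hd : ∀ s ∈ Ioo 0 l, HasDerivAt (fun s => travelTime 𝔟 a (ρ (γ s))) 1 s := by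
    intro s hs'
    have hm := hγ.mem s hs'
    have h1 := (hγ.integralCurve s hs').hasMFDerivAt (Ioo_mem_nhds hs'.1 hs'.2)
    have h2 : HasFDerivAt (fun s => ρ (γ s))
        ((show Model (m + 1) →L[ℝ] ℝ from differential ρ (γ s)).comp
          ((1 : ℝ →L[ℝ] ℝ).smulRight (unitVec F ρ (γ s)))) s :=
      ((h.mdifferentiableAt (γ s)).hasMFDerivAt.comp s h1).hasFDerivAt
    have h3 : HasDerivAt (fun s => ρ (γ s)) (√(𝔟 (ρ (γ s)))) s := by
      refine h2.hasDerivAt.congr_deriv ?_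
      rw [← h.differential_unitGrad (h.regular _ hm)]
      change differential ρ (γ s) ((1 : ℝ) • unitVec F ρ (γ s)) = _
      rw [one_smul]
      rfl
    refine ((hs.hasDerivAt_travelTime hm).comp s h3).congr_deriv ?_
    exact one_div_mul_cancel (Real.sqrt_pos.2 (hs.pos _ hm)).ne'
  -- Only continuity is known at the ends, where `grad ρ` may vanish; the mean value theorem needs
  -- no more. The start contributes `t = 0`.
  obtain ⟨c, hc, hc'⟩ := exists_hasDerivAt_eq_slope (fun s => travelTime 𝔟 a (ρ (γ s)))
    (fun _ => 1) hl ((h.continuous_time hs).comp_continuousOn hγ.continuousOn) hd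
  rw [hγ.start, IsFiniteTimeSpeed.travelTime_left, sub_zero, sub_zero, eq_div_iff hl.ne',
    one_mul] at hc'
  exact hc'.symm

end IsRegularTransnormal

end Geodesics

/-! ### Adapted charts, the regularity of `𝔟` and the form of the metric. -/

section MetricForm

variable {m : ℕ} {M : Type*} [TopologicalSpace M] [T2Space M] [ChartedSpace (Model (m + 1)) M]
  [IsManifold (𝓡 (m + 1)) ∞ M] {F : TangentBundle (𝓡 (m + 1)) M → ℝ} {ρ : M → ℝ} {𝔟 : ℝ → ℝ}
  {a b : ℝ} {e : OpenPartialHomeomorph M (Model (m + 1))}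

/-- The metric tensor of the gradient direction, divided by `𝔟 ∘ ρ`. -/
def reducedMetric (F : TangentBundle (𝓡 (m + 1)) M → ℝ) (ρ : M → ℝ) (𝔟 : ℝ → ℝ) (x : M) :
    TangentSpace (𝓡 (m + 1)) x →L[ℝ] TangentSpace (𝓡 (m + 1)) x →L[ℝ] ℝ :=
  show Model (m + 1) →L[ℝ] Model (m + 1) →L[ℝ] ℝ from
    (𝔟 (ρ x))⁻¹ • fundamentalTensor (fiberF F x) (grad F ρ x)

theorem reducedMetric_apply (x : M) (v w : Model (m + 1)) :
    reducedMetric F ρ 𝔟 x v w =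
      (𝔟 (ρ x))⁻¹ * fundamentalTensor (fiberF F x) (grad F ρ x) v w := rfl

namespace IsRegularTransnormal

variable (h : IsRegularTransnormal F ρ 𝔟 a b) (hs : IsFiniteTimeSpeed 𝔟 a b)
include h hs

/-- The horizontal geodesic over `[0, T]` through `x`, cut off at time `t(x)`, is the required
witness. -/
theorem isAdaptedChart_of_isFlowBox (hc : IsComplete F) (he : IsFlowBox F ρ 𝔟 a b e) :
    IsAdaptedChart F ρ a b e where
  mem_atlas := he.mem_atlas
  regular := he.regular
  coordVec_zero := he.coordVec_zero
  parameter x hx := by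
    have hρ := he.regular x hx
    have ht := (hs.travelTime_mem_Ioo (h.mem_Icc x)).2 hρ
    obtain ⟨γ, hγ, hγx, -⟩ := h.exists_isHorizontalGeodesic hs hc hρ
    rw [he.time x hx]
    exact ⟨ht.1, γ, ⟨hγ.continuousOn.mono (Icc_subset_Icc_right ht.2.le), hγ.start,
      fun s hs' => hγ.mem s ⟨hs'.1, hs'.2.trans ht.2⟩,
      hγ.integralCurve.mono (Ioo_subset_Ioo_right ht.2.le)⟩, hγx⟩

/-- The first coordinate is the parameter of some horizontal geodesic ending at the point, and that
parameter is always the travel time. Hence it does not depend on the chart. -/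
theorem isFlowBox_of_isAdaptedChart (he : IsAdaptedChart F ρ a b e) :
    IsFlowBox F ρ 𝔟 a b e where
  mem_atlas := he.mem_atlas
  regular := he.regular
  coordVec_zero := he.coordVec_zero
  time x hx := by
    obtain ⟨h0, γ, hγ, hγx⟩ := he.parameter x hx
    have h1 := h.time_eq_of_isHorizontalGeodesic hs h0 hγ
    rw [hγx] at h1
    exact h1.symm

/-- `𝔟 ∘ ρ = F(grad ρ)²` is smooth on the regular set. Along a flow line `ρ` is the travel position,
so `𝔟` composed with the motion is differentiable, and this passes to `𝔟` through the differentiable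
travel time. -/
theorem differentiableAt_speed {τ : ℝ} (hτ : τ ∈ Ioo 0 (travelTime 𝔟 a b)) :
    DifferentiableAt ℝ 𝔟 (travelPosition 𝔟 a b τ) := by
  refine hs.differentiableAt_of_comp_travelPosition hτ ?_
  have hr := hs.travelPosition_mem_Ioo hτ
  obtain ⟨x, hx⟩ := h.exists_eq (Ioo_subset_Icc_self hr)
  have htx : travelTime 𝔟 a (ρ x) = τ := by
    rw [hx, hs.travelTime_travelPosition (Ioo_subset_Icc_self hτ)]
  obtain ⟨e, he, hxe⟩ := h.exists_isFlowBox hs (x₀ := x) (by rw [hx]; exact hr)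
  have hcτ : flowLine ρ 𝔟 a e x τ = e x := by rw [← htx, flowLine_time]
  have hreg : ∀ s ∈ flowLine ρ 𝔟 a e x ⁻¹' e.target,
      flowLine ρ 𝔟 a e x s ∈ regularTarget ρ a b e := fun s hs' =>
    ⟨hs', he.regular _ (e.map_target hs')⟩
  have hτ' : τ ∈ flowLine ρ 𝔟 a e x ⁻¹' e.target := by
    rw [mem_preimage, hcτ]; exact e.map_source hxe
  have h1 : DifferentiableAt ℝ
      ((fun u => localF F e (u, localGrad F ρ e u) ^ 2) ∘ flowLine ρ 𝔟 a e x) τ :=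
    DifferentiableAt.comp τ
      (((h.contDiffAt_localF_localGrad he.mem_atlas (hreg τ hτ')).pow 2).differentiableAt (by simp))
      (hasDerivAt_flowLine x τ).differentiableAt
  refine h1.congr_of_eventuallyEq ?_
  filter_upwards [(isOpen_preimage_flowLine x).mem_nhds hτ'] with s hs'
  have h2 := ((he.isHorizontalOn_flowLine hxe) s hs').2.2
  simp only [Function.comp_apply]
  rw [h.localF_localGrad_sq he.mem_atlas (hreg s hs')]
  congr 1
  rw [← h2]
  simp only [h2]
  rw [← hs.travelPosition_travelTime (h.mem_Icc (e.symm (flowLine ρ 𝔟 a e x s))), h2]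

theorem deriv_travelPosition_sq {x : M} (hx : ρ x ∈ Ioo a b) :
    deriv (travelPosition 𝔟 a b) (travelTime 𝔟 a (ρ x)) ^ 2 = 𝔟 (ρ x) := by
  rw [(hs.hasDerivAt_travelPosition ((hs.travelTime_mem_Ioo (h.mem_Icc x)).2 hx)).deriv,
    hs.travelPosition_travelTime (h.mem_Icc x), Real.sq_sqrt (hs.pos _ hx).le]

omit hs in
theorem mul_reducedMetric {x : M} (hx : ρ x ∈ Ioo a b) (v w : Model (m + 1)) :
    𝔟 (ρ x) * reducedMetric F ρ 𝔟 x v w = gradMetric F ρ x v w := by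
  rw [reducedMetric_apply, mul_inv_cancel_left₀ (h.speed_pos hx).ne']
  rfl

omit hs in
theorem reducedMetric_symm {x : M} (hx : ρ x ∈ Ioo a b) (v w : Model (m + 1)) :
    reducedMetric F ρ 𝔟 x v w = reducedMetric F ρ 𝔟 x w v := by
  rw [reducedMetric_apply, reducedMetric_apply,
    (isMinkowskiNorm_fiberF h.finsler x).symm (grad_spec h.finsler (h.regular x hx)).1]

omit hs in
theorem reducedMetric_pos {x : M} (hx : ρ x ∈ Ioo a b) {v : Model (m + 1)} (hv : v ≠ 0) :
    0 < reducedMetric F ρ 𝔟 x v v := by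
  rw [reducedMetric_apply]
  exact mul_pos (inv_pos.2 (h.speed_pos hx)) ((isMinkowskiNorm_fiberF h.finsler x).posDef _ _
    (grad_spec h.finsler (h.regular x hx)).1 hv)

omit hs in
/-- The components of the reduced metric are smooth. -/
theorem contMDiffOn_reducedMetric (he : e ∈ IsManifold.maximalAtlas (𝓡 (m + 1)) ∞ M)
    (hreg : ∀ x ∈ e.source, ρ x ∈ Ioo a b) (i j : Fin (m + 1)) :
    ContMDiffOn (𝓡 (m + 1)) 𝓘(ℝ, ℝ) ∞
      (fun x => reducedMetric F ρ 𝔟 x (coordVec e i x) (coordVec e j x)) e.source := by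
  have hreg' : ∀ u ∈ e.target, u ∈ regularTarget ρ a b e := fun u hu =>
    ⟨hu, hreg _ (e.map_target hu)⟩
  let Φ : Model (m + 1) → ℝ := fun u => (localF F e (u, localGrad F ρ e u) ^ 2)⁻¹ *
    fundamentalTensor (fun w => localF F e (u, w)) (localGrad F ρ e u)
      (EuclideanSpace.single i 1) (EuclideanSpace.single j 1)
  have hΦ : ContDiffOn ℝ ∞ Φ e.target := by
    intro u hu
    have hu' := hreg' u hu
    have h0 := localGrad_ne_zero h.finsler he hu (h.not_isCriticalPoint hu')
    have h1 : ContDiffAt ℝ ∞ (fun u => fundamentalTensor (fun w => localF F e (u, w))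
        (localGrad F ρ e u)) u :=
      ContDiffAt.comp u
        (g := fun p : Model (m + 1) × Model (m + 1) =>
          fundamentalTensor (fun w => localF F e (p.1, w)) p.2)
        (f := fun u => (u, localGrad F ρ e u))
        (contDiffAt_fundamentalTensor_localF h.finsler he hu h0)
        (contDiffAt_id.prodMk (contDiffAt_localGrad h.finsler he h.transnormal.smooth hu
          (h.not_isCriticalPoint hu')))
    exact ((((h.contDiffAt_localF_localGrad he hu').pow 2).inv
      (pow_pos (h.localF_localGrad_pos he hu') 2).ne').mul
      ((h1.clm_apply contDiffAt_const).clm_apply contDiffAt_const)).contDiffWithinAt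
  refine ((contMDiffOn_iff_contDiffOn.2 hΦ).comp (contMDiffOn_of_mem_maximalAtlas he)
    e.mapsTo).congr fun x hx => ?_
  have hu := e.map_source hx
  have h2 := fundamentalTensor_localF h.finsler he hu
    (localGrad_ne_zero h.finsler he hu (h.not_isCriticalPoint (hreg' _ hu)))
    (EuclideanSpace.single i 1) (EuclideanSpace.single j 1)
  simp only [Function.comp_apply, Φ]
  rw [h2, h.localF_localGrad_sq he (hreg' _ hu), frame_localGrad he hu, e.left_inv hx]
  rfl

/-- The normalised gradient is dual to the first coordinate. -/
theorem gradMetric_unitGrad (he : IsFlowBox F ρ 𝔟 a b e) {x : M} (hx : x ∈ e.source)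
    (w : Model (m + 1)) :
    fundamentalTensor (fiberF F x) (grad F ρ x) (unitVec F ρ x) w = coframe e x w 0 := by
  have hρ := he.regular x hx
  have hu := e.map_source hx
  have hu' : e x ∈ regularTarget ρ a b e :=
    ⟨hu, by rw [mem_preimage, e.left_inv hx]; exact hρ⟩
  have hg := grad_spec h.finsler (h.regular x hρ)
  -- The differential of `t` is computed twice: as `dρ / F(grad ρ)` and as the projection to the
  -- first coordinate of the flow box.
  have h1 := h.hasFDerivAt_localTime hs he.mem_atlas hu'
  have h2 : localTime ρ 𝔟 a e =ᶠ[𝓝 (e x)] (EuclideanSpace.proj 0 : Model (m + 1) →L[ℝ] ℝ) := by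
    filter_upwards [e.open_target.mem_nhds hu] with u hu
    rw [localTime, ← he.time _ (e.map_target hu), e.right_inv hu]
    rfl
  have h3 := DFunLike.congr_fun (h1.unique
    ((EuclideanSpace.proj 0 : Model (m + 1) →L[ℝ] ℝ).hasFDerivAt.congr_of_eventuallyEq h2))
    (coframe e x w)
  rw [(hasFDerivAt_comp_symm he.mem_atlas hu (h.mdifferentiableAt _)).fderiv,
    localF_localGrad he.mem_atlas hu, e.left_inv hx] at h3
  have h4 : (fiberF F x (grad F ρ x))⁻¹ * differential ρ x (frame e (e x) (coframe e x w)) =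
    coframe e x w 0 := h3
  rw [frame_coframe he.mem_atlas hx] at h4
  rw [← h4]
  have h5 : ∀ (y : Model (m + 1)) (c : ℝ), y ≠ 0 → fundamentalTensor (fiberF F x) y (c • y) w =
      c * legendre (fiberF F x) y w := fun y c hy => by
    rw [map_smul, (isMinkowskiNorm_fiberF h.finsler x).fundamentalTensor_self hy]
    rfl
  exact (h5 _ _ hg.1).trans (congrArg (fun ξ : Model (m + 1) →L[ℝ] ℝ =>
    (fiberF F x (grad F ρ x))⁻¹ * ξ w) hg.2)

/-- Let `X i` be the coordinate fields. Since `g (X 0)` is the first coordinate differential, `g(X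
0, X 0) = 1` and `g(X 0, X i) = 0` for `i > 0`, so the expansion in this basis has no mixed terms.
-/
theorem gradMetric_eq (he : IsFlowBox F ρ 𝔟 a b e) {x : M} (hx : x ∈ e.source)
    (v w : Model (m + 1)) :
    gradMetric F ρ x v w = coordDiff e 0 x v * coordDiff e 0 x w +
      𝔟 (ρ x) * ∑ i : Fin m, ∑ j : Fin m,
        reducedMetric F ρ 𝔟 x (coordVec e i.succ x) (coordVec e j.succ x) *
          coordDiff e i.succ x v * coordDiff e j.succ x w := by
  have hρ := he.regular x hx
  set g := fundamentalTensor (fiberF F x) (grad F ρ x) with hg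
  let X : Fin (m + 1) → Model (m + 1) := fun i => frame e (e x) (EuclideanSpace.single i 1)
  have hX0 : X 0 = unitVec F ρ x := he.coordVec_zero x hx
  have hgX : ∀ w, g (X 0) w = coframe e x w 0 := fun w => by
    rw [hX0]; exact h.gradMetric_unitGrad hs he hx w
  have hsymm : ∀ v w, g v w = g w v :=
    (isMinkowskiNorm_fiberF h.finsler x).symm (grad_spec h.finsler (h.regular x hρ)).1
  have hXc : ∀ i : Fin m, coframe e x (X i.succ) 0 = 0 := fun i => by
    have h1 := coframe_frame he.mem_atlas (e.map_source hx) (EuclideanSpace.single i.succ (1 : ℝ))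
    rw [e.left_inv hx] at h1
    rw [show coframe e x (X i.succ) = _ from h1]
    simp
  have hdec : ∀ v : Model (m + 1), v = coframe e x v 0 • X 0 +
      ∑ i : Fin m, coframe e x v i.succ • X i.succ := fun v => by
    rw [← Fin.sum_univ_succ (fun i => coframe e x v i • X i)]
    conv_lhs => rw [← frame_coframe he.mem_atlas hx v]
    have h1 : coframe e x v = ∑ i, coframe e x v i • EuclideanSpace.single i (1 : ℝ) := by
      ext k
      simp [Pi.single_apply]
    conv_lhs => rw [h1]
    simp only [map_sum, map_smul, X]
  have key : g v w = coframe e x v 0 * coframe e x w 0 +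
      ∑ i : Fin m, ∑ j : Fin m, g (X i.succ) (X j.succ) * coframe e x v i.succ *
        coframe e x w j.succ := by
    conv_lhs => rw [hdec v]
    rw [map_add, map_smul, map_sum, add_apply, smul_apply, hgX, smul_eq_mul, sum_apply]
    congr 1
    refine Finset.sum_congr rfl fun i _ => ?_
    rw [map_smul, smul_apply, smul_eq_mul]
    conv_lhs => rw [hdec w]
    rw [map_add, map_smul, map_sum, hsymm (X i.succ) (X 0), hgX, hXc, smul_zero, zero_add,
      Finset.mul_sum]
    refine Finset.sum_congr rfl fun j _ => ?_
    rw [map_smul, smul_eq_mul]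
    ring
  refine Eq.trans key ?_
  congr 1
  rw [Finset.mul_sum]
  refine Finset.sum_congr rfl fun i _ => ?_
  rw [Finset.mul_sum]
  refine Finset.sum_congr rfl fun j _ => ?_
  rw [← mul_assoc, ← mul_assoc]
  exact congrArg (· * coordDiff e i.succ x v * coordDiff e j.succ x w)
    (h.mul_reducedMetric hρ (X i.succ) (X j.succ)).symm

end IsRegularTransnormal

end MetricForm

end FinslerTransnormal

end

/-! ### The main theorem. -/

theorem mainTheorem9 {m : ℕ} {M : Type*} [TopologicalSpace M] [T2Space M]
    [SecondCountableTopology M] [ConnectedSpace M]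
    [ChartedSpace (FinslerTransnormal.Model (m + 1)) M] [IsManifold (𝓡 (m + 1)) ∞ M]
    (F : TangentBundle (𝓡 (m + 1)) M → ℝ) (hF : FinslerTransnormal.IsFinslerStructure F)
    (hcomplete : FinslerTransnormal.IsComplete F)
    (ρ : M → ℝ) (𝔟 : ℝ → ℝ) (a b : ℝ) (hab : a < b)
    (hρ : FinslerTransnormal.IsTransnormal F ρ 𝔟) (hrange : range ρ = Icc a b)
    (hcrit : ∀ x, ρ x ∈ Ioo a b → ¬ FinslerTransnormal.IsCriticalPoint (m + 1) ρ x) :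
    -- the integral over `[a, b]` converges
    IntervalIntegrable (fun s => 1 / √(𝔟 s)) volume a b ∧
    -- adapted coordinates exist around every point of `ρ⁻¹(a, b)`
    (∀ x, ρ x ∈ Ioo a b → ∃ e : OpenPartialHomeomorph M (FinslerTransnormal.Model (m + 1)),
      FinslerTransnormal.IsAdaptedChart F ρ a b e ∧ x ∈ e.source) ∧
    ∃ (t : M → ℝ) (r : ℝ → ℝ),
      -- `t` is the first coordinate of every adapted chart, continuously extended to `M`
      (∀ e : OpenPartialHomeomorph M (FinslerTransnormal.Model (m + 1)),
        FinslerTransnormal.IsAdaptedChart F ρ a b e → ∀ x ∈ e.source, e x 0 = t x) ∧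
      Continuous t ∧
      -- it is the parameter on `[0, ∫ₐᵇ ds/√𝔟]` of the horizontal geodesics
      (∀ x, ρ x ∈ Ioo a b → ∃ γ : ℝ → M,
        FinslerTransnormal.IsHorizontalGeodesic F ρ a b γ (∫ s in a..b, 1 / √(𝔟 s)) ∧
        γ (t x) = x ∧ ∀ τ ∈ Icc 0 (∫ s in a..b, 1 / √(𝔟 s)), t (γ τ) = τ) ∧
      -- (a) the level sets of `ρ` are the sets `t = const`
      range t = Icc 0 (∫ s in a..b, 1 / √(𝔟 s)) ∧
      (∀ c ∈ Icc a b, ρ ⁻¹' {c} = t ⁻¹' {∫ s in a..c, 1 / √(𝔟 s)}) ∧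
      -- (b) `ρ` is a function of `t`, and `ρ'' = 𝔟'(ρ) / 2`
      (∀ x, ρ x = r (t x)) ∧
      (∀ τ ∈ Ioo 0 (∫ s in a..b, 1 / √(𝔟 s)),
        DifferentiableAt ℝ r τ ∧ DifferentiableAt ℝ 𝔟 (r τ) ∧
        HasDerivAt (deriv r) (1 / 2 * deriv 𝔟 (r τ)) τ) ∧
      -- (c) the metric form
      ∃ f : ∀ x : M, TangentSpace (𝓡 (m + 1)) x →L[ℝ] TangentSpace (𝓡 (m + 1)) x →L[ℝ] ℝ,
        -- `f` is a metric tensor on the regular level sets, and `ρ'² f` is the induced one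
        (∀ x, ρ x ∈ Ioo a b → ∀ v w : TangentSpace (𝓡 (m + 1)) x,
          FinslerTransnormal.differential ρ x v = 0 →
          FinslerTransnormal.differential ρ x w = 0 →
          f x v w = f x w v ∧ (v ≠ 0 → 0 < f x v v) ∧
          deriv r (t x) ^ 2 * f x v w = FinslerTransnormal.gradMetric F ρ x v w) ∧
        (∀ e : OpenPartialHomeomorph M (FinslerTransnormal.Model (m + 1)),
          FinslerTransnormal.IsAdaptedChart F ρ a b e →
          (∀ i j : Fin m, ContMDiffOn (𝓡 (m + 1)) 𝓘(ℝ, ℝ) ∞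
            (fun x => f x (FinslerTransnormal.coordVec e i.succ x)
              (FinslerTransnormal.coordVec e j.succ x)) e.source) ∧
          ∀ x ∈ e.source, ∀ v w : TangentSpace (𝓡 (m + 1)) x,
            FinslerTransnormal.gradMetric F ρ x v w =
              FinslerTransnormal.coordDiff e 0 x v * FinslerTransnormal.coordDiff e 0 x w +
              deriv r (t x) ^ 2 * ∑ i : Fin m, ∑ j : Fin m,
                f x (FinslerTransnormal.coordVec e i.succ x)
                  (FinslerTransnormal.coordVec e j.succ x) *
                FinslerTransnormal.coordDiff e i.succ x v *
                FinslerTransnormal.coordDiff e j.succ x w) := by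
  have h : FinslerTransnormal.IsRegularTransnormal F ρ 𝔟 a b := ⟨hF, hρ, hab, hrange, hcrit⟩
  have hs := h.isFiniteTimeSpeed
  have hinj : ∀ x, ∀ c ∈ Icc a b, FinslerTransnormal.travelTime 𝔟 a (ρ x) =
      FinslerTransnormal.travelTime 𝔟 a c ↔ ρ x = c := fun x c hc =>
    hs.strictMonoOn_travelTime.injOn.eq_iff (h.mem_Icc x) hc
  -- The witnesses are `t = ∫_a^ρ ds/√𝔟`, its inverse motion as `r`, and `g_{grad ρ} / 𝔟(ρ)` as `f`,
  -- where `𝔟(ρ) = r'(t)²` on regular points.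
  refine ⟨hs.integrable, fun x hx => ?_, fun x => FinslerTransnormal.travelTime 𝔟 a (ρ x),
    FinslerTransnormal.travelPosition 𝔟 a b, fun e he =>
      (h.isFlowBox_of_isAdaptedChart hs he).time, h.continuous_time hs,
    fun x hx => h.exists_isHorizontalGeodesic hs hcomplete hx, ?_, fun c hc => ?_,
    fun x => (hs.travelPosition_travelTime (h.mem_Icc x)).symm, fun τ hτ => ?_,
    FinslerTransnormal.reducedMetric F ρ 𝔟, fun x hx v w _ _ => ?_, fun e he => ?_⟩
  · obtain ⟨e, he, hxe⟩ := h.exists_isFlowBox hs hx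
    exact ⟨e, h.isAdaptedChart_of_isFlowBox hs hcomplete he, hxe⟩
  · have h1 := range_comp (FinslerTransnormal.travelTime 𝔟 a) ρ
    rw [hrange, hs.image_travelTime] at h1
    exact h1
  · ext x
    exact (hinj x c hc).symm
  · exact ⟨(hs.hasDerivAt_travelPosition hτ).differentiableAt, h.differentiableAt_speed hs hτ,
      hs.hasDerivAt_deriv_travelPosition hτ (h.differentiableAt_speed hs hτ)⟩
  · refine ⟨h.reducedMetric_symm hx v w, fun hv => h.reducedMetric_pos hx hv, ?_⟩
    rw [h.deriv_travelPosition_sq hs hx]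
    exact h.mul_reducedMetric hx v w
  · have hbox := h.isFlowBox_of_isAdaptedChart hs he
    refine ⟨fun i j => h.contMDiffOn_reducedMetric he.mem_atlas he.regular i.succ j.succ,
      fun x hx v w => ?_⟩
    rw [h.deriv_travelPosition_sq hs (he.regular x hx)]
    exact h.gradMetric_eq hs hbox hx v w
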